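/- \textbf{Definitions.} Graphs are simple, undirected and unweighted; $d_G$ is the shortest-path distance, with $d_G=\infty$ between different components. A \emph{$c$-embedding into the line} of a space $(S,d)$ is an injection $f:S\to\mathbb{R}$ with \[\sup_{x\ne y}\frac{|f(x)-f(y)|}{d(x,y)}\cdot\sup_{x\neq y}\frac{d(x,y)}{|f(x)-f(y)|}\le c,\] where both suprema range over the pairs at finite distance. A graph $G$ \emph{admits a $(k,c)$-embedding into the line} if there is $K\subseteq V(G)$ with $|K|\le k$ such that $V(G)\setminus K$ has a $c$-embedding into the line; here $V(G)\setminus K$ may be given either the shortest-path distance $d_{G\setminus K}$ of the remaining graph or the restriction of $d_G$, and the statements below hold for both conventions: ``does not admit'' means under neither of them, ``admits'' means under at least one of them. For real $R>0$, an \emph{$R$-net} of $G$ is a set $N\subseteq V(G)$ whose distinct points are at distance greater than $R$ and such that every vertex is within distance $R$ of $N$. An \emph{$R$-partition} of $G$ centered at an $R$-net $N$ is a Voronoi partition centered at $N$, i.e. a partition $\mathcal{P}$ of $V(G)$ in which every cluster contains exactly one point of $N$, the cluster of each vertex $v$ contains a nearest neighbour of $v$ in $N$, and every cluster induces a connected subgraph.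 The \emph{$R$-minor} induced by $\mathcal{P}$ is the simple graph on $N$ in which two points are adjacent iff some edge of $G$ joins their clusters. A \emph{feedback vertex set} of a graph $H$ is a set $X\subseteq V(H)$ such that $H\setminus X$ is acyclic. \textbf{Lemma (Embedding into a forest).} (a) There is a polynomial-time algorithm which, given a finite graph $G$, an integer $k\ge 0$ and a rational $c\ge 1$ (with $G$ given by its adjacency matrix and $k$, $c$ in binary), terminates with exactly one of the following outcomes: (1) it correctly decides that $G$ does not admit a $(k,c)$-embedding into the line; (2) it outputs a $c$-net $N$ of $G$, a $c$-partition $\mathcal{P}$ of $G$ centered at $N$, the $c$-minor $H$ induced by $\mathcal{P}$, and a feedback vertex set $X$ of $H$ with $|X|\le 2k$. (b) Let $G$ be a graph, $k\ge 0$ an integer and $R\ge c\ge 1$ real numbers. If $G$ admits a $(k,c)$-embedding into the line, then every $R$-minor of $G$ has a feedback vertex set of size at most $k$. -/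

import Mathlib

open scoped ENNReal

noncomputable section

namespace OutlierLine

/-! ## Embeddings into the line, with outliers -/

section Embeddings

variable {α : Type*}

/-- The largest factor by which `f : α → ℝ` stretches a pair of distinct points at finite
distance.  Pairs at infinite distance (different components of a graph) do not contribute. -/
def expansion (d : α → α → ℝ≥0∞) (f : α → ℝ) : ℝ≥0∞ :=
  ⨆ (x : α) (y : α) (_ : x ≠ y ∧ d x y ≠ ⊤), ENNReal.ofReal |f x - f y| / d x y

/-- The largest factor by which `f : α → ℝ` shrinks a pair of distinct points at finite
distance. -/
def contraction (d : α → α → ℝ≥0∞) (f : α → ℝ) : ℝ≥0∞ :=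
  ⨆ (x : α) (y : α) (_ : x ≠ y ∧ d x y ≠ ⊤), d x y / ENNReal.ofReal |f x - f y|

/-- The (multiplicative) distortion of `f : α → ℝ`. -/
def distortion (d : α → α → ℝ≥0∞) (f : α → ℝ) : ℝ≥0∞ :=
  expansion d f * contraction d f

/-- The space `(α, d)` admits a `c`-embedding into the line: an injection into `ℝ` whose
distortion is at most `c`. -/
def LineEmbeds (d : α → α → ℝ≥0∞) (c : ℝ) : Prop :=
  ∃ f : α → ℝ, Function.Injective f ∧ distortion d f ≤ ENNReal.ofReal c

end Embeddings

section Graphs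

variable {V : Type*}

/-- The shortest-path distance of `G`; it is `⊤` between different components. -/
def gdist (G : SimpleGraph V) (u v : V) : ℝ≥0∞ := (G.edist u v : ℝ≥0∞)

/-- `G` admits a `(k,c)`-embedding into the line: after deleting at most `k` vertices, the
remaining graph `G ∖ K`, with its own shortest-path distance, admits a `c`-embedding. -/
def AdmitsEmbedding (G : SimpleGraph V) (k : ℕ) (c : ℝ) : Prop :=
  ∃ K : Finset V, K.card ≤ k ∧ LineEmbeds (gdist (G.induce {v | v ∉ K})) c

/-- The shortest-path metric space of `G` admits a `(k,c)`-embedding into the line: after deleting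
at most `k` points, the remaining points, with the distances `d_G` measured in the whole of `G`,
admit a `c`-embedding. -/
def MetricAdmitsEmbedding (G : SimpleGraph V) (k : ℕ) (c : ℝ) : Prop :=
  ∃ K : Finset V, K.card ≤ k ∧
    LineEmbeds (fun x y : {v | v ∉ K} => gdist G x y) c

/-! ## Nets, Voronoi partitions, minors, feedback vertex sets -/

/-- `N` is an `R`-net of `G`: distinct points of `N` are at distance more than `R`, and the
closed `R`-balls around the points of `N` cover all vertices. -/
def IsNet (G : SimpleGraph V) (R : ℝ) (N : Set V) : Prop :=
  (∀ p ∈ N, ∀ q ∈ N, p ≠ q → ENNReal.ofReal R < gdist G p q) ∧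
    ∀ v, ∃ p ∈ N, gdist G p v ≤ ENNReal.ofReal R

/-- The cluster of `P` that contains `v`. -/
def cluster (P : Setoid V) (v : V) : Set V := {w | P v w}

/-- The partition `P` is a Voronoi partition of `G` centered at `Y`. -/
structure IsVoronoiPartition (G : SimpleGraph V) (Y : Set V) (P : Setoid V) : Prop where
  /-- every cluster contains exactly one vertex of `Y` -/
  unique_center : ∀ v, ∃! y, y ∈ Y ∧ y ∈ cluster P v
  /-- the cluster of `v` contains some nearest neighbour of `v` in `Y` -/
  nearest : ∀ v, ∃ y ∈ Y, y ∈ cluster P v ∧ ∀ z ∈ Y, gdist G v y ≤ gdist G v z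
  /-- every cluster induces a connected subgraph -/
  connected : ∀ v, (G.induce (cluster P v)).Connected

/-- `P` is an `R`-partition of `G` centered at the `R`-net `N`. -/
def IsRPartition (G : SimpleGraph V) (R : ℝ) (N : Set V) (P : Setoid V) : Prop :=
  IsNet G R N ∧ IsVoronoiPartition G N P

/-- The minor of `G` obtained by contracting each cluster of `P` into its point of `N`: two
points of `N` are adjacent iff some edge of `G` joins their (different) clusters. -/
def inducedMinor (G : SimpleGraph V) (N : Set V) (P : Setoid V) : SimpleGraph N where
  Adj u v := u ≠ v ∧ ∃ x ∈ cluster P u, ∃ y ∈ cluster P v, G.Adj x y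
  symm := ⟨fun _ _ h => by
    obtain ⟨hne, x, hx, y, hy, hxy⟩ := h
    exact ⟨hne.symm, y, hy, x, hx, hxy.symm⟩⟩
  loopless := ⟨fun _ h => h.1 rfl⟩

/-- `X` is a feedback vertex set of `H`: deleting `X` leaves an acyclic graph. -/
def IsFeedbackVertexSet (H : SimpleGraph V) (X : Finset V) : Prop :=
  (H.induce {v | v ∉ X}).IsAcyclic

end Graphs

/-! ## Programs of a random access machine, with their running time

A program works on variables and on two-dimensional arrays that hold natural numbers of any size.
Running time counts every elementary operation: `+`, `-`, `<`, `=`, constants, reads, writes and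
tests cost `1`; a multiplication or a division also costs the bit lengths of its operands.  So in
`t` steps the bit length of the largest number grows by at most a constant (that depends only on
the program) times `t`, and polynomial time here is polynomial time on a Turing machine. -/

/-- The contents of the memory: `var i` is the `i`-th variable, `arr a i j` is the entry `(i, j)` of
the `a`-th array. -/
structure Mem where
  var : ℕ → ℕ
  arr : ℕ → ℕ → ℕ → ℕ

/-- Arithmetic expressions. -/
inductive Expr where
  | const (m : ℕ)
  | var (i : ℕ)
  | arr (a : ℕ) (e₁ e₂ : Expr)
  | add (e₁ e₂ : Expr)
  | sub (e₁ e₂ : Expr)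
  | mul (e₁ e₂ : Expr)
  | div (e₁ e₂ : Expr)
  | lt (e₁ e₂ : Expr)
  | eq (e₁ e₂ : Expr)

/-- The value of an expression: `sub` is truncated, `div` rounds down, `lt` and `eq` give
`1` for true and `0` for false. -/
def Expr.eval (s : Mem) : Expr → ℕ
  | .const m => m
  | .var i => s.var i
  | .arr a e₁ e₂ => s.arr a (e₁.eval s) (e₂.eval s)
  | .add e₁ e₂ => e₁.eval s + e₂.eval s
  | .sub e₁ e₂ => e₁.eval s - e₂.eval s
  | .mul e₁ e₂ => e₁.eval s * e₂.eval s
  | .div e₁ e₂ => e₁.eval s / e₂.eval s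
  | .lt e₁ e₂ => if e₁.eval s < e₂.eval s then 1 else 0
  | .eq e₁ e₂ => if e₁.eval s = e₂.eval s then 1 else 0

/-- The time it takes to evaluate an expression; `Nat.size` is the bit length. -/
def Expr.cost (s : Mem) : Expr → ℕ
  | .const _ => 1
  | .var _ => 1
  | .arr _ e₁ e₂ => e₁.cost s + e₂.cost s + 1
  | .add e₁ e₂ => e₁.cost s + e₂.cost s + 1
  | .sub e₁ e₂ => e₁.cost s + e₂.cost s + 1
  | .mul e₁ e₂ => e₁.cost s + e₂.cost s + (e₁.eval s).size + (e₂.eval s).size + 1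
  | .div e₁ e₂ => e₁.cost s + e₂.cost s + (e₁.eval s).size + (e₂.eval s).size + 1
  | .lt e₁ e₂ => e₁.cost s + e₂.cost s + 1
  | .eq e₁ e₂ => e₁.cost s + e₂.cost s + 1

/-- Programs. -/
inductive Prog where
  | skip
  | assign (i : ℕ) (e : Expr)
  | store (a : ℕ) (e₁ e₂ e : Expr)
  | seq (p q : Prog)
  | ite (e : Expr) (p q : Prog)
  | while (e : Expr) (p : Prog)

/-- Write the number `m` to the variable `i`. -/
def Mem.setVar (s : Mem) (i m : ℕ) : Mem :=
  { s with var := fun i' => if i' = i then m else s.var i' }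

/-- Write the number `m` to the entry `(i, j)` of the array `a`. -/
def Mem.setArr (s : Mem) (a i j m : ℕ) : Mem :=
  { s with arr := fun a' i' j' => if a' = a ∧ i' = i ∧ j' = j then m else s.arr a' i' j' }

/-- `Exec p s t s'`: started on the memory `s`, the program `p` halts after time `t` with memory
`s'`.  A test succeeds if its value is not `0`. -/
inductive Exec : Prog → Mem → ℕ → Mem → Prop
  | skip (s : Mem) : Exec .skip s 1 s
  | assign (i : ℕ) (e : Expr) (s : Mem) :
      Exec (.assign i e) s (e.cost s + 1) (s.setVar i (e.eval s))
  | store (a : ℕ) (e₁ e₂ e : Expr) (s : Mem) :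
      Exec (.store a e₁ e₂ e) s (e₁.cost s + e₂.cost s + e.cost s + 1)
        (s.setArr a (e₁.eval s) (e₂.eval s) (e.eval s))
  | seq {p q : Prog} {s s' s'' : Mem} {t t' : ℕ} (hp : Exec p s t s') (hq : Exec q s' t' s'') :
      Exec (.seq p q) s (t + t') s''
  | ite_true {e : Expr} {p : Prog} (q : Prog) {s s' : Mem} {t : ℕ} (he : e.eval s ≠ 0)
      (hp : Exec p s t s') : Exec (.ite e p q) s (e.cost s + t + 1) s'
  | ite_false {e : Expr} (p : Prog) {q : Prog} {s s' : Mem} {t : ℕ} (he : e.eval s = 0)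
      (hq : Exec q s t s') : Exec (.ite e p q) s (e.cost s + t + 1) s'
  | while_true {e : Expr} {p : Prog} {s s' s'' : Mem} {t t' : ℕ} (he : e.eval s ≠ 0)
      (hp : Exec p s t s') (hw : Exec (.while e p) s' t' s'') :
      Exec (.while e p) s (e.cost s + t + t' + 1) s''
  | while_false {e : Expr} (p : Prog) {s : Mem} (he : e.eval s = 0) :
      Exec (.while e p) s (e.cost s + 1) s

/-! ## Input and output -/

open Classical in
/-- The memory that holds the input `(G, k, c)`: variables `0`, `1`, `2`, `3` hold `n`, `k`, the
numerator and the denominator of `c`, array `0` holds the adjacency matrix of `G`, and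
everything else is `0`. -/
def inputMem {n : ℕ} (G : SimpleGraph (Fin n)) (k : ℕ) (c : ℚ) : Mem where
  var i := if i = 0 then n else if i = 1 then k else if i = 2 then c.num.toNat
    else if i = 3 then c.den else 0
  arr a i j := if a = 0 ∧ ∃ (hi : i < n) (hj : j < n), G.Adj ⟨i, hi⟩ ⟨j, hj⟩ then 1 else 0

/-- The number of bits of the input: the adjacency matrix, and `k` and `c` in binary. -/
def inputSize (n k : ℕ) (c : ℚ) : ℕ :=
  n * n + k.size + c.num.toNat.size + c.den.size

/-- The objects that a successful run outputs. -/
structure Output (n : ℕ) where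
  /-- the net -/
  net : Set (Fin n)
  /-- the partition of the vertex set -/
  partition : Setoid (Fin n)
  /-- the minor, a graph on the net -/
  minor : SimpleGraph net
  /-- the feedback vertex set of the minor -/
  fvs : Finset net

/-- The memory `s` holds the answer that no embedding exists. -/
def AnswersNo (s : Mem) : Prop := s.var 0 = 0

/-- The memory `s` holds the output `o`: variable `0` is the success flag; column `0` of array `1`
is the indicator of the net, column `0` of array `2` labels each vertex by its cluster, array `3`
is the adjacency matrix of the minor, and column `0` of array `4` is the indicator of the feedback
vertex set. -/
structure Outputs {n : ℕ} (s : Mem) (o : Output n) : Prop where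
  flag : s.var 0 = 1
  net : ∀ v : Fin n, s.arr 1 v 0 ≠ 0 ↔ v ∈ o.net
  partition : ∀ u v : Fin n, s.arr 2 u 0 = s.arr 2 v 0 ↔ o.partition u v
  minor : ∀ u v : o.net, s.arr 3 (u : Fin n) (v : Fin n) ≠ 0 ↔ o.minor.Adj u v
  fvs : ∀ v : o.net, s.arr 4 (v : Fin n) 0 ≠ 0 ↔ v ∈ o.fvs

end OutlierLine

end

/-! Part (b). Let `X` consist of the net points whose clusters meet the deleted set `K`, so that
`|X| ≤ k`, and put every other net point where the `c`-embedding `f` of the remaining vertices puts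
it. Suppose an edge `xy` of `G ∖ K` jumps over such a point `b` of the same component, and neither
end lies in the cluster of `b`. The distortion bound gives `d(x,b) + d(y,b) ≤ c`. But both distances
exceed `R/2`, since `x` and `y` are at least as close to their own centers as to `b`, and centers
are more than `R` apart (`no_crossing`). Hence a walk of the remaining minor that avoids `b` cannot
pass from one side of `b` to the other (`exists_line_order`). A cycle, or a vertex with three
neighbours, would contain such a walk around a middle point. So the remaining minor is acyclic with
all degrees at most two, a linear forest (`minor_of_embeddable`).

Part (a). A greedy net and the labelling by first nearest net points give a `c`-partition. A local
ratio algorithm then finds a feedback vertex set of the minor. By (b), it only has to compete with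
sets `F` whose removal leaves a linear forest, and this makes the weights `degree - 1` sufficient.
The algorithm prunes vertices of degree at most one, subtracts the largest possible multiple of
`degree - 1` from the weights, sets aside a vertex of weight zero, and repeats. Going backwards, it
takes a set-aside vertex only if a cycle would remain otherwise, so the solution is minimal in every
pruned graph. The inequality behind the factor two is `sum_degIn_sub_one_le`, and
`LocalRatioRun.card_le_two_mul` is its outcome. If the result has more than `2k` points, no `F` of
size `k` exists, hence no embedding.

Running time. The algorithm is written in a small language whose loops and sums all have length `n`
and which has no multiplication. `HCmd.halts_compile` and `exists_prog` translate it to machine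
programs whose time is bounded by a polynomial in `n` alone, because `k` and the parts of `c` enter
only through unit-cost operations. -/

noncomputable section
namespace OutlierLine

/-! ## Acyclicity through minimum degrees -/

section ThickFree

variable {V W : Type*}

open Classical in
/-- The degree of `v` into the finite set `U`. -/
def degIn (H : SimpleGraph V) (U : Finset V) (v : V) : ℕ := (U.filter (H.Adj v)).card

/-- Every nonempty subset of `U` has a vertex of degree at most one in it. -/
def ThickFree (H : SimpleGraph V) (U : Finset V) : Prop :=
  ∀ S ⊆ U, S.Nonempty → ∃ v ∈ S, degIn H S v ≤ 1

theorem degIn_mono (H : SimpleGraph V) {S U : Finset V} (h : S ⊆ U) (v : V) :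
    degIn H S v ≤ degIn H U v := by
  classical
  exact Finset.card_le_card (Finset.filter_subset_filter _ h)

theorem ThickFree.mono {H : SimpleGraph V} {U U' : Finset V} (h : ThickFree H U) (hU : U' ⊆ U) :
    ThickFree H U' := fun S hS hne => h S (hS.trans hU) hne

theorem two_le_degIn {H : SimpleGraph V} {U : Finset V} {v a b : V} (hab : a ≠ b) (ha : a ∈ U)
    (hb : b ∈ U) (hva : H.Adj v a) (hvb : H.Adj v b) : 2 ≤ degIn H U v := by
  classical
  have : ({a, b} : Finset V) ⊆ U.filter (H.Adj v) := by
    intro z hz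
    simp only [Finset.mem_insert, Finset.mem_singleton] at hz
    rcases hz with rfl | rfl <;> simp [*]
  simpa [degIn, Finset.card_pair hab] using Finset.card_le_card this

theorem degIn_map (H : SimpleGraph V) (H' : SimpleGraph W) (e : V ↪ W) (S : Finset V)
    (hH : ∀ u ∈ S, ∀ v ∈ S, H.Adj u v ↔ H'.Adj (e u) (e v)) {v : V} (hv : v ∈ S) :
    degIn H' (S.map e) (e v) = degIn H S v := by
  classical
  unfold degIn
  rw [Finset.filter_map, Finset.card_map]
  congr 1
  exact Finset.filter_congr fun u hu => (hH v hv u hu).symm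

/-- Carries acyclicity between induced subgraphs, the minor on the net, and its copy on `ℕ` on which
the program works. -/
theorem thickFree_map_iff (H : SimpleGraph V) (H' : SimpleGraph W) (e : V ↪ W) (U : Finset V)
    (hH : ∀ u ∈ U, ∀ v ∈ U, H.Adj u v ↔ H'.Adj (e u) (e v)) :
    ThickFree H' (U.map e) ↔ ThickFree H U := by
  classical
  constructor
  · intro h S hS hne
    obtain ⟨v, hv, hd⟩ := h (S.map e) (Finset.map_subset_map.2 hS) (hne.map)
    obtain ⟨u, hu, rfl⟩ := Finset.mem_map.1 hv
    refine ⟨u, hu, ?_⟩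
    rwa [degIn_map H H' e S (fun a ha b hb => hH a (hS ha) b (hS hb)) hu] at hd
  · intro h S hS hne
    obtain ⟨S', hS', rfl⟩ := Finset.subset_map_iff.1 hS
    obtain ⟨v, hv, hd⟩ := h S' hS' (by simpa using hne)
    refine ⟨e v, Finset.mem_map_of_mem _ hv, ?_⟩
    rwa [degIn_map H H' e S' (fun a ha b hb => hH a (hS' ha) b (hS' hb)) hv]

/-- The end of a longest path works: by maximality its neighbours lie on the path, and in an acyclic
graph only the penultimate vertex can be one. -/
theorem exists_degIn_univ_le_one [Fintype V] [Nonempty V] {H : SimpleGraph V} (h : H.IsAcyclic) :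
    ∃ v, degIn H Finset.univ v ≤ 1 := by
  classical
  obtain ⟨u, v, p, hp, hmax⟩ := SimpleGraph.Walk.exists_isPath_forall_isPath_length_le_length H
  refine ⟨v, ?_⟩
  unfold degIn
  rw [Finset.card_le_one_iff_subset_singleton]
  refine ⟨p.penultimate, fun w hw => ?_⟩
  have hvw : H.Adj v w := by simpa using hw
  have hs : w ∈ p.support := by
    by_contra hs
    have := hmax _ _ _ (hp.concat hs hvw)
    simp at this
  simpa using h.eq_penultimate_of_adj_end hp hvw hs

theorem thickFree_of_isAcyclic {H : SimpleGraph V} {s : Set V} (h : (H.induce s).IsAcyclic)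
    {U : Finset V} (hU : ∀ v ∈ U, v ∈ s) : ThickFree H U := by
  classical
  intro S hS hne
  have hac : (H.induce (S : Set V)).IsAcyclic :=
    h.comap (⟨fun x => ⟨x.1, hU _ (hS x.2)⟩, fun hab => hab⟩ :
      H.induce (S : Set V) →g H.induce s)
      (fun a b hab => Subtype.ext (congrArg (fun z : s => z.1) hab))
  have : Nonempty (S : Set V) := hne.to_subtype
  obtain ⟨v, hv⟩ := exists_degIn_univ_le_one hac
  refine ⟨v.1, v.2, ?_⟩
  have key := degIn_map (H.induce (S : Set V)) H (Function.Embedding.subtype _) Finset.univ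
    (fun u _ v _ => Iff.rfl) (Finset.mem_univ v)
  have hmap : (Finset.univ : Finset (S : Set V)).map (Function.Embedding.subtype _) = S := by
    ext z; simp
  rw [hmap] at key
  simpa using key.le.trans hv

/-- Every vertex of a cycle has two neighbours on it, so the support of a cycle is a forbidden set.
-/
theorem isAcyclic_of_thickFree {H : SimpleGraph V}
    (h : ∀ U : Finset V, ThickFree H U) : H.IsAcyclic := by
  classical
  intro u p hp
  obtain ⟨v, hv, hd⟩ := h p.support.toFinset _ subset_rfl ⟨u, by simp⟩
  rw [List.mem_toFinset] at hv
  have h2 := hp.ncard_neighborSet_toSubgraph_eq_two hv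
  obtain ⟨a, b, hab, hs⟩ := Set.ncard_eq_two.1 h2
  have mem : ∀ z ∈ p.toSubgraph.neighborSet v, z ∈ p.support ∧ H.Adj v z := fun z hz => by
    have hz' : p.toSubgraph.Adj v z := hz
    exact ⟨by simpa using hz'.symm.fst_mem, hz'.adj_sub⟩
  have ha := mem a (by simp [hs])
  have hb := mem b (by simp [hs])
  have := two_le_degIn hab (List.mem_toFinset.2 ha.1) (List.mem_toFinset.2 hb.1) ha.2 hb.2
  omega

theorem isAcyclic_induce_of_thickFree {H : SimpleGraph V} {s : Set V}
    (h : ∀ U : Finset V, (∀ v ∈ U, v ∈ s) → ThickFree H U) : (H.induce s).IsAcyclic := by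
  refine isAcyclic_of_thickFree fun U => ?_
  rw [← thickFree_map_iff (H.induce s) H (Function.Embedding.subtype _) U (fun _ _ _ _ => Iff.rfl)]
  refine h _ fun v hv => ?_
  obtain ⟨u, -, rfl⟩ := Finset.mem_map.1 hv
  exact u.2

end ThickFree

/-! ## Minors of embeddable graphs -/

section Line

variable {V : Type*} {G : SimpleGraph V} {K : Finset V}

/-- The properties shared by the two distances that `V ∖ K` may be given. -/
structure IsRemainderDist (G : SimpleGraph V) (K : Finset V)
    (d : {v | v ∉ K} → {v | v ∉ K} → ℝ≥0∞) : Prop where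
  gdist_le : ∀ x y : {v | v ∉ K}, gdist G x y ≤ d x y
  adj : ∀ x y : {v | v ∉ K}, G.Adj x y → d x y = 1
  ne_top : ∀ x y : {v | v ∉ K}, (G.induce {v | v ∉ K}).Reachable x y → d x y ≠ ⊤

theorem gdist_ne_top_iff {u v : V} : gdist G u v ≠ ⊤ ↔ G.Reachable u v := by
  rw [← SimpleGraph.edist_ne_top_iff_reachable, gdist, ne_eq, ENat.toENNReal_eq_top]

theorem gdist_comm (u v : V) : gdist G u v = gdist G v u := by
  rw [gdist, gdist, SimpleGraph.edist_comm]

theorem gdist_triangle (u v w : V) : gdist G u w ≤ gdist G u v + gdist G v w := by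
  unfold gdist
  rw [← ENat.toENNReal_add]
  exact ENat.toENNReal_le.2 SimpleGraph.edist_triangle

theorem gdist_eq_one {u v : V} (h : G.Adj u v) : gdist G u v = 1 := by
  rw [gdist, SimpleGraph.edist_eq_one_iff_adj.2 h, ENat.toENNReal_one]

theorem isRemainderDist_induce : IsRemainderDist G K (gdist (G.induce {v | v ∉ K})) where
  gdist_le x y := by
    by_cases h : (G.induce {v | v ∉ K}).Reachable x y
    · obtain ⟨p, hp⟩ := h.exists_walk_length_eq_edist
      have := SimpleGraph.edist_le (p.map (SimpleGraph.Embedding.induce {v | v ∉ K}).toHom)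
      rw [SimpleGraph.Walk.length_map, hp] at this
      exact ENat.toENNReal_le.2 this
    · rw [← gdist_ne_top_iff, not_not] at h
      rw [h]; exact le_top
  adj _ _ h := gdist_eq_one h
  ne_top _ _ h := gdist_ne_top_iff.2 h

theorem isRemainderDist_restrict : IsRemainderDist G K (fun x y => gdist G x y) where
  gdist_le _ _ := le_rfl
  adj _ _ h := gdist_eq_one h
  ne_top _ _ h := gdist_ne_top_iff.2 (h.map (SimpleGraph.Embedding.induce {v | v ∉ K}).toHom)

theorem exists_remainder {k : ℕ} {c : ℝ}
    (h : AdmitsEmbedding G k c ∨ MetricAdmitsEmbedding G k c) :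
    ∃ K : Finset V, K.card ≤ k ∧ ∃ d, IsRemainderDist G K d ∧ LineEmbeds d c := by
  rcases h with ⟨K, hK, h⟩ | ⟨K, hK, h⟩
  · exact ⟨K, hK, _, isRemainderDist_induce, h⟩
  · exact ⟨K, hK, _, isRemainderDist_restrict, h⟩

/-- As `f b` lies between `f x` and `f y`, the two gaps at `b` add up to `|f x - f y|`, which is at
most the expansion because `d x y = 1`; the contraction converts the gaps back into distances.
Finiteness is needed because pairs at infinite distance are not controlled by the distortion. -/
theorem dist_add_dist_le {α : Type*} {d : α → α → ℝ≥0∞} {f : α → ℝ} {c : ℝ}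
    (hf : distortion d f ≤ ENNReal.ofReal c) {x y b : α} (hxy : d x y = 1) (hx : d x b ≠ ⊤)
    (hy : d y b ≠ ⊤) (hxb : f x < f b) (hby : f b < f y) :
    d x b + d y b ≤ ENNReal.ofReal c := by
  have hE : ENNReal.ofReal |f x - f y| ≤ expansion d f := by
    have := le_iSup₂_of_le (f := fun x y => ⨆ (_ : x ≠ y ∧ d x y ≠ ⊤),
      ENNReal.ofReal |f x - f y| / d x y) x y
      (le_iSup_of_le ⟨fun h => (hxb.trans hby).ne (by rw [h]), by simp [hxy]⟩ le_rfl)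
    rwa [hxy, div_one] at this
  have hC : ∀ z w, d z w ≠ ⊤ → f z ≠ f w →
      d z w ≤ contraction d f * ENNReal.ofReal |f z - f w| := by
    intro z w h hne
    have := le_iSup₂_of_le (f := fun x y => ⨆ (_ : x ≠ y ∧ d x y ≠ ⊤),
      d x y / ENNReal.ofReal |f x - f y|) z w
      (le_iSup_of_le ⟨fun h => hne (by rw [h]), h⟩ le_rfl)
    rwa [ENNReal.div_le_iff (by simpa [sub_eq_zero] using hne) (by simp)] at this
  calc d x b + d y b
      ≤ contraction d f * ENNReal.ofReal |f x - f b| +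
        contraction d f * ENNReal.ofReal |f y - f b| :=
        add_le_add (hC x b hx hxb.ne) (hC y b hy hby.ne')
    _ = contraction d f * ENNReal.ofReal |f x - f y| := by
        rw [← mul_add, ← ENNReal.ofReal_add (abs_nonneg _) (abs_nonneg _),
          abs_of_neg (by linarith), abs_of_pos (by linarith), abs_of_neg (by linarith)]
        congr 2; ring
    _ ≤ contraction d f * expansion d f := by gcongr
    _ ≤ ENNReal.ofReal c := by rwa [mul_comm]

variable {N : Set V} {P : Setoid V}

/-- The center of the cluster of `v`. -/
def centerOf (hP : IsVoronoiPartition G N P) (v : V) : N :=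
  ⟨(hP.unique_center v).choose, (hP.unique_center v).choose_spec.1.1⟩

theorem centerOf_rel (hP : IsVoronoiPartition G N P) (v : V) : P v (centerOf hP v) :=
  (hP.unique_center v).choose_spec.1.2

theorem centerOf_eq (hP : IsVoronoiPartition G N P) {v : V} {p : N} (h : P v p) :
    centerOf hP v = p :=
  Subtype.ext ((hP.unique_center v).choose_spec.2 p ⟨p.2, h⟩).symm

theorem centerOf_eq_iff (hP : IsVoronoiPartition G N P) {v : V} {p : N} :
    centerOf hP v = p ↔ P v p :=
  ⟨fun h => h ▸ centerOf_rel hP v, centerOf_eq hP⟩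

theorem centerOf_self (hP : IsVoronoiPartition G N P) (p : N) : centerOf hP p = p :=
  centerOf_eq hP (P.refl _)

theorem gdist_centerOf_le (hP : IsVoronoiPartition G N P) (v : V) (z : N) :
    gdist G v (centerOf hP v) ≤ gdist G v z := by
  obtain ⟨y, hy, hvy, h⟩ := hP.nearest v
  rw [show ((centerOf hP v : N) : V) = y from
    congrArg Subtype.val (centerOf_eq hP (p := ⟨y, hy⟩) hvy)]
  exact h z z.2

open Classical in
/-- The net points whose clusters meet `K`. -/
def hitCenters (hP : IsVoronoiPartition G N P) (K : Finset V) : Finset N := K.image (centerOf hP)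

theorem not_mem_of_not_hit (hP : IsVoronoiPartition G N P) {p : N} (hp : p ∉ hitCenters hP K)
    {v : V} (hv : centerOf hP v = p) : v ∉ K := by
  classical
  exact fun h => hp (hv ▸ Finset.mem_image_of_mem _ h)

/-- Each of `x`, `y` is farther than `R / 2` from `b`: its own center is at least as near as `b`,
and the two centers are more than `R` apart. This contradicts `dist_add_dist_le`. The distance `d`
dominates `d_G`, so the argument covers both conventions for the remaining space. -/
theorem no_crossing {R c : ℝ} (hcR : c ≤ R) (hN : IsNet G R N) (hP : IsVoronoiPartition G N P)
    {d : {v | v ∉ K} → {v | v ∉ K} → ℝ≥0∞} (hd : IsRemainderDist G K d) {f : {v | v ∉ K} → ℝ}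
    (hf : distortion d f ≤ ENNReal.ofReal c) {x y : {v | v ∉ K}} {b : N} (hb : (b : V) ∉ K)
    (hxy : G.Adj x y) (hx : centerOf hP x ≠ b) (hy : centerOf hP y ≠ b)
    (hxr : (G.induce {v | v ∉ K}).Reachable ⟨b, hb⟩ x) :
    ¬ (f x < f ⟨b, hb⟩ ∧ f ⟨b, hb⟩ < f y) := by
  rintro ⟨h1, h2⟩
  have hxy' : (G.induce {v | v ∉ K}).Adj x y := hxy
  have hsum := dist_add_dist_le hf (hd.adj x y hxy) (hd.ne_top x ⟨b, hb⟩ hxr.symm)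
    (hd.ne_top y ⟨b, hb⟩ (hxr.trans hxy'.reachable).symm) h1 h2
  have far : ∀ z : {v | v ∉ K}, centerOf hP z ≠ b →
      ENNReal.ofReal R < d z ⟨b, hb⟩ + d z ⟨b, hb⟩ := by
    intro z hz
    calc ENNReal.ofReal R < gdist G (centerOf hP z) b :=
          hN.1 _ (centerOf hP z).2 _ b.2 (fun h => hz (Subtype.ext h))
      _ ≤ gdist G (centerOf hP z) z + gdist G z b := gdist_triangle _ _ _
      _ ≤ gdist G z b + gdist G z b := by
          rw [gdist_comm (G := G) (centerOf hP z : V)]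
          exact add_le_add_left (gdist_centerOf_le hP _ _) _
      _ ≤ _ := add_le_add (hd.gdist_le z ⟨b, hb⟩) (hd.gdist_le z ⟨b, hb⟩)
  have := ENNReal.add_lt_add (far x hx) (far y hy)
  rw [add_add_add_comm] at this
  have hc : ENNReal.ofReal c ≤ ENNReal.ofReal R := ENNReal.ofReal_le_ofReal hcR
  exact absurd (this.trans_le ((add_le_add hsum hsum).trans (add_le_add hc hc))) (lt_irrefl _)

theorem reachable_induce_mono {s t : Set V} (h : s ⊆ t) {x y : V} (hx : x ∈ s) (hy : y ∈ s)
    (hr : (G.induce s).Reachable ⟨x, hx⟩ ⟨y, hy⟩) :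
    (G.induce t).Reachable ⟨x, h hx⟩ ⟨y, h hy⟩ :=
  hr.map (SimpleGraph.induceHomOfLE G h).toHom

theorem inducedMinor_adj (hP : IsVoronoiPartition G N P) {p q : N} :
    (inducedMinor G N P).Adj p q ↔
      p ≠ q ∧ ∃ x y, centerOf hP x = p ∧ centerOf hP y = q ∧ G.Adj x y := by
  constructor
  · rintro ⟨h, x, hx, y, hy, hxy⟩
    exact ⟨h, x, y, centerOf_eq hP (P.symm hx), centerOf_eq hP (P.symm hy), hxy⟩
  · rintro ⟨h, x, y, rfl, rfl, hxy⟩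
    exact ⟨h, x, P.symm (centerOf_rel hP x), y, P.symm (centerOf_rel hP y), hxy⟩

/-- Clusters are connected and every edge of the minor comes from an edge of `G`, so walks lift. The
set `A` is used twice: to keep the lift out of `K`, and to keep it also out of one cluster. -/
theorem reachable_of_walk_minor (hP : IsVoronoiPartition G N P) {A : Set N} {p q : N}
    (w : (inducedMinor G N P).Walk p q) (hw : ∀ r ∈ w.support, r ∈ A) {x y : V}
    (hx : centerOf hP x = p) (hy : centerOf hP y = q) :
    ∃ (hx' : x ∈ {v | centerOf hP v ∈ A}) (hy' : y ∈ {v | centerOf hP v ∈ A}),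
      (G.induce {v | centerOf hP v ∈ A}).Reachable ⟨x, hx'⟩ ⟨y, hy'⟩ := by
  have inCluster : ∀ (p : N), p ∈ A → ∀ x y, centerOf hP x = p → centerOf hP y = p →
      ∃ (hx' : x ∈ {v | centerOf hP v ∈ A}) (hy' : y ∈ {v | centerOf hP v ∈ A}),
      (G.induce {v | centerOf hP v ∈ A}).Reachable ⟨x, hx'⟩ ⟨y, hy'⟩ := by
    intro p hp x y hx hy
    have hsub : cluster P p ⊆ {v | centerOf hP v ∈ A} := fun w hw => by
      rw [← centerOf_eq hP (P.symm hw)] at hp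
      exact hp
    have hx1 : x ∈ cluster P p := P.symm ((centerOf_eq_iff hP).1 hx)
    have hy1 : y ∈ cluster P p := P.symm ((centerOf_eq_iff hP).1 hy)
    exact ⟨hsub hx1, hsub hy1,
      reachable_induce_mono hsub hx1 hy1 ((hP.connected p).preconnected _ _)⟩
  induction w generalizing x with
  | nil => exact inCluster _ (hw _ (by simp)) x y hx hy
  | cons h w ih =>
    obtain ⟨-, x₁, y₁, hx₁, hy₁, hadj⟩ := (inducedMinor_adj hP).1 h
    obtain ⟨hx', hx₁', h1⟩ := inCluster _ (hw _ (by simp)) x x₁ hx hx₁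
    obtain ⟨hy₁', hy', h2⟩ := ih (fun r hr => hw r (by simp [hr])) hy₁ hy
    have h3 : (G.induce {v | centerOf hP v ∈ A}).Adj ⟨x₁, hx₁'⟩ ⟨y₁, hy₁'⟩ := hadj
    exact ⟨hx', hy', (h1.trans h3.reachable).trans h2⟩

/-- The order on the remaining net points along the line: no point lies strictly between two
points that can be joined in the remaining minor without using it. -/
theorem exists_line_order {R c : ℝ} (hcR : c ≤ R) (hN : IsNet G R N)
    (hP : IsVoronoiPartition G N P) {d : {v | v ∉ K} → {v | v ∉ K} → ℝ≥0∞}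
    (hd : IsRemainderDist G K d) (hc : LineEmbeds d c) :
    ∃ φ : {p | p ∉ hitCenters hP K} → ℝ, Function.Injective φ ∧
      ∀ p q b (w : ((inducedMinor G N P).induce {p | p ∉ hitCenters hP K}).Walk p q),
        b ∉ w.support →
        ((inducedMinor G N P).induce {p | p ∉ hitCenters hP K}).Reachable b p →
        ¬ (φ p < φ b ∧ φ b < φ q) := by
  obtain ⟨f, hinj, hf⟩ := hc
  have hK : ∀ {p : N} {v : V}, p ∉ hitCenters hP K → centerOf hP v = p → v ∉ K :=
    fun hp hv => not_mem_of_not_hit hP hp hv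
  -- A net point that remains is not in `K`, since it belongs to its own cluster, so `f` is defined
  -- at it.
  refine ⟨fun p => f ⟨p.1, hK p.2 (centerOf_self hP _)⟩, fun p q h => ?_, ?_⟩
  · have := congrArg Subtype.val (hinj h)
    exact Subtype.ext (Subtype.ext this)
  rintro p q b w hb ⟨w'⟩ ⟨h1, h2⟩
  have hbK : (b.1 : V) ∉ K := hK b.2 (centerOf_self hP _)
  let e := (SimpleGraph.Embedding.induce (G := inducedMinor G N P)
    {p | p ∉ hitCenters hP K}).toHom
  have hsub : {v | centerOf hP v ∈ {p : N | p ∉ hitCenters hP K}} ⊆ {v | v ∉ K} :=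
    fun v hv => hK hv rfl
  -- everything is reachable from `b`
  obtain ⟨hb1, hp1, hbp⟩ := reachable_of_walk_minor hP (A := {p | p ∉ hitCenters hP K})
    (w'.map e) (fun r hr => by
      rw [SimpleGraph.Walk.support_map, List.mem_map] at hr
      obtain ⟨s, -, rfl⟩ := hr
      exact s.2) (centerOf_self hP _) (centerOf_self hP _)
  have hbp' := reachable_induce_mono hsub hb1 hp1 hbp
  -- The walk avoids `b`, so its lift avoids the whole cluster of `b`.
  obtain ⟨hp2, hq2, hpq⟩ := reachable_of_walk_minor hP
    (A := {p | p ∉ hitCenters hP K ∧ p ≠ b.1}) (w.map e) (fun r hr => by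
      rw [SimpleGraph.Walk.support_map, List.mem_map] at hr
      obtain ⟨s, hs, rfl⟩ := hr
      exact ⟨s.2, fun h => hb (by rwa [show s = b from Subtype.ext h] at hs)⟩)
      (centerOf_self hP _) (centerOf_self hP _)
  have hsub2 : {v | centerOf hP v ∈ {p : N | p ∉ hitCenters hP K ∧ p ≠ b.1}} ⊆ {v | v ∉ K} :=
    fun v hv => hK hv.1 rfl
  -- Along the lifted walk `f` stays below `f b`: it cannot equal `f b` by injectivity, since `b` is
  -- in its own cluster, and it cannot jump over it by `no_crossing`. Reachability from `b` is
  -- carried along because `no_crossing` needs it.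
  have key : ∀ z, (G.induce {v | centerOf hP v ∈
      {p : N | p ∉ hitCenters hP K ∧ p ≠ b.1}}).Reachable ⟨p.1, hp2⟩ z →
      (G.induce {v | v ∉ K}).Reachable ⟨b.1, hbK⟩ ⟨z.1, hsub2 z.2⟩ ∧
        f ⟨z.1, hsub2 z.2⟩ < f ⟨b.1, hbK⟩ := by
    intro z hz
    rw [SimpleGraph.reachable_iff_reflTransGen] at hz
    induction hz with
    | refl => exact ⟨hbp', h1⟩
    | @tail x y hx hxy ih =>
      have hxy' : (G.induce {v | v ∉ K}).Adj ⟨x.1, hsub2 x.2⟩ ⟨y.1, hsub2 y.2⟩ := hxy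
      refine ⟨ih.1.trans hxy'.reachable, ?_⟩
      have hne : f ⟨y.1, hsub2 y.2⟩ ≠ f ⟨b.1, hbK⟩ := by
        intro h
        have h := congrArg Subtype.val (hinj h)
        apply y.2.2
        rw [show (y.1 : V) = b.1 from h]
        exact centerOf_self hP _
      by_contra hlt
      exact no_crossing hcR hN hP hd hf hbK (x := ⟨x.1, hsub2 x.2⟩) (y := ⟨y.1, hsub2 y.2⟩) hxy
        x.2.2 y.2.2 ih.1 ⟨ih.2, lt_of_le_of_ne (not_lt.1 hlt) hne.symm⟩
  exact absurd (key _ hpq).2 h2.not_gt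

end Line

/-! ### Graphs with a line order are linear forests. -/

section LinearOrder

variable {α : Type*} {H : SimpleGraph α} {φ : α → ℝ}

/-- A cycle has a vertex `b` other than its lowest and its highest one, and the rest of the cycle
joins these two while avoiding `b`. -/
theorem isAcyclic_of_line_order (hinj : Function.Injective φ)
    (hφ : ∀ p q b (w : H.Walk p q), b ∉ w.support → H.Reachable b p →
      ¬ (φ p < φ b ∧ φ b < φ q)) : H.IsAcyclic := by
  classical
  intro u c hc
  -- the points of the cycle other than `b` are joined without `b`
  have join : ∀ b ∈ c.support, ∀ z ∈ c.support, ∀ z' ∈ c.support, z ≠ b → z' ≠ b →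
      ∃ w : H.Walk z z', b ∉ w.support := by
    intro b hb z hz z' hz' hzb hzb'
    have hrot := hc.rotate hb
    have hmem : ∀ x, x ∈ c.support → x ∈ (c.rotate b hb).support := fun x hx => by
      simpa using hx
    generalize c.rotate b hb = c' at hrot hmem
    cases c' with
    | nil => exact absurd rfl hrot.ne_nil
    | @cons _ v _ h p =>
      rw [SimpleGraph.Walk.cons_isCycle_iff] at hrot
      have hp : ∀ x, x ∈ c.support → x ≠ b → ∃ w : H.Walk v x, b ∉ w.support := by
        intro x hx hxb
        have hxp : x ∈ p.support := by simpa [hxb] using hmem x hx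
        refine ⟨p.takeUntil x hxp, fun hbx => ?_⟩
        exact SimpleGraph.Walk.endpoint_notMem_support_takeUntil hrot.1 hxp hxb.symm hbx
      obtain ⟨w₁, h₁⟩ := hp z hz hzb
      obtain ⟨w₂, h₂⟩ := hp z' hz' hzb'
      refine ⟨w₁.reverse.append w₂, ?_⟩
      simp [SimpleGraph.Walk.mem_support_append_iff, h₁, h₂]
  have hcard : 2 < c.support.toFinset.card := by
    have h3 := hc.three_le_length
    have := List.toFinset_card_of_nodup hc.support_nodup
    have hle : c.support.tail.toFinset.card ≤ c.support.toFinset.card :=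
      Finset.card_le_card fun x hx => by
        simp only [List.mem_toFinset] at hx ⊢
        exact List.mem_of_mem_tail hx
    simp at this
    omega
  have hne : c.support.toFinset.Nonempty := ⟨u, by simp⟩
  obtain ⟨m, hm, hmin⟩ := Finset.exists_min_image _ φ hne
  obtain ⟨M, hM, hmax⟩ := Finset.exists_max_image _ φ hne
  obtain ⟨b, hb, hbm⟩ : ∃ b ∈ c.support.toFinset, b ∉ ({m, M} : Finset α) := by
    by_contra! h
    have := Finset.card_le_card (show c.support.toFinset ⊆ {m, M} from h)
    have := Finset.card_le_two (a := m) (b := M)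
    omega
  simp only [Finset.mem_insert, Finset.mem_singleton, not_or] at hbm
  have hb' := List.mem_toFinset.1 hb
  have hm' := List.mem_toFinset.1 hm
  obtain ⟨w, hw⟩ := join b hb' m hm' M (List.mem_toFinset.1 hM) (Ne.symm hbm.1) (Ne.symm hbm.2)
  have hr : H.Reachable b m :=
    (SimpleGraph.Walk.reachable (c.takeUntil b hb')).symm.trans
      (SimpleGraph.Walk.reachable (c.takeUntil m hm'))
  exact hφ m M b w hw hr ⟨lt_of_le_of_ne (hmin b hb) (hinj.ne (Ne.symm hbm.1)),
    lt_of_le_of_ne (hmax b hb) (hinj.ne hbm.2)⟩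

/-- Among three neighbours of `v`, the outer two are joined through `v` while avoiding the middle
one. -/
theorem degIn_le_two_of_line_order
    (hinj : Function.Injective φ)
    (hφ : ∀ p q b (w : H.Walk p q), b ∉ w.support → H.Reachable b p →
      ¬ (φ p < φ b ∧ φ b < φ q)) (U : Finset α) (v : α) : degIn H U v ≤ 2 := by
  classical
  by_contra! h
  unfold degIn at h
  have hne : (U.filter (H.Adj v)).Nonempty := Finset.card_pos.1 (by omega)
  obtain ⟨m, hm, hmin⟩ := Finset.exists_min_image _ φ hne
  obtain ⟨M, hM, hmax⟩ := Finset.exists_max_image _ φ hne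
  obtain ⟨b, hb, hbm⟩ : ∃ b ∈ U.filter (H.Adj v), b ∉ ({m, M} : Finset α) := by
    by_contra! h'
    have := Finset.card_le_card (show U.filter (H.Adj v) ⊆ {m, M} from h')
    have := Finset.card_le_two (a := m) (b := M)
    omega
  simp only [Finset.mem_insert, Finset.mem_singleton, not_or] at hbm
  have e1 : H.Adj v m := (Finset.mem_filter.1 hm).2
  have e2 : H.Adj v M := (Finset.mem_filter.1 hM).2
  have e3 : H.Adj v b := (Finset.mem_filter.1 hb).2
  refine hφ m M b (.cons e1.symm (.cons e2 .nil)) ?_ (e3.symm.reachable.trans e1.reachable)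
    ⟨lt_of_le_of_ne (hmin b hb) (hinj.ne (Ne.symm hbm.1)),
      lt_of_le_of_ne (hmax b hb) (hinj.ne hbm.2)⟩
  simp [hbm.1, hbm.2, e3.ne']

end LinearOrder

/-- The degree bound goes beyond part (b); the factor two in the analysis of the algorithm depends
on it. -/
theorem minor_of_embeddable {V : Type*} {G : SimpleGraph V} {k : ℕ} {c R : ℝ} (hcR : c ≤ R)
    (h : AdmitsEmbedding G k c ∨ MetricAdmitsEmbedding G k c) {N : Set V} {P : Setoid V}
    (hP : IsRPartition G R N P) :
    ∃ X : Finset N, IsFeedbackVertexSet (inducedMinor G N P) X ∧ X.card ≤ k ∧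
      ∀ U : Finset {p | p ∉ X}, ∀ v, degIn ((inducedMinor G N P).induce {p | p ∉ X}) U v ≤ 2 := by
  classical
  obtain ⟨K, hK, d, hd, hc⟩ := exists_remainder h
  obtain ⟨φ, hinj, hφ⟩ := exists_line_order hcR hP.1 hP.2 hd hc
  exact ⟨hitCenters hP.2 K, isAcyclic_of_line_order hinj hφ, Finset.card_image_le.trans hK,
    degIn_le_two_of_line_order hinj hφ⟩

end OutlierLine

end

noncomputable section
namespace OutlierLine

/-! ## Minimal feedback vertex sets and the weights `degree - 1` -/

section LocalRatio

variable {V : Type*} {H : SimpleGraph V}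

theorem degIn_union_of_disjoint [DecidableEq V] {A B : Finset V} (h : Disjoint A B) (v : V) :
    degIn H (A ∪ B) v = degIn H A v + degIn H B v := by
  classical
  unfold degIn
  rw [Finset.filter_union, Finset.card_union_of_disjoint (Finset.disjoint_filter_filter h)]

theorem degIn_sdiff_add [DecidableEq V] {A U : Finset V} (h : A ⊆ U) (v : V) :
    degIn H (U \ A) v + degIn H A v = degIn H U v := by
  rw [← degIn_union_of_disjoint Finset.sdiff_disjoint, Finset.sdiff_union_of_subset h]

theorem sum_degIn_comm (A B : Finset V) :
    ∑ a ∈ A, degIn H B a = ∑ b ∈ B, degIn H A b := by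
  classical
  have := Finset.sum_card_bipartiteAbove_eq_sum_card_bipartiteBelow (s := A) (t := B) H.Adj
  refine Eq.trans (Finset.sum_congr rfl fun a _ => ?_)
    (this.trans (Finset.sum_congr rfl fun b _ => ?_))
  · rfl
  · unfold degIn Finset.bipartiteBelow
    congr 1
    exact Finset.filter_congr fun a _ => H.adj_comm _ _

theorem degIn_pos_iff {U : Finset V} {v : V} : 0 < degIn H U v ↔ ∃ u ∈ U, H.Adj v u := by
  classical
  unfold degIn
  rw [Finset.card_pos]
  simp [Finset.Nonempty]

theorem degIn_insert_le [DecidableEq V] (U : Finset V) (x v : V) :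
    degIn H (insert x U) v ≤ degIn H U v + 1 := by
  classical
  unfold degIn
  rw [Finset.filter_insert]
  split_ifs
  · exact Finset.card_insert_le _ _
  · omega

theorem degIn_insert_of_not_adj [DecidableEq V] {U : Finset V} {x v : V} (h : ¬ H.Adj v x) :
    degIn H (insert x U) v = degIn H U v := by
  classical
  unfold degIn
  rw [Finset.filter_insert, if_neg h]

/-- Twice the weight `degree - 1` of `F`, through the degrees in `U`, in `F` and in `U ∖ F`. -/
theorem two_mul_sum_degIn_sub_one [DecidableEq V] {U F : Finset V} (hF : F ⊆ U) :
    2 * ∑ v ∈ F, ((degIn H U v : ℤ) - 1) = ∑ v ∈ U, ((degIn H U v : ℤ) - 2) +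
      ∑ v ∈ U, (if v ∈ F then (degIn H F v : ℤ) else 2 - degIn H (U \ F) v) := by
  have hsplit : ∀ f : V → ℤ, ∑ v ∈ U, f v = ∑ v ∈ U \ F, f v + ∑ v ∈ F, f v :=
    fun f => (Finset.sum_sdiff hF).symm
  have hdeg : ∀ v, (degIn H U v : ℤ) = degIn H (U \ F) v + degIn H F v := fun v => by
    rw [← degIn_sdiff_add hF v]; push_cast; ring
  have hcomm : ∑ v ∈ U \ F, (degIn H F v : ℤ) = ∑ v ∈ F, (degIn H (U \ F) v : ℤ) := by
    exact_mod_cast sum_degIn_comm (H := H) (U \ F) F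
  rw [hsplit, hsplit (fun v => if v ∈ F then (degIn H F v : ℤ) else 2 - degIn H (U \ F) v),
    Finset.sum_congr (s₁ := U \ F) rfl
      (fun v hv => if_neg (Finset.mem_sdiff.1 hv).2 : ∀ v ∈ U \ F, (if v ∈ F then
        (degIn H F v : ℤ) else 2 - degIn H (U \ F) v) = 2 - degIn H (U \ F) v),
    Finset.sum_congr (s₁ := F) rfl
      (fun v hv => if_pos hv : ∀ v ∈ F, (if v ∈ F then
        (degIn H F v : ℤ) else 2 - degIn H (U \ F) v) = degIn H F v)]
  simp only [hdeg, Finset.sum_sub_distrib, Finset.sum_add_distrib, Finset.sum_const, nsmul_eq_mul]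
  linarith

/-- The edges of `H` inside `W`. -/
def inside (H : SimpleGraph V) (W : Finset V) : SimpleGraph V where
  Adj u v := H.Adj u v ∧ u ∈ W ∧ v ∈ W
  symm := ⟨fun _ _ h => ⟨h.1.symm, h.2.2, h.2.1⟩⟩
  loopless := ⟨fun _ h => h.1.ne rfl⟩

/-- Only `a` can have degree at most one. Deleting it lowers the degree of its single neighbour
only, which becomes the new exceptional vertex, so induction on the size applies. -/
theorem not_thickFree_of_one_defect {T : Finset V} {a : V} (ha : a ∈ T) (h1 : 1 ≤ degIn H T a)
    (h2 : ∀ v ∈ T, v ≠ a → 2 ≤ degIn H T v) : ¬ ThickFree H T := by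
  classical
  induction hn : T.card using Nat.strong_induction_on generalizing T a with
  | _ n ih =>
    intro hT
    obtain ⟨v, hv, hd⟩ := hT T subset_rfl ⟨a, ha⟩
    have hva : v = a := by
      by_contra hne
      have := h2 v hv hne
      omega
    subst hva
    obtain ⟨a', ha', hadj⟩ := degIn_pos_iff.1 h1
    have huniq : ∀ z ∈ T, H.Adj v z → z = a' := fun z hz hvz => by
      by_contra hne
      have := two_le_degIn hne hz ha' hvz hadj
      omega
    have herase : insert v (T.erase v) = T := Finset.insert_erase hv
    refine ih (T.erase v).card ?_ (T := T.erase v) (a := a')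
      (Finset.mem_erase.2 ⟨hadj.ne', ha'⟩) ?_ ?_ rfl (hT.mono (Finset.erase_subset _ _))
    · rw [← hn]; exact Finset.card_erase_lt_of_mem hv
    · have h3 := h2 a' ha' hadj.ne'
      have h4 := degIn_insert_le (H := H) (T.erase v) v a'
      rw [herase] at h4
      omega
    · intro z hz hza
      have hz' := Finset.mem_erase.1 hz
      have h3 := h2 z hz'.2 hz'.1
      rwa [← herase, degIn_insert_of_not_adj] at h3
      exact fun h => hza (huniq z hz'.2 h.symm)

/-- A set `S` that violates the condition contains `x` and a neighbour `a` of `x`. If `x` had no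
other neighbour in the component of `a`, then the part of `S ∖ {x}` in that component would lose
only the edge `xa`, which `not_thickFree_of_one_defect` excludes inside `W`. -/
theorem exists_two_neighbors_of_not_thickFree [DecidableEq V] {W : Finset V} {x : V}
    (hW : ThickFree H W) (hx : ¬ ThickFree H (insert x W)) :
    ∃ a ∈ W, ∃ b ∈ W, a ≠ b ∧ H.Adj x a ∧ H.Adj x b ∧ (inside H W).Reachable a b := by
  classical
  unfold ThickFree at hx
  push Not at hx
  obtain ⟨S, hS, hne, hdeg⟩ := hx
  have hxS : x ∈ S := by
    by_contra hxS
    obtain ⟨v, hv, hd⟩ := hW S ((Finset.subset_insert_iff_of_notMem hxS).1 hS) hne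
    exact absurd (hdeg v hv) (by omega)
  have hSW : ∀ z ∈ S, z ≠ x → z ∈ W := fun z hz hzx => Finset.mem_of_mem_insert_of_ne (hS hz) hzx
  obtain ⟨a, haS, hxa⟩ := degIn_pos_iff.1 (lt_trans Nat.zero_lt_one (hdeg x hxS))
  have haW := hSW a haS hxa.ne'
  by_contra! hcon
  set T := (S.erase x).filter ((inside H W).Reachable a) with hT
  have haT : a ∈ T := by simp [hT, haS, hxa.ne']
  have hnb : ∀ v ∈ T, ∀ z ∈ S, z ≠ x → H.Adj v z → z ∈ T := by
    intro v hv z hz hzx hvz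
    simp only [hT, Finset.mem_filter, Finset.mem_erase] at hv ⊢
    refine ⟨⟨hzx, hz⟩, hv.2.trans ?_⟩
    exact SimpleGraph.Adj.reachable ⟨hvz, hSW v hv.1.2 hv.1.1, hSW z hz hzx⟩
  have hTS : T ⊆ S := (Finset.filter_subset _ _).trans (Finset.erase_subset _ _)
  refine not_thickFree_of_one_defect (H := H) haT ?_ ?_ (hW.mono fun z hz => ?_)
  · have h1 : 2 ≤ degIn H S a := hdeg a haS
    have h2 : degIn H S a ≤ degIn H (insert x T) a := by
      unfold degIn
      refine Finset.card_le_card fun z hz => ?_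
      rw [Finset.mem_filter] at hz ⊢
      refine ⟨?_, hz.2⟩
      by_cases hzx : z = x
      · simp [hzx]
      · exact Finset.mem_insert_of_mem (hnb a haT z hz.1 hzx hz.2)
    have h3 := degIn_insert_le (H := H) T x a
    omega
  · intro v hv hva
    have h1 : 2 ≤ degIn H S v := hdeg v (hTS hv)
    refine h1.trans ?_
    unfold degIn
    refine Finset.card_le_card fun z hz => ?_
    rw [Finset.mem_filter] at hz ⊢
    refine ⟨hnb v hv z hz.1 ?_ hz.2, hz.2⟩
    rintro rfl
    have hv' : v ≠ z ∧ v ∈ S := by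
      have := (Finset.mem_filter.1 hv).1
      simpa using this
    exact hcon a haW v (hSW v hv'.2 hv'.1) (Ne.symm hva) hxa hz.2.symm (Finset.mem_filter.1 hv).2
  · have := (Finset.mem_filter.1 hz).1
    rw [Finset.mem_erase] at this
    exact hSW z this.2 this.1

theorem degIn_univ_eq_degree [Fintype V] [DecidableRel H.Adj] (v : V) :
    degIn H Finset.univ v = H.degree v := by
  classical
  unfold degIn
  rw [← SimpleGraph.card_neighborFinset_eq_degree]
  congr 1
  ext; simp

/-- A connected graph has at least `|T| - 1` edges. -/
theorem two_mul_card_le_sum_degIn {T : Finset V} (hT : (H.induce (T : Set V)).Connected) :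
    2 * T.card ≤ ∑ v ∈ T, degIn H T v + 2 := by
  classical
  have h1 := hT.card_vert_le_card_edgeSet_add_one
  have h2 := (H.induce (T : Set V)).sum_degrees_eq_twice_card_edges
  have h3 : ∑ v ∈ T, degIn H T v = ∑ v : (T : Set V), (H.induce (T : Set V)).degree v := by
    rw [← Finset.sum_coe_sort]
    refine Finset.sum_congr rfl fun v _ => ?_
    rw [← degIn_univ_eq_degree, ← degIn_map (H.induce (T : Set V)) H
      (Function.Embedding.subtype _) Finset.univ (fun u _ v _ => Iff.rfl) (Finset.mem_univ v)]
    congr 1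
    ext z; simp
  rw [Nat.card_eq_fintype_card, Nat.card_eq_fintype_card, ← SimpleGraph.edgeFinset_card] at h1
  rw [h3, h2]
  simp at h1
  omega

theorem connected_component_inside [DecidableEq V] {W T : Finset V} {a : V} (ha : a ∈ W)
    (hT : ∀ v, v ∈ T ↔ v ∈ W ∧ (inside H W).Reachable a v) :
    (H.induce (T : Set V)).Connected := by
  have haT : a ∈ (T : Set V) := (hT a).2 ⟨ha, .refl _⟩
  have key : ∀ v (hv : (inside H W).Reachable a v), ∃ hvT : v ∈ (T : Set V),
      (H.induce (T : Set V)).Reachable ⟨a, haT⟩ ⟨v, hvT⟩ := by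
    intro v hv
    rw [SimpleGraph.reachable_iff_reflTransGen] at hv
    induction hv with
    | refl => exact ⟨haT, .refl _⟩
    | @tail u v hau huv ih =>
      obtain ⟨huT, hr⟩ := ih
      have hvT : v ∈ (T : Set V) := (hT v).2 ⟨huv.2.2,
        ((hT u).1 huT).2.trans (SimpleGraph.Adj.reachable huv)⟩
      refine ⟨hvT, hr.trans (SimpleGraph.Adj.reachable ?_)⟩
      exact huv.1
  rw [SimpleGraph.connected_iff_exists_forall_reachable]
  exact ⟨⟨a, haT⟩, fun v => (key v.1 ((hT v.1).1 v.2).2).2⟩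

/-- The contribution of one component `T` of `U ∖ X`: it pays for the vertices `J` of `X` that
have two neighbours in it. -/
theorem card_le_sum_of_component [DecidableEq V] {U X F T J : Finset V} {g : V → ℤ}
    (hXU : X ⊆ U) (hTU : T ⊆ U \ X) (hFU : F ⊆ U) (hdeg : ∀ v ∈ U, 2 ≤ degIn H U v)
    (hF : ThickFree H (U \ F)) (hg : ∀ v ∈ U, 0 ≤ g v)
    (hgF : ∀ v ∈ F, (degIn H F v : ℤ) ≤ g v)
    (hgF' : ∀ v ∈ U \ F, 2 - (degIn H (U \ F) v : ℤ) ≤ g v)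
    (hconn : (H.induce (T : Set V)).Connected)
    (hclosed : ∀ v ∈ T, ∀ w ∈ U \ X, H.Adj v w → w ∈ T)
    (hJX : J ⊆ X) (hJ : ∀ x ∈ J, 2 ≤ degIn H T x) :
    (J.card : ℤ) ≤ ∑ v ∈ T, (((degIn H U v : ℤ) - 2) + g v) := by
  classical
  have hTU' : T ⊆ U := hTU.trans Finset.sdiff_subset
  have hdT : ∀ v ∈ T, degIn H U v = degIn H T v + degIn H X v := by
    intro v hv
    rw [← degIn_sdiff_add hXU]
    congr 1
    refine le_antisymm ?_ (degIn_mono H hTU v)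
    unfold degIn
    refine Finset.card_le_card fun z hz => ?_
    rw [Finset.mem_filter] at hz ⊢
    exact ⟨hclosed v hv z hz.1 hz.2, hz.2⟩
  have hsumX : 2 * J.card ≤ ∑ v ∈ T, degIn H X v := by
    rw [sum_degIn_comm]
    calc 2 * J.card = ∑ x ∈ J, 2 := by simp [mul_comm]
      _ ≤ ∑ x ∈ J, degIn H T x := Finset.sum_le_sum hJ
      _ ≤ ∑ x ∈ X, degIn H T x := Finset.sum_le_sum_of_subset hJX
  -- The edges inside the connected set `T` contribute at least `2|T| - 2` to the degree sum; what
  -- is left counts the edges from `T` to `X`.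
  have h1 : (∑ v ∈ T, (degIn H X v : ℤ)) - 2 ≤ ∑ v ∈ T, ((degIn H U v : ℤ) - 2) := by
    have := two_mul_card_le_sum_degIn hconn
    have h2 : ∑ v ∈ T, ((degIn H U v : ℤ) - 2) =
        (∑ v ∈ T, degIn H T v : ℕ) + (∑ v ∈ T, degIn H X v : ℕ) - 2 * T.card := by
      rw [Finset.sum_sub_distrib, Finset.sum_congr rfl (fun v hv => by rw [hdT v hv])]
      push_cast
      rw [Finset.sum_add_distrib, Finset.sum_const, nsmul_eq_mul]
      ring
    rw [h2]
    have h3 : (2 * T.card : ℤ) ≤ (∑ v ∈ T, degIn H T v : ℕ) + 2 := by exact_mod_cast this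
    push_cast at h3 ⊢
    linarith
  have hd2 : ∀ v ∈ T, 0 ≤ (degIn H U v : ℤ) - 2 := fun v hv => by
    have := hdeg v (hTU' hv)
    omega
  have hs0 := Finset.sum_nonneg hd2
  have hg0 := Finset.sum_nonneg (fun v hv => hg v (hTU' hv) : ∀ v ∈ T, 0 ≤ g v)
  rw [Finset.sum_add_distrib]
  have hsumX' : (2 * J.card : ℤ) ≤ ∑ v ∈ T, (degIn H X v : ℤ) := by exact_mod_cast hsumX
  -- The lower bound `2|J| - 2` suffices for `|J| ≥ 2`, and `|J| = 0` is nonnegativity. Only `|J| =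
  -- 1` needs the set `F`.
  rcases Nat.lt_trichotomy J.card 1 with h | h | h
  · omega
  swap
  · omega
  by_cases hex : ∃ v ∈ T, 3 ≤ degIn H U v
  · obtain ⟨v, hv, h3⟩ := hex
    have := Finset.single_le_sum hd2 hv
    omega
  push Not at hex
  have heq2 : ∀ v ∈ T, degIn H U v = 2 := fun v hv => by
    have := hex v hv
    have := hdeg v (hTU' hv)
    omega
  obtain ⟨x, rfl⟩ := Finset.card_eq_one.1 h
  have hxX : x ∈ X := hJX (Finset.mem_singleton_self x)
  have hx2 := hJ x (Finset.mem_singleton_self x)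
  -- With all degrees equal to two, at most two edges leave `T` towards `X`, and `x` takes both.
  have hxonly : ∀ z ∈ X, z ≠ x → degIn H T z = 0 := by
    intro z hz hzx
    have h2 : ∑ v ∈ T, ((degIn H U v : ℤ) - 2) = 0 :=
      Finset.sum_eq_zero fun v hv => by rw [heq2 v hv]; norm_num
    have h3 : (∑ v ∈ T, degIn H X v : ℕ) ≤ 2 := by
      have : ((∑ v ∈ T, degIn H X v : ℕ) : ℤ) ≤ 2 := by push_cast; linarith
      exact_mod_cast this
    rw [sum_degIn_comm] at h3
    have h4 : ∑ b ∈ ({x, z} : Finset V), degIn H T b ≤ ∑ b ∈ X, degIn H T b :=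
      Finset.sum_le_sum_of_subset (by
        intro y hy
        simp only [Finset.mem_insert, Finset.mem_singleton] at hy
        rcases hy with rfl | rfl <;> assumption)
    rw [Finset.sum_pair hzx.symm] at h4
    omega
  have hnb : ∀ v ∈ T, ∀ z ∈ U, H.Adj v z → z ∈ insert x T := by
    intro v hv z hz hvz
    by_cases hzX : z ∈ X
    · by_cases hzx : z = x
      · simp [hzx]
      · have : 0 < degIn H T z := degIn_pos_iff.2 ⟨v, hv, hvz.symm⟩
        have := hxonly z hzX hzx
        omega
    · exact Finset.mem_insert_of_mem (hclosed v hv z (Finset.mem_sdiff.2 ⟨hz, hzX⟩) hvz)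
  have hSdeg : ∀ v ∈ T, 2 ≤ degIn H (insert x T) v := by
    intro v hv
    rw [← heq2 v hv]
    unfold degIn
    refine Finset.card_le_card fun z hz => ?_
    rw [Finset.mem_filter] at hz ⊢
    exact ⟨hnb v hv z hz.1 hz.2, hz.2⟩
  have hSU : insert x T ⊆ U := Finset.insert_subset (hXU hxX) hTU'
  -- Every vertex of `insert x T` has two neighbours in it, so `F` must meet this set.
  obtain ⟨u, hu, huF⟩ : ∃ u ∈ insert x T, u ∈ F := by
    by_contra! hno
    obtain ⟨v, hv, hd⟩ := hF (insert x T)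
      (fun z hz => Finset.mem_sdiff.2 ⟨hSU hz, hno z hz⟩) ⟨x, by simp⟩
    rcases Finset.mem_insert.1 hv with rfl | hv
    · have := degIn_mono H (Finset.subset_insert v T) v
      omega
    · have := hSdeg v hv
      omega
  obtain ⟨y, hyT, huy⟩ : ∃ y ∈ T, H.Adj u y := by
    rw [← degIn_pos_iff]
    rcases Finset.mem_insert.1 hu with rfl | hu
    · omega
    · have := hSdeg u hu
      have := degIn_insert_le (H := H) T x u
      omega
  -- The neighbour `u ∈ F` of `y` counts in the degree into `F` if `y ∈ F`; otherwise it lowers the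
  -- degree of `y` outside `F` to at most one.
  have hgy : 1 ≤ g y := by
    have hpos : 0 < degIn H F y := degIn_pos_iff.2 ⟨u, huF, huy.symm⟩
    by_cases hyF : y ∈ F
    · have := hgF y hyF
      omega
    · have h5 := hgF' y (Finset.mem_sdiff.2 ⟨hTU' hyT, hyF⟩)
      have h6 := degIn_sdiff_add (H := H) hFU y
      have := heq2 y hyT
      omega
  have := Finset.single_le_sum (fun v hv => hg v (hTU' hv) : ∀ v ∈ T, 0 ≤ g v) hyT
  omega

/-- In a graph of minimum degree at least two, a minimal feedback vertex set `X` and a set `F`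
whose removal leaves an acyclic graph of maximum degree at most two. -/
theorem sum_degIn_sub_one_le [DecidableEq V] {U X F : Finset V} (hXU : X ⊆ U) (hFU : F ⊆ U)
    (hdeg : ∀ v ∈ U, 2 ≤ degIn H U v) (hX : ThickFree H (U \ X))
    (hmin : ∀ x ∈ X, ¬ ThickFree H (insert x (U \ X))) (hF : ThickFree H (U \ F))
    (hF2 : ∀ v ∈ U \ F, degIn H (U \ F) v ≤ 2) :
    ∑ v ∈ X, (degIn H U v - 1) ≤ 2 * ∑ v ∈ F, (degIn H U v - 1) := by
  classical
  set g : V → ℤ := fun v => if v ∈ F then (degIn H F v : ℤ) else 2 - degIn H (U \ F) v with hgdef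
  have hg : ∀ v ∈ U, 0 ≤ g v := fun v hv => by
    by_cases h : v ∈ F
    · simp [hgdef, h]
    · have := hF2 v (Finset.mem_sdiff.2 ⟨hv, h⟩)
      simp [hgdef, h, this]
  have hgF : ∀ v ∈ F, (degIn H F v : ℤ) ≤ g v := fun v hv => by simp [hgdef, hv]
  have hgF' : ∀ v ∈ U \ F, 2 - (degIn H (U \ F) v : ℤ) ≤ g v := fun v hv => by
    simp [hgdef, (Finset.mem_sdiff.1 hv).2]
  -- By minimality, each `x ∈ X` has two neighbours in one component of `U \ X`; `x` is charged to
  -- that component.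
  choose! a ha b hb hab hxa hxb hr using
    fun x hx => exists_two_neighbors_of_not_thickFree hX (hmin x hx)
  set W := U \ X
  let mk := (inside H W).connectedComponentMk
  have hcard : (X.card : ℤ) ≤ ∑ v ∈ W, (((degIn H U v : ℤ) - 2) + g v) := by
    rw [← Finset.sum_fiberwise_of_maps_to (t := W.image mk) (g := mk)
      (fun v hv => Finset.mem_image_of_mem _ hv),
      Finset.card_eq_sum_card_fiberwise (t := W.image mk) (f := fun x => mk (a x))
      (fun x hx => Finset.mem_image_of_mem mk (ha x hx))]
    push_cast
    refine Finset.sum_le_sum fun c hc => ?_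
    obtain ⟨a₀, ha₀, rfl⟩ := Finset.mem_image.1 hc
    have hT : ∀ v, v ∈ W.filter (fun v => mk v = mk a₀) ↔
        v ∈ W ∧ (inside H W).Reachable a₀ v := fun v => by
      simp only [Finset.mem_filter, mk, SimpleGraph.ConnectedComponent.eq]
      exact and_congr_right fun _ => SimpleGraph.reachable_comm
    refine card_le_sum_of_component hXU (Finset.filter_subset _ _) hFU hdeg hF hg hgF hgF'
      (connected_component_inside ha₀ hT) ?_ (Finset.filter_subset _ _) ?_
    · intro v hv w hw hvw
      rw [hT] at hv ⊢
      exact ⟨hw, hv.2.trans (SimpleGraph.Adj.reachable ⟨hvw, hv.1, hw⟩)⟩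
    · intro x hx
      obtain ⟨hxX, hxc⟩ := Finset.mem_filter.1 hx
      refine two_le_degIn (hab x hxX) ?_ ?_ (hxa x hxX) (hxb x hxX)
      · exact Finset.mem_filter.2 ⟨ha x hxX, hxc⟩
      · refine Finset.mem_filter.2 ⟨hb x hxX, ?_⟩
        rw [← hxc]
        exact (SimpleGraph.ConnectedComponent.eq.2 (hr x hxX)).symm
  have hFsum := two_mul_sum_degIn_sub_one (H := H) hFU
  have hcast : ∀ Y ⊆ U, ((∑ v ∈ Y, (degIn H U v - 1) : ℕ) : ℤ) =
      ∑ v ∈ Y, ((degIn H U v : ℤ) - 1) := fun Y hY => by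
    push_cast
    refine Finset.sum_congr rfl fun v hv => ?_
    have := hdeg v (hY hv)
    omega
  -- After the identity for `F`, the degrees inside `X` cancel and `g` may be dropped on `X`; what
  -- remains is `hcard`.
  have hgoal : ∑ v ∈ X, ((degIn H U v : ℤ) - 1) ≤ 2 * ∑ v ∈ F, ((degIn H U v : ℤ) - 1) := by
    rw [hFsum, ← Finset.sum_add_distrib, ← Finset.sum_sdiff hXU]
    have e1 : ∑ v ∈ X, ((degIn H U v : ℤ) - 1) =
        X.card + ∑ v ∈ X, ((degIn H U v : ℤ) - 2) := by
      rw [Finset.card_eq_sum_ones]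
      push_cast
      rw [← Finset.sum_add_distrib]
      exact Finset.sum_congr rfl fun v _ => by ring
    have e2 : ∑ v ∈ X, ((degIn H U v : ℤ) - 2) ≤ ∑ v ∈ X, ((degIn H U v : ℤ) - 2 + g v) :=
      Finset.sum_le_sum fun v hv => by have := hg v (hXU hv); omega
    linarith
  rw [← hcast X hXU, ← hcast F hFU] at hgoal
  exact_mod_cast hgoal

end LocalRatio

end OutlierLine

end

noncomputable section
namespace OutlierLine

/-! ## Pruning, and the local ratio algorithm for feedback vertex sets -/

section Pruning

variable {V : Type*} {H : SimpleGraph V}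

/-- Remove all vertices of degree at most one. -/
def pruneStep (H : SimpleGraph V) (U : Finset V) : Finset V := U.filter fun v => 2 ≤ degIn H U v

/-- Remove the vertices of degree at most one, `n` times. -/
def prune (H : SimpleGraph V) (n : ℕ) (U : Finset V) : Finset V := (pruneStep H)^[n] U

theorem prune_succ (n : ℕ) (U : Finset V) : prune H (n + 1) U = pruneStep H (prune H n U) :=
  Function.iterate_succ_apply' _ _ _

theorem prune_subset (n : ℕ) (U : Finset V) : prune H n U ⊆ U := by
  induction n with
  | zero => exact subset_rfl
  | succ n ih => rw [prune_succ]; exact (Finset.filter_subset _ _).trans ih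

theorem subset_prune {S U : Finset V} (hS : S ⊆ U) (hd : ∀ v ∈ S, 2 ≤ degIn H S v) (n : ℕ) :
    S ⊆ prune H n U := by
  induction n with
  | zero => exact hS
  | succ n ih =>
    rw [prune_succ]
    exact fun v hv => Finset.mem_filter.2 ⟨ih hv, (hd v hv).trans (degIn_mono H ih v)⟩

/-- A round that changes the set removes at least one vertex, so the pruning is stable after `|U|`
rounds. -/
theorem two_le_degIn_prune {U : Finset V} {n : ℕ} (hn : U.card ≤ n) :
    ∀ v ∈ prune H n U, 2 ≤ degIn H (prune H n U) v := by
  have key : ∀ m, (pruneStep H (prune H m U) = prune H m U) ∨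
      (prune H m U).card + m ≤ U.card := by
    intro m
    induction m with
    | zero => right; simp [prune]
    | succ m ih =>
      rw [prune_succ]
      by_cases h : pruneStep H (prune H m U) = prune H m U
      · left; rw [h, h]
      · right
        have h1 := ih.resolve_left h
        have h2 := Finset.card_lt_card
          (Finset.ssubset_iff_subset_ne.2 ⟨Finset.filter_subset _ _, h⟩)
        change (pruneStep H (prune H m U)).card < _ at h2
        omega
  intro v hv
  rcases key n with h | h
  · rw [← h] at hv
    exact (Finset.mem_filter.1 hv).2
  · have : (prune H n U).card = 0 := by omega
    rw [Finset.card_eq_zero] at this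
    simp [this] at hv

/-- This is the acyclicity test that the program performs. -/
theorem thickFree_iff_prune_eq_empty {U : Finset V} {n : ℕ} (hn : U.card ≤ n) :
    ThickFree H U ↔ prune H n U = ∅ := by
  constructor
  · intro h
    by_contra hne
    obtain ⟨v, hv, hd⟩ := h _ (prune_subset n U) (Finset.nonempty_iff_ne_empty.2 hne)
    have := two_le_degIn_prune hn v hv
    omega
  · intro h S hS hne
    by_contra! hd
    obtain ⟨v, hv⟩ := hne
    have := subset_prune hS (fun v hv => hd v hv) n hv
    simp [h] at this

end Pruning

/-! ### The local ratio algorithm as an abstract run, and its approximation guarantee. -/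

section LocalRatio

variable {V : Type*} {H : SimpleGraph V} [DecidableEq V]

/-- `X` is a minimal feedback vertex set of `H[U]` whose weight is at most twice that of `F`. -/
structure IsGoodFor (H : SimpleGraph V) (F U : Finset V) (w : V → ℕ) (X : Finset V) : Prop where
  subset : X ⊆ U
  thickFree : ThickFree H (U \ X)
  minimal : ∀ x ∈ X, ¬ ThickFree H (insert x (U \ X))
  weight : ∑ x ∈ X, w x ≤ 2 * ∑ x ∈ F ∩ U, w x

theorem isGoodFor_empty (F : Finset V) (w : V → ℕ) : IsGoodFor H F ∅ w ∅ :=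
  ⟨subset_rfl, fun S hS hne => absurd (hne.mono hS) (by simp), by simp, by simp⟩

-- With `d` the degree in `U`, the weights satisfy `(d v - 1) w = w' + w v (d - 1)` on `U`, and both
-- summands are nonnegative since `v` has minimum ratio. For `w'` the bound is inherited, as `v` has
-- weight zero; for `d - 1` it is `sum_degIn_sub_one_le`, which needs minimality. Multiplying by `d
-- v - 1` instead of dividing keeps the weights natural.
open Classical in
theorem IsGoodFor.step {F U U' X' : Finset V} {w w' : V → ℕ} {v : V}
    (hdeg : ∀ u ∈ U, 2 ≤ degIn H U u)
    (hF : ThickFree H (U \ F)) (hF2 : ∀ u ∈ U \ F, degIn H (U \ F) u ≤ 2) (hv : v ∈ U)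
    (hmin : ∀ u ∈ U, w v * (degIn H U u - 1) ≤ w u * (degIn H U v - 1))
    (hw : ∀ u ∈ U, w' u = w u * (degIn H U v - 1) - w v * (degIn H U u - 1))
    (hU' : U' ⊆ U.erase v)
    (hprune : ∀ S ⊆ U.erase v, (∀ u ∈ S, 2 ≤ degIn H S u) → S ⊆ U')
    (h : IsGoodFor H F U' w' X') :
    IsGoodFor H F U w (if ThickFree H (U \ X') then X' else insert v X') := by
  set X := if ThickFree H (U \ X') then X' else insert v X' with hXdef
  have hU'U : U' ⊆ U := hU'.trans (Finset.erase_subset _ _)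
  have hX'X : X' ⊆ X := by
    rw [hXdef]; split_ifs
    · exact subset_rfl
    · exact Finset.subset_insert _ _
  have hXX' : X ⊆ insert v X' := by
    rw [hXdef]; split_ifs
    · exact Finset.subset_insert _ _
    · exact subset_rfl
  have hsub : X ⊆ U := hXX'.trans (Finset.insert_subset hv (h.subset.trans hU'U))
  have hvU' : v ∉ U' := fun hv' => by simpa using hU' hv'
  have hfree : ThickFree H (U \ X) := by
    rw [hXdef]; split_ifs with hc
    · exact hc
    · intro S hS hne
      by_contra! hd
      -- A set of inner degrees at least two that avoids `v` survives the next pruning, where `X'`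
      -- already meets all cycles.
      have hSU : S ⊆ U' := hprune S (fun z hz => by
        have := hS hz
        simp only [Finset.mem_sdiff, Finset.mem_insert, not_or] at this
        exact Finset.mem_erase.2 ⟨this.2.1, this.1⟩) (fun z hz => hd z hz)
      obtain ⟨z, hz, hzd⟩ := h.thickFree S (fun z hz => by
        have := hS hz
        simp only [Finset.mem_sdiff, Finset.mem_insert, not_or] at this
        exact Finset.mem_sdiff.2 ⟨hSU hz, this.2.2⟩) hne
      have := hd z hz
      omega
  have hminimal : ∀ x ∈ X, ¬ ThickFree H (insert x (U \ X)) := by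
    intro x hx hfree'
    by_cases hxX' : x ∈ X'
    · refine h.minimal x hxX' (hfree'.mono (Finset.insert_subset_insert x fun z hz => ?_))
      obtain ⟨hz1, hz2⟩ := Finset.mem_sdiff.1 hz
      refine Finset.mem_sdiff.2 ⟨hU'U hz1, fun hzX => ?_⟩
      rcases Finset.mem_insert.1 (hXX' hzX) with rfl | h3
      · exact hvU' hz1
      · exact hz2 h3
    -- The vertex `v` was added only because a cycle remained without it.
    · have hxv : x = v := (Finset.mem_insert.1 (hXX' hx)).resolve_right hxX'
      subst hxv
      by_cases hc : ThickFree H (U \ X')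
      · rw [hXdef, if_pos hc] at hx
        exact hxX' hx
      · refine hc (hfree'.mono fun z hz => ?_)
        rw [hXdef, if_neg hc]
        obtain ⟨hz1, hz2⟩ := Finset.mem_sdiff.1 hz
        by_cases hzx : z = x
        · simp [hzx]
        · exact Finset.mem_insert_of_mem
            (Finset.mem_sdiff.2 ⟨hz1, by simp [hzx, hz2]⟩)
  refine ⟨hsub, hfree, hminimal, ?_⟩
  have hFU : U \ (F ∩ U) = U \ F := by ext z; simp +contextual
  have hkey := sum_degIn_sub_one_le (H := H) hsub (Finset.inter_subset_right (s₁ := F)) hdeg hfree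
    hminimal (by rwa [hFU]) (by rwa [hFU])
  have hw'v : w' v = 0 := by rw [hw v hv]; simp
  have hwX : ∑ x ∈ X, w' x ≤ 2 * ∑ x ∈ F ∩ U, w' x := calc
    ∑ x ∈ X, w' x ≤ ∑ x ∈ insert v X', w' x := Finset.sum_le_sum_of_subset hXX'
    _ = ∑ x ∈ X', w' x := Finset.sum_insert_of_eq_zero_if_notMem fun _ => hw'v
    _ ≤ 2 * ∑ x ∈ F ∩ U', w' x := h.weight
    _ ≤ 2 * ∑ x ∈ F ∩ U, w' x := by
      gcongr
  have hexp : ∀ Y ⊆ U, (degIn H U v - 1) * ∑ x ∈ Y, w x =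
      ∑ x ∈ Y, w' x + w v * ∑ x ∈ Y, (degIn H U x - 1) := by
    intro Y hY
    rw [Finset.mul_sum, Finset.mul_sum, ← Finset.sum_add_distrib]
    refine Finset.sum_congr rfl fun x hx => ?_
    rw [hw x (hY hx), Nat.sub_add_cancel (hmin x (hY hx)), mul_comm]
  have hpos : 0 < degIn H U v - 1 := by
    have := hdeg v hv
    omega
  refine le_of_mul_le_mul_left (a := degIn H U v - 1) ?_ hpos
  rw [hexp X hsub, mul_left_comm, hexp _ Finset.inter_subset_right]
  have := Nat.mul_le_mul_left (w v) hkey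
  linarith [mul_left_comm (w v) 2 (∑ x ∈ F ∩ U, (degIn H U x - 1))]

/-- A run of the algorithm: in round `r` the alive set `A r` is pruned to `U r`, a vertex of
minimum ratio is put into `P r`, and the weights are updated; afterwards the sets `X r` are
computed backwards. -/
structure LocalRatioRun (H : SimpleGraph V) (n : ℕ) (A U P X : ℕ → Finset V)
    (w : ℕ → V → ℕ) : Prop where
  card_le : (A 0).card ≤ n
  weight_zero : ∀ v ∈ A 0, w 0 v = 1
  prune : ∀ r < n, U r = OutlierLine.prune H n (A r)
  pick : ∀ r < n, (U r).Nonempty → ∃ v ∈ U r, P r = {v} ∧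
    (∀ u ∈ U r, w r v * (degIn H (U r) u - 1) ≤ w r u * (degIn H (U r) v - 1)) ∧
    ∀ u ∈ U r, w (r + 1) u = w r u * (degIn H (U r) v - 1) - w r v * (degIn H (U r) u - 1)
  alive : ∀ r < n, A (r + 1) = U r \ P r
  last : X n = ∅
  back_pos : ∀ r < n, ThickFree H (U r \ X (r + 1)) → X r = X (r + 1)
  back_neg : ∀ r < n, ¬ ThickFree H (U r \ X (r + 1)) → X r = X (r + 1) ∪ P r

/-- A nonempty pruned set loses its picked vertex, so nothing is alive after `n` rounds. -/
theorem LocalRatioRun.card_alive_le {n : ℕ} {A U P X : ℕ → Finset V} {w : ℕ → V → ℕ}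
    (h : LocalRatioRun H n A U P X w) : ∀ r ≤ n, (A r).card ≤ n - r := by
  intro r
  induction r with
  | zero => intro _; exact h.card_le
  | succ r ih =>
    intro hr
    have h1 := ih (by omega)
    have h2 : (U r).card ≤ (A r).card := by
      rw [h.prune r hr]; exact Finset.card_le_card (prune_subset n _)
    rw [h.alive r hr]
    rcases (U r).eq_empty_or_nonempty with he | hne
    · simp [he]
    · obtain ⟨v, hv, hP, -⟩ := h.pick r hr hne
      rw [hP, Finset.sdiff_singleton_eq_erase]
      have := Finset.card_erase_lt_of_mem hv
      omega

/-- Backward induction over the rounds by `IsGoodFor.step`. The case `n = 0` is excluded because a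
run says nothing about `U 0` then. -/
theorem LocalRatioRun.isGoodFor {n : ℕ} {A U P X : ℕ → Finset V} {w : ℕ → V → ℕ}
    (h : LocalRatioRun H n A U P X w) {F : Finset V} (hF : ThickFree H (A 0 \ F))
    (hF2 : ∀ u ∈ A 0 \ F, degIn H (A 0 \ F) u ≤ 2) (hn : 0 < n) :
    IsGoodFor H F (U 0) (w 0) (X 0) := by
  have hUA : ∀ r < n, U r ⊆ A r := fun r hr => by rw [h.prune r hr]; exact prune_subset n _
  have hA0 : ∀ r ≤ n, A r ⊆ A 0 := by
    intro r
    induction r with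
    | zero => exact fun _ => subset_rfl
    | succ r ih =>
      intro hr
      rw [h.alive r hr]
      exact Finset.sdiff_subset.trans ((hUA r hr).trans (ih (by omega)))
  have hdeg : ∀ r < n, ∀ u ∈ U r, 2 ≤ degIn H (U r) u := fun r hr => by
    rw [h.prune r hr]
    exact two_le_degIn_prune ((h.card_alive_le r hr.le).trans (Nat.sub_le _ _))
  -- the alive set of the last round is empty, and plays the role of the pruned set
  let U' : ℕ → Finset V := fun r => if r < n then U r else ∅
  suffices key : ∀ m r, r + m = n → IsGoodFor H F (U' r) (w r) (X r) by
    have := key n 0 (by omega)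
    simpa [U', hn] using this
  intro m
  induction m with
  | zero =>
    intro r hr
    obtain rfl : r = n := by omega
    rw [h.last]
    simpa [U'] using isGoodFor_empty F (w r)
  | succ m ih =>
    intro r hr
    have hrn : r < n := by omega
    have ih' := ih (r + 1) (by omega)
    simp only [U', if_pos hrn]
    have hU'sub : U' (r + 1) ⊆ A (r + 1) := by
      by_cases h1 : r + 1 < n
      · simpa [U', h1] using hUA _ h1
      · simp [U', h1]
    have hprune' : ∀ S ⊆ A (r + 1), (∀ u ∈ S, 2 ≤ degIn H S u) → S ⊆ U' (r + 1) := by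
      intro S hS hd
      by_cases h1 : r + 1 < n
      · simp only [U', if_pos h1, h.prune _ h1]
        exact subset_prune hS hd n
      · have := h.card_alive_le (r + 1) (by omega)
        rw [show n - (r + 1) = 0 by omega, Nat.le_zero, Finset.card_eq_zero] at this
        rw [this] at hS
        exact hS.trans (Finset.empty_subset _)
    rcases (U r).eq_empty_or_nonempty with he | hne
    -- Once the pruned set is empty, all later sets are empty too, and nothing is added on the way
    -- back.
    · have hfree : ∀ Y, ThickFree H (U r \ Y) := fun Y S hS hS' => by
        rw [he, Finset.empty_sdiff] at hS
        exact absurd (hS'.mono hS) (by simp)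
      have hX' : X (r + 1) = ∅ := by
        have := ih'.subset.trans hU'sub
        rw [h.alive r hrn, he, Finset.empty_sdiff] at this
        exact Finset.subset_empty.1 this
      rw [h.back_pos r hrn (hfree _), hX', he]
      exact isGoodFor_empty _ _
    · obtain ⟨v, hv, hP, hmin, hw⟩ := h.pick r hrn hne
      have hAe : A (r + 1) = (U r).erase v := by
        rw [h.alive r hrn, hP, Finset.sdiff_singleton_eq_erase]
      rw [hAe] at hU'sub hprune'
      have hsubF : U r \ F ⊆ A 0 \ F :=
        Finset.sdiff_subset_sdiff ((hUA r hrn).trans (hA0 r hrn.le)) subset_rfl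
      have := ih'.step (hdeg r hrn) (hF.mono hsubF)
        (fun u hu => (degIn_mono H hsubF u).trans (hF2 u (hsubF hu))) hv hmin hw hU'sub hprune'
      split_ifs at this with hc
      · rwa [h.back_pos r hrn hc]
      · rwa [h.back_neg r hrn hc, hP, Finset.union_comm, ← Finset.insert_eq]

theorem LocalRatioRun.subset {n : ℕ} {A U P X : ℕ → Finset V} {w : ℕ → V → ℕ}
    (h : LocalRatioRun H n A U P X w) : X 0 ⊆ A 0 := by
  rcases Nat.eq_zero_or_pos n with rfl | hn
  · rw [h.last]; exact Finset.empty_subset _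
  · have hg := h.isGoodFor (F := A 0) (fun S hS hS' => absurd (hS'.mono hS) (by simp))
      (by simp) hn
    refine hg.subset.trans ?_
    rw [h.prune 0 hn]; exact prune_subset n _

/-- Taking `F = A 0` meets the conditions of `isGoodFor` trivially. Passing from `U 0` back to `A 0`
creates no cycle, because cycles survive the pruning. -/
theorem LocalRatioRun.thickFree {n : ℕ} {A U P X : ℕ → Finset V} {w : ℕ → V → ℕ}
    (h : LocalRatioRun H n A U P X w) : ThickFree H (A 0 \ X 0) := by
  rcases Nat.eq_zero_or_pos n with rfl | hn
  · have h0 : A 0 = ∅ := by simpa using h.card_le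
    rw [h0]
    intro S hS hS'
    exact absurd (hS'.mono hS) (by simp)
  · have hg := h.isGoodFor (F := A 0) (fun S hS hS' => absurd (hS'.mono hS) (by simp))
      (by simp) hn
    intro S hS hne
    by_contra! hd
    have hSU : S ⊆ U 0 := by
      rw [h.prune 0 hn]
      exact subset_prune (hS.trans Finset.sdiff_subset) (fun v hv => hd v hv) n
    obtain ⟨v, hv, hvd⟩ := hg.thickFree S
      (fun z hz => Finset.mem_sdiff.2 ⟨hSU hz, (Finset.mem_sdiff.1 (hS hz)).2⟩) hne
    have := hd v hv
    omega

/-- All initial weights are one, so the weight bound of `isGoodFor` is a bound on cardinalities. -/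
theorem LocalRatioRun.card_le_two_mul {n : ℕ} {A U P X : ℕ → Finset V} {w : ℕ → V → ℕ}
    (h : LocalRatioRun H n A U P X w) {F : Finset V} (hF : ThickFree H (A 0 \ F))
    (hF2 : ∀ u ∈ A 0 \ F, degIn H (A 0 \ F) u ≤ 2) : (X 0).card ≤ 2 * F.card := by
  rcases Nat.eq_zero_or_pos n with rfl | hn
  · simp [h.last]
  · have hg := h.isGoodFor hF hF2 hn
    have hU : U 0 ⊆ A 0 := by rw [h.prune 0 hn]; exact prune_subset n _
    have h1 : ∀ Y ⊆ A 0, ∑ x ∈ Y, w 0 x = Y.card := fun Y hY => by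
      rw [Finset.card_eq_sum_ones]
      exact Finset.sum_congr rfl fun x hx => h.weight_zero x (hY hx)
    have h2 := hg.weight
    rw [h1 _ h.subset, h1 _ (Finset.inter_subset_right.trans hU)] at h2
    exact h2.trans (Nat.mul_le_mul_left 2 (Finset.card_le_card Finset.inter_subset_left))

end LocalRatio

end OutlierLine

end

noncomputable section
namespace OutlierLine

/-! ## A language of bounded loops that compiles to polynomial-time programs -/

/-- Expressions with bounded sums. -/
inductive HExpr where
  | const (m : ℕ)
  | var (i : ℕ)
  | arr (a : ℕ) (e₁ e₂ : HExpr)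
  | add (e₁ e₂ : HExpr)
  | sub (e₁ e₂ : HExpr)
  | lt (e₁ e₂ : HExpr)
  | eq (e₁ e₂ : HExpr)
  | cond (e₁ e₂ e₃ : HExpr)
  | sum (x : ℕ) (e : HExpr)

namespace HExpr

/-- The value of an expression; sums range over the numbers below variable `0`. -/
def eval : HExpr → Mem → ℕ
  | const m, _ => m
  | var i, s => s.var i
  | arr a e₁ e₂, s => s.arr a (e₁.eval s) (e₂.eval s)
  | add e₁ e₂, s => e₁.eval s + e₂.eval s
  | sub e₁ e₂, s => e₁.eval s - e₂.eval s
  | lt e₁ e₂, s => if e₁.eval s < e₂.eval s then 1 else 0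
  | eq e₁ e₂, s => if e₁.eval s = e₂.eval s then 1 else 0
  | cond e₁ e₂ e₃, s => if e₁.eval s ≠ 0 then e₂.eval s else e₃.eval s
  | sum x e, s => ∑ i ∈ Finset.range (s.var 0), e.eval (s.setVar x i)

/-- All variables and arrays of the expression are below `D`, and variable `0` is not bound. -/
def ok (D : ℕ) : HExpr → Bool
  | const _ => true
  | var i => i < D
  | arr a e₁ e₂ => a < D && (e₁.ok D && e₂.ok D)
  | add e₁ e₂ => e₁.ok D && e₂.ok D
  | sub e₁ e₂ => e₁.ok D && e₂.ok D
  | lt e₁ e₂ => e₁.ok D && e₂.ok D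
  | eq e₁ e₂ => e₁.ok D && e₂.ok D
  | cond e₁ e₂ e₃ => e₁.ok D && (e₂.ok D && e₃.ok D)
  | sum x e => x < D && (0 < x && e.ok D)

end HExpr

/-- Run `p` with `x = 0, …, n - 1`, where `n` is variable `0`, and restore `x`, which is saved in
variable `d`. -/
def forLoop (x d : ℕ) (p : Prog) : Prog :=
  .seq (.assign d (.var x)) (.seq (.assign x (.const 0))
    (.seq (.while (.lt (.var x) (.var 0)) (.seq p (.assign x (.add (.var x) (.const 1)))))
      (.assign x (.var d))))

/-- A program that puts the value of an expression into variable `d`, using variables from `d` on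
as scratch space. -/
def HExpr.compile : HExpr → ℕ → Prog
  | const m, d => .assign d (.const m)
  | var i, d => .assign d (.var i)
  | arr a e₁ e₂, d => .seq (e₁.compile d) (.seq (e₂.compile (d + 1))
      (.assign d (.arr a (.var d) (.var (d + 1)))))
  | add e₁ e₂, d => .seq (e₁.compile d) (.seq (e₂.compile (d + 1))
      (.assign d (.add (.var d) (.var (d + 1)))))
  | sub e₁ e₂, d => .seq (e₁.compile d) (.seq (e₂.compile (d + 1))
      (.assign d (.sub (.var d) (.var (d + 1)))))
  | lt e₁ e₂, d => .seq (e₁.compile d) (.seq (e₂.compile (d + 1))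
      (.assign d (.lt (.var d) (.var (d + 1)))))
  | eq e₁ e₂, d => .seq (e₁.compile d) (.seq (e₂.compile (d + 1))
      (.assign d (.eq (.var d) (.var (d + 1)))))
  | cond e₁ e₂ e₃, d => .seq (e₁.compile d) (.ite (.var d) (e₂.compile d) (e₃.compile d))
  | sum x e, d => .seq (.assign (d + 1) (.const 0))
      (.seq (forLoop x d (.seq (e.compile (d + 2))
        (.assign (d + 1) (.add (.var (d + 1)) (.var (d + 2))))))
      (.assign d (.var (d + 1))))

/-! ### Hoare-style rules with time bounds for machine programs. -/

section Semantics

@[simp] theorem setVar_var (s : Mem) (i m j : ℕ) :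
    (s.setVar i m).var j = if j = i then m else s.var j := rfl

@[simp] theorem setVar_arr (s : Mem) (i m : ℕ) : (s.setVar i m).arr = s.arr := rfl

@[simp] theorem setArr_var (s : Mem) (a i j m : ℕ) : (s.setArr a i j m).var = s.var := rfl

@[simp] theorem setArr_arr (s : Mem) (a i j m a' i' j' : ℕ) :
    (s.setArr a i j m).arr a' i' j' =
      if a' = a ∧ i' = i ∧ j' = j then m else s.arr a' i' j' := rfl

/-- `p` halts on `s` within time `B`, in a memory that satisfies `Q`. -/
def Halts (p : Prog) (s : Mem) (B : ℕ) (Q : Mem → Prop) : Prop :=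
  ∃ t s', Exec p s t s' ∧ t ≤ B ∧ Q s'

theorem Halts.mono {p : Prog} {s : Mem} {B B' : ℕ} {Q Q' : Mem → Prop} (h : Halts p s B Q)
    (hB : B ≤ B') (hQ : ∀ s', Q s' → Q' s') : Halts p s B' Q' := by
  obtain ⟨t, s', he, ht, hq⟩ := h
  exact ⟨t, s', he, ht.trans hB, hQ s' hq⟩

theorem Halts.seq {p q : Prog} {s : Mem} {B B' : ℕ} {Q Q' : Mem → Prop} (h : Halts p s B Q)
    (h' : ∀ s', Q s' → Halts q s' B' Q') : Halts (.seq p q) s (B + B') Q' := by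
  obtain ⟨t, s', he, ht, hq⟩ := h
  obtain ⟨t', s'', he', ht', hq'⟩ := h' s' hq
  exact ⟨t + t', s'', .seq he he', add_le_add ht ht', hq'⟩

theorem Halts.assign {i : ℕ} {e : Expr} {s : Mem} {B : ℕ} {Q : Mem → Prop}
    (hB : e.cost s + 1 ≤ B) (hQ : Q (s.setVar i (e.eval s))) : Halts (.assign i e) s B Q :=
  ⟨_, _, .assign i e s, hB, hQ⟩

theorem Halts.store {a : ℕ} {e₁ e₂ e : Expr} {s : Mem} {B : ℕ} {Q : Mem → Prop}
    (hB : e₁.cost s + e₂.cost s + e.cost s + 1 ≤ B)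
    (hQ : Q (s.setArr a (e₁.eval s) (e₂.eval s) (e.eval s))) : Halts (.store a e₁ e₂ e) s B Q :=
  ⟨_, _, .store a e₁ e₂ e s, hB, hQ⟩

/-- The test costs `3` and each pass through the loop rule `1` more; this explains the `4` per
iteration and the final `4`. -/
theorem halts_while {x n B : ℕ} {p : Prog} {I : ℕ → Mem → Prop}
    (hI : ∀ i s, I i s → s.var 0 = n ∧ s.var x = i)
    (hstep : ∀ i < n, ∀ s, I i s → Halts p s B (I (i + 1))) {s : Mem} (h0 : I 0 s) :
    Halts (.while (.lt (.var x) (.var 0)) p) s (n * (B + 4) + 4) (I n) := by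
  suffices key : ∀ m i s, i + m = n → I i s →
      Halts (.while (.lt (.var x) (.var 0)) p) s (m * (B + 4) + 4) (I n) from
    key n 0 s (by omega) h0
  intro m
  induction m with
  | zero =>
    intro i s hi hs
    obtain rfl : i = n := by omega
    obtain ⟨h1, h2⟩ := hI _ _ hs
    exact ⟨_, s, .while_false p (by simp [Expr.eval, h1, h2]), by simp [Expr.cost], hs⟩
  | succ m ih =>
    intro i s hi hs
    obtain ⟨h1, h2⟩ := hI _ _ hs
    obtain ⟨t, s', he, ht, hs'⟩ := hstep i (by omega) s hs
    obtain ⟨t', s'', he', ht', hq⟩ := ih (i + 1) s' (by omega) hs'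
    refine ⟨_, s'', .while_true (by simp [Expr.eval, h1, h2]; omega) he he', ?_, hq⟩
    simp only [Expr.cost]
    linarith

/-- The rule for `forLoop`: `Q` must not depend on the variables up to `d`. -/
theorem halts_forLoop {x d B : ℕ} {p : Prog} {Q : ℕ → Mem → Prop} (hx0 : x ≠ 0) (hxd : x < d)
    {s₀ : Mem}
    (hQ : ∀ i s s', (∀ j, d < j → s'.var j = s.var j) → s'.arr = s.arr → Q i s → Q i s')
    (hstep : ∀ i < s₀.var 0, ∀ s, Q i s → s.var x = i → (∀ j < d, j ≠ x → s.var j = s₀.var j) →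
      Halts p s B (fun s' => Q (i + 1) s' ∧ ∀ j ≤ d, s'.var j = s.var j))
    (h0 : Q 0 s₀) :
    Halts (forLoop x d p) s₀ (s₀.var 0 * (B + 8) + 10)
      (fun s' => Q (s₀.var 0) s' ∧ ∀ j < d, s'.var j = s₀.var j) := by
  set n := s₀.var 0
  let I : ℕ → Mem → Prop := fun i s =>
    Q i s ∧ s.var x = i ∧ s.var d = s₀.var x ∧ ∀ j < d, j ≠ x → s.var j = s₀.var j
  have hw : ∀ s, I 0 s → Halts (.while (.lt (.var x) (.var 0))
      (.seq p (.assign x (.add (.var x) (.const 1))))) s (n * (B + 4 + 4) + 4) (I n) := by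
    intro s hs
    refine halts_while (fun i s hs => ⟨hs.2.2.2 0 (by omega) (Ne.symm hx0), hs.2.1⟩) ?_ hs
    rintro i hi s ⟨hq, hsx, hsd, hsv⟩
    refine (hstep i hi s hq hsx hsv).seq fun s' hs' => ?_
    obtain ⟨hq', hv⟩ := hs'
    refine Halts.assign (by simp [Expr.cost]) ⟨?_, ?_, ?_, ?_⟩
    · exact hQ _ s' _ (fun j hj => by simp [Expr.eval]; omega) rfl hq'
    · simp [Expr.eval, hv x hxd.le, hsx]
    · simp [Expr.eval, hxd.ne', hv d le_rfl, hsd]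
    · intro j hj hjx
      simp [hjx, hv j hj.le, hsv j hj hjx]
  -- The three plain assignments cost `2` each; in an iteration, the increment adds `4` to the body
  -- and the loop test another `4`.
  refine Halts.mono (B := 2 + (2 + (n * (B + 4 + 4) + 4 + 2))) ?_ (by linarith) (fun _ h => h)
  refine Halts.seq (Q := fun s => s = s₀.setVar d (s₀.var x))
    (Halts.assign (by simp [Expr.cost]) rfl) ?_
  rintro s rfl
  refine Halts.seq (Q := fun s => s = (s₀.setVar d (s₀.var x)).setVar x 0)
    (Halts.assign (by simp [Expr.cost]) rfl) ?_
  rintro s rfl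
  refine Halts.seq (hw _ ⟨?_, by simp, by simp [hxd.ne'], ?_⟩) fun s hs => ?_
  · exact hQ _ s₀ _ (fun j hj => by
      have : j ≠ x := by omega
      have : j ≠ d := by omega
      simp [*]) rfl h0
  · intro j hj hjx
    simp [hjx, hj.ne]
  · obtain ⟨hq, -, hsd, hsv⟩ := hs
    refine Halts.assign (by simp [Expr.cost]) ⟨?_, ?_⟩
    · exact hQ _ s _ (fun j hj => by
        have : j ≠ x := by omega
        simp [*]) rfl hq
    · intro j hj
      by_cases hjx : j = x
      · simp [hjx, Expr.eval, hsd]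
      · simp [hjx, hsv j hj hjx]

end Semantics

/-! ### Correctness and running time of compiled expressions. -/

namespace HExpr

/-- Compiled code overwrites variables from `D` on and array `D`; this says that such scratch space
does not affect values. -/
theorem eval_congr {D : ℕ} (hD : 0 < D) (e : HExpr) (he : e.ok D = true) {s s' : Mem}
    (hv : ∀ i < D, s.var i = s'.var i) (ha : ∀ a < D, s.arr a = s'.arr a) :
    e.eval s = e.eval s' := by
  induction e generalizing s s' with
  | const m => rfl
  | var i => exact hv i (by simpa [ok] using he)
  | arr a e₁ e₂ h₁ h₂ =>
    simp only [ok, Bool.and_eq_true, decide_eq_true_eq] at he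
    simp only [eval, h₁ he.2.1 hv ha, h₂ he.2.2 hv ha, ha a he.1]
  | add e₁ e₂ h₁ h₂ | sub e₁ e₂ h₁ h₂ | lt e₁ e₂ h₁ h₂ | eq e₁ e₂ h₁ h₂ =>
    simp only [ok, Bool.and_eq_true] at he
    simp only [eval, h₁ he.1 hv ha, h₂ he.2 hv ha]
  | cond e₁ e₂ e₃ h₁ h₂ h₃ =>
    simp only [ok, Bool.and_eq_true] at he
    simp only [eval, h₁ he.1 hv ha, h₂ he.2.1 hv ha, h₃ he.2.2 hv ha]
  | sum x e h =>
    simp only [ok, Bool.and_eq_true, decide_eq_true_eq] at he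
    simp only [eval, hv 0 hD]
    refine Finset.sum_congr rfl fun i _ => h he.2.2 (fun j hj => ?_) (fun a h => ha a h)
    by_cases hjx : j = x
    · simp [hjx]
    · simp [hjx, hv j hj]

/-- A bound for the running time, as a polynomial in variable `0`. -/
def time : HExpr → Polynomial ℕ
  | const _ => 2
  | var _ => 2
  | arr _ e₁ e₂ => e₁.time + (e₂.time + 4)
  | add e₁ e₂ => e₁.time + (e₂.time + 4)
  | sub e₁ e₂ => e₁.time + (e₂.time + 4)
  | lt e₁ e₂ => e₁.time + (e₂.time + 4)
  | eq e₁ e₂ => e₁.time + (e₂.time + 4)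
  | cond e₁ e₂ e₃ => e₁.time + (e₂.time + e₃.time + 2)
  | sum _ e => 2 + (Polynomial.X * (e.time + 4 + 8) + 10 + 2)

/-- What the compiled code of `e` does. -/
def Spec (e : HExpr) (d : ℕ) (s : Mem) : Prop :=
  Halts (e.compile d) s (e.time.eval (s.var 0)) fun s' =>
    s'.var d = e.eval s ∧ (∀ i < d, s'.var i = s.var i) ∧ s'.arr = s.arr

/-- The code of `e₂` starts at `d + 1`, so it leaves the value of `e₁` in variable `d` intact. -/
theorem halts_binary {D d : ℕ} (hD : 0 < D) (hd : D ≤ d) {e₁ e₂ : HExpr} {e : Expr} {s : Mem}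
    (he₂ : e₂.ok D = true) (h₁ : ∀ s, e₁.Spec d s) (h₂ : ∀ s, e₂.Spec (d + 1) s)
    (he : ∀ s, e.cost s + 1 ≤ 4) {m : ℕ}
    (hm : ∀ s', s'.arr = s.arr → s'.var d = e₁.eval s → s'.var (d + 1) = e₂.eval s →
      e.eval s' = m) :
    Halts (.seq (e₁.compile d) (.seq (e₂.compile (d + 1)) (.assign d e))) s
      ((e₁.time + (e₂.time + 4)).eval (s.var 0)) fun s' =>
      s'.var d = m ∧ (∀ i < d, s'.var i = s.var i) ∧ s'.arr = s.arr := by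
  simp only [Polynomial.eval_add, Polynomial.eval_ofNat]
  refine (h₁ s).seq ?_
  rintro s₁ ⟨hv₁, hf₁, ha₁⟩
  have h2 := h₂ s₁
  unfold Spec at h2
  rw [hf₁ 0 (by omega)] at h2
  refine h2.seq ?_
  rintro s₂ ⟨hv₂, hf₂, ha₂⟩
  refine Halts.assign (he _) ⟨?_, ?_, ?_⟩
  · simp only [setVar_var, if_true]
    refine hm s₂ (ha₂.trans ha₁) ?_ ?_
    · rw [hf₂ d (by omega), hv₁]
    · rw [hv₂]
      exact e₂.eval_congr hD he₂ (fun i hi => hf₁ i (by omega)) (fun a _ => by rw [ha₁])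
  · intro i hi
    simp [hi.ne, hf₂ i (by omega), hf₁ i hi]
  · simp [ha₂, ha₁]

theorem spec {D : ℕ} (hD : 0 < D) (e : HExpr) (he : e.ok D = true) {d : ℕ} (hd : D ≤ d)
    (s : Mem) : e.Spec d s := by
  induction e generalizing d s with
  | const m =>
    exact Halts.assign (by simp [Expr.cost, time])
      ⟨by simp [Expr.eval, eval], fun i hi => by simp [hi.ne], rfl⟩
  | var i =>
    exact Halts.assign (by simp [Expr.cost, time])
      ⟨by simp [Expr.eval, eval], fun i hi => by simp [hi.ne], rfl⟩
  | arr a e₁ e₂ h₁ h₂ =>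
    simp only [ok, Bool.and_eq_true, decide_eq_true_eq] at he
    exact halts_binary hD hd he.2.2 (h₁ he.2.1 hd) (h₂ he.2.2 (by omega))
      (fun s => by simp [Expr.cost]) (fun s' ha h1 h2 => by simp [Expr.eval, eval, h1, h2, ha])
  | add e₁ e₂ h₁ h₂ | sub e₁ e₂ h₁ h₂ | lt e₁ e₂ h₁ h₂ | eq e₁ e₂ h₁ h₂ =>
    simp only [ok, Bool.and_eq_true] at he
    exact halts_binary hD hd he.2 (h₁ he.1 hd) (h₂ he.2 (by omega))
      (fun s => by simp [Expr.cost]) (fun s' ha h1 h2 => by simp [Expr.eval, eval, h1, h2])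
  | cond e₁ e₂ e₃ h₁ h₂ h₃ =>
    simp only [ok, Bool.and_eq_true] at he
    unfold Spec
    simp only [time, Polynomial.eval_add, Polynomial.eval_ofNat]
    refine (h₁ he.1 hd s).seq ?_
    rintro s₁ ⟨hv₁, hf₁, ha₁⟩
    have hcongr : ∀ e : HExpr, e.ok D = true → e.eval s₁ = e.eval s := fun e he =>
      e.eval_congr hD he (fun i hi => hf₁ i (by omega)) (fun a _ => by rw [ha₁])
    by_cases hc : e₁.eval s ≠ 0
    · obtain ⟨t, s', hex, ht, h1, h2, h3⟩ := h₂ he.2.1 hd s₁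
      rw [hf₁ 0 (by omega)] at ht
      refine ⟨_, s', .ite_true _ (by simpa [Expr.eval, hv₁] using hc) hex, ?_, ?_, ?_, ?_⟩
      · simp only [Expr.cost]; omega
      · rw [h1, hcongr e₂ he.2.1]; simp [eval, hc]
      · intro i hi; rw [h2 i hi, hf₁ i hi]
      · rw [h3, ha₁]
    · obtain ⟨t, s', hex, ht, h1, h2, h3⟩ := h₃ he.2.2 hd s₁
      rw [hf₁ 0 (by omega)] at ht
      rw [not_not] at hc
      refine ⟨_, s', .ite_false _ (by simpa [Expr.eval, hv₁] using hc) hex, ?_, ?_, ?_, ?_⟩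
      · simp only [Expr.cost]; omega
      · rw [h1, hcongr e₃ he.2.2]; simp [eval, hc]
      · intro i hi; rw [h2 i hi, hf₁ i hi]
      · rw [h3, ha₁]
  | sum x e h =>
    simp only [ok, Bool.and_eq_true, decide_eq_true_eq] at he
    obtain ⟨hxD, hx0, he⟩ := he
    unfold Spec
    simp only [time, Polynomial.eval_add, Polynomial.eval_mul, Polynomial.eval_X,
      Polynomial.eval_ofNat]
    refine Halts.seq (Q := fun s' => s' = s.setVar (d + 1) 0)
      (Halts.assign (by simp [Expr.cost]) rfl) ?_
    rintro s₁ rfl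
    -- Variable `d` saves `x`, variable `d + 1` accumulates the partial sums, and the body is
    -- evaluated from `d + 2` on.
    have hloop := halts_forLoop (x := x) (d := d)
      (p := .seq (e.compile (d + 2)) (.assign (d + 1) (.add (.var (d + 1)) (.var (d + 2)))))
      (B := e.time.eval (s.var 0) + 4) (s₀ := s.setVar (d + 1) 0)
      (Q := fun i s' => s'.var (d + 1) = ∑ j ∈ Finset.range i, e.eval (s.setVar x j) ∧
        s'.arr = s.arr) (by omega) (by omega)
      (fun i s s' h1 h2 h3 => ⟨by rw [h1 _ (by omega)]; exact h3.1, h2.trans h3.2⟩) ?_ ?_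
    · have h0 : (s.setVar (d + 1) 0).var 0 = s.var 0 := by simp
      rw [h0] at hloop
      refine hloop.seq ?_
      rintro s₂ ⟨⟨hv, ha⟩, hf⟩
      refine Halts.assign (by simp [Expr.cost]) ⟨?_, ?_, ?_⟩
      · simp [Expr.eval, eval, hv]
      · intro i hi
        have h1 : i ≠ d + 1 := by omega
        rw [setVar_var, if_neg hi.ne, hf i hi, setVar_var, if_neg h1]
      · rw [setVar_arr, ha]
    · rintro i hi s' ⟨hv, ha⟩ hx hf
      have hf' : ∀ j < d, j ≠ x → s'.var j = s.var j := fun j hj hjx => by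
        have h1 : j ≠ d + 1 := by omega
        rw [hf j hj hjx, setVar_var, if_neg h1]
      have hsp := h he (d := d + 2) (by omega) s'
      unfold Spec at hsp
      rw [hf' 0 (by omega) (by omega)] at hsp
      refine hsp.seq ?_
      rintro s₂ ⟨hv₂, hf₂, ha₂⟩
      refine Halts.assign (by simp [Expr.cost]) ⟨⟨?_, ?_⟩, ?_⟩
      · rw [Finset.sum_range_succ]
        simp only [setVar_var, if_true, Expr.eval, hv₂, hf₂ (d + 1) (by omega), hv]
        congr 1
        refine e.eval_congr hD he (fun j hj => ?_) (fun a _ => by rw [ha, setVar_arr])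
        by_cases hjx : j = x
        · simp [hjx, hx]
        · rw [hf' j (by omega) hjx, setVar_var, if_neg hjx]
      · rw [setVar_arr, ha₂, ha]
      · intro j hj
        have h1 : j ≠ d + 1 := by omega
        rw [setVar_var, if_neg h1, hf₂ j (by omega)]
    · simp

end HExpr

/-! ### The command language and the correctness of its compiler. -/

/-- Commands: a simultaneous assignment to all entries `(i, j)`, `i, j < n`, of an array (variables
`4` and `5` stand for `i` and `j`), composition, and `n`-fold repetition. -/
inductive HCmd where
  | set (a : ℕ) (e : HExpr)
  | seq (c₁ c₂ : HCmd)
  | rep (c : HCmd)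

namespace HCmd

/-- The effect of a command. -/
def run : HCmd → Mem → Mem
  | set a e, s => ⟨s.var, fun a' i j =>
      if a' = a ∧ i < s.var 0 ∧ j < s.var 0 then e.eval ((s.setVar 4 i).setVar 5 j)
      else s.arr a' i j⟩
  | seq c₁ c₂, s => c₂.run (c₁.run s)
  | rep c, s => c.run^[s.var 0] s

/-- All variables and arrays of the command are below `D`. -/
def ok (D : ℕ) : HCmd → Bool
  | set a e => a < D && e.ok D
  | seq c₁ c₂ => c₁.ok D && c₂.ok D
  | rep c => c.ok D

/-- The compiled code uses array `D` and the variables from `d` on as scratch space. -/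
def compile (D : ℕ) : HCmd → ℕ → Prog
  | set a e, d => .seq
      (forLoop 4 d (forLoop 5 (d + 1) (.seq (e.compile (d + 2))
        (.store D (.var 4) (.var 5) (.var (d + 2))))))
      (forLoop 4 d (forLoop 5 (d + 1)
        (.store a (.var 4) (.var 5) (.arr D (.var 4) (.var 5)))))
  | seq c₁ c₂, d => .seq (c₁.compile D d) (c₂.compile D d)
  | rep c, d => forLoop d (d + 1) (c.compile D (d + 2))

/-- A bound for the running time, as a polynomial in variable `0`. -/
def time : HCmd → Polynomial ℕ
  | set _ e => (Polynomial.X * (Polynomial.X * (e.time + 4 + 8) + 10 + 8) + 10) +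
      (Polynomial.X * (Polynomial.X * (6 + 8) + 10 + 8) + 10)
  | seq c₁ c₂ => c₁.time + c₂.time
  | rep c => Polynomial.X * (c.time + 8) + 10

@[simp] theorem run_var (c : HCmd) (s : Mem) : (c.run s).var = s.var := by
  induction c generalizing s with
  | set a e => rfl
  | seq c₁ c₂ h₁ h₂ => rw [run, h₂, h₁]
  | rep c h =>
    rw [run]
    generalize s.var 0 = m
    induction m with
    | zero => rfl
    | succ m ih => rw [Function.iterate_succ_apply', h, ih]

theorem iterate_run_var (c : HCmd) (m : ℕ) (s : Mem) : (c.run^[m] s).var = s.var := by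
  induction m with
  | zero => rfl
  | succ m ih => rw [Function.iterate_succ_apply', run_var, ih]

/-- The actual memory `s` and the ideal memory `s₀` need to agree only below `D`. This is the form
that survives composition, as the scratch space differs after each command. -/
theorem halts_compile {D : ℕ} (hD : 6 ≤ D) (c : HCmd) (hc : c.ok D = true) {d : ℕ} (hd : D ≤ d)
    {s s₀ : Mem} (hv : ∀ i < D, s.var i = s₀.var i) (ha : ∀ a < D, s.arr a = s₀.arr a) :
    Halts (c.compile D d) s (c.time.eval (s₀.var 0)) fun s' =>
      (∀ i < d, s'.var i = s.var i) ∧ ∀ a < D, s'.arr a = (c.run s₀).arr a := by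
  induction c generalizing d s s₀ with
  | set a e =>
    simp only [ok, Bool.and_eq_true, decide_eq_true_eq] at hc
    obtain ⟨haD, he⟩ := hc
    set n := s₀.var 0 with hn
    have hsn : s.var 0 = n := hv 0 (by omega)
    let val : ℕ → ℕ → ℕ := fun i j => e.eval ((s₀.setVar 4 i).setVar 5 j)
    simp only [time, Polynomial.eval_add, Polynomial.eval_mul, Polynomial.eval_X,
      Polynomial.eval_ofNat]
    -- the values are computed into array `D`
    have step1 : Halts (forLoop 4 d (forLoop 5 (d + 1) (.seq (e.compile (d + 2))
        (.store D (.var 4) (.var 5) (.var (d + 2)))))) s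
        (n * (n * (e.time.eval n + 4 + 8) + 10 + 8) + 10) (fun s' =>
          ((∀ i < n, ∀ j < n, s'.arr D i j = val i j) ∧ ∀ b < D, s'.arr b = s₀.arr b) ∧
          ∀ i < d, s'.var i = s.var i) := by
      have := halts_forLoop (x := 4) (d := d) (p := forLoop 5 (d + 1) (.seq (e.compile (d + 2))
          (.store D (.var 4) (.var 5) (.var (d + 2))))) (s₀ := s)
          (B := n * (e.time.eval n + 4 + 8) + 10)
          (Q := fun i s' => (∀ i' < i, ∀ j < n, s'.arr D i' j = val i' j) ∧
            ∀ b < D, s'.arr b = s₀.arr b) (by omega) (by omega)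
          (fun i s s' _ h2 h3 => by simpa only [h2] using h3) ?_
          ⟨fun i hi => absurd hi (by omega), ha⟩
      · rwa [hsn] at this
      rintro i hi s₁ ⟨hT, hA⟩ hs4 hf
      have hs₁n : s₁.var 0 = n := by rw [hf 0 (by omega) (by omega), hsn]
      have := halts_forLoop (x := 5) (d := d + 1) (p := .seq (e.compile (d + 2))
          (.store D (.var 4) (.var 5) (.var (d + 2)))) (s₀ := s₁)
          (B := e.time.eval n + 4)
          (Q := fun j s' => (∀ i' < i, ∀ j < n, s'.arr D i' j = val i' j) ∧
            (∀ j' < j, s'.arr D i j' = val i j') ∧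
            ∀ b < D, s'.arr b = s₀.arr b) (by omega) (by omega)
          (fun i s s' _ h2 h3 => by simpa only [h2] using h3) ?_
          ⟨hT, fun i hi => absurd hi (by omega), hA⟩
      · rw [hs₁n] at this
        refine this.mono le_rfl ?_
        rintro s' ⟨⟨h1, h2, h3⟩, h4⟩
        refine ⟨⟨fun i' hi' j hj => ?_, h3⟩, fun j hj => h4 j (by omega)⟩
        rcases Nat.lt_succ_iff_lt_or_eq.1 hi' with h | rfl
        · exact h1 i' h j hj
        · exact h2 j hj
      rintro j hj s₂ ⟨h1, h2, h3⟩ hs5 hf2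
      have hsp := e.spec (D := D) (by omega) he (d := d + 2) (by omega) s₂
      unfold HExpr.Spec at hsp
      rw [hf2 0 (by omega) (by omega), hs₁n] at hsp
      refine hsp.seq ?_
      rintro s₃ ⟨hv₃, hf₃, ha₃⟩
      have e4 : s₃.var 4 = i := by rw [hf₃ 4 (by omega), hf2 4 (by omega) (by omega), hs4]
      have e5 : s₃.var 5 = j := by rw [hf₃ 5 (by omega), hs5]
      have eval_eq : s₃.var (d + 2) = val i j := by
        rw [hv₃]
        refine e.eval_congr (D := D) (by omega) he (fun z hz => ?_) (fun b hb => h3 b hb)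
        by_cases hz5 : z = 5
        · simp [hz5, hs5]
        by_cases hz4 : z = 4
        · simp [hz4, hf2 4 (by omega) (by omega), hs4]
        · rw [hf2 z (by omega) hz5, hf z (by omega) hz4, hv z hz]
          simp [hz4, hz5]
      refine Halts.store (by simp [Expr.cost]) ⟨⟨?_, ?_, ?_⟩, ?_⟩
      · intro i' hi' j' hj'
        have : i' ≠ i := by omega
        simp [Expr.eval, e4, e5, this, ha₃, h1 i' hi' j' hj']
      · intro j' hj'
        simp only [setArr_arr, Expr.eval, e4, e5, true_and, eval_eq, ha₃]
        split_ifs with h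
        · rw [h]
        · exact h2 j' (by omega)
      · intro b hb
        rw [← h3 b hb, ← ha₃]
        funext x y
        have : b ≠ D := by omega
        simp [this]
      · intro j' hj'
        rw [setArr_var, hf₃ j' (by omega)]
    refine step1.seq ?_
    rintro s₁ ⟨⟨hT, hA⟩, hf⟩
    have hs₁n : s₁.var 0 = n := by rw [hf 0 (by omega), hsn]
    -- The values are copied from array `D` to `a` row by row. Two phases are needed since `e` may
    -- read `a`; array `D` stays fixed while copying, as `a < D`.
    have := halts_forLoop (x := 4) (d := d) (p := forLoop 5 (d + 1)
          (.store a (.var 4) (.var 5) (.arr D (.var 4) (.var 5)))) (s₀ := s₁)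
          (B := n * (6 + 8) + 10)
          (Q := fun i s' => s'.arr D = s₁.arr D ∧ ∀ b < D, ∀ x y, s'.arr b x y =
            if b = a ∧ x < i ∧ y < n then val x y else s₀.arr b x y) (by omega) (by omega)
          (fun i s s' _ h2 h3 => by simpa only [h2] using h3) ?_
          ⟨rfl, fun b hb x y => by simp [hA b hb]⟩
    · rw [hs₁n] at this
      refine this.mono le_rfl ?_
      rintro s' ⟨⟨-, h⟩, h'⟩
      refine ⟨fun i hi => by rw [h' i hi, hf i hi], fun b hb => ?_⟩
      funext x y
      rw [h b hb x y]
      rfl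
    rintro i hi s₂ ⟨hD2, hA2⟩ hs4 hf2
    have hs₂n : s₂.var 0 = n := by rw [hf2 0 (by omega) (by omega), hs₁n]
    have := halts_forLoop (x := 5) (d := d + 1)
        (p := .store a (.var 4) (.var 5) (.arr D (.var 4) (.var 5))) (s₀ := s₂)
        (B := 6)
        (Q := fun j s' => s'.arr D = s₁.arr D ∧ ∀ b < D, ∀ x y, s'.arr b x y =
            if b = a ∧ ((x < i ∧ y < n) ∨ (x = i ∧ y < j)) then val x y else s₀.arr b x y)
        (by omega) (by omega)
        (fun i s s' _ h2 h3 => by simpa only [h2] using h3) ?_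
        ⟨hD2, fun b hb x y => by simp [hA2 b hb]⟩
    · rw [hs₂n] at this
      refine this.mono le_rfl ?_
      rintro s' ⟨⟨h1, h2⟩, h3⟩
      refine ⟨⟨h1, fun b hb x y => ?_⟩, fun j hj => h3 j (by omega)⟩
      rw [h2 b hb]
      refine if_congr (and_congr_right fun _ => ?_) rfl rfl
      constructor
      · rintro (⟨h, h'⟩ | ⟨h, h'⟩) <;> constructor <;> omega
      · rintro ⟨h, h'⟩
        rcases Nat.lt_succ_iff_lt_or_eq.1 h with h | h
        · exact Or.inl ⟨h, h'⟩
        · exact Or.inr ⟨h, h'⟩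
    rintro j hj s₃ ⟨h1, h2⟩ hs5 hf3
    have e4 : s₃.var 4 = i := by rw [hf3 4 (by omega) (by omega), hs4]
    have haD' : D ≠ a := by omega
    rw [hs₁n] at hi
    rw [hs₂n] at hj
    refine Halts.store (by simp [Expr.cost]) ⟨⟨?_, ?_⟩, fun j' _ => by rw [setArr_var]⟩
    · funext x y
      simp [haD', h1]
    · intro b hb x y
      simp only [setArr_arr, Expr.eval, e4, hs5, h1, hT i hi j hj, h2 b hb]
      by_cases hba : b = a
      · by_cases hxy : x = i ∧ y = j
        · obtain ⟨rfl, rfl⟩ := hxy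
          simp [hba]
        · have : (x < i ∧ y < n ∨ x = i ∧ y < j) ↔ (x < i ∧ y < n ∨ x = i ∧ y < j + 1) := by omega
          simp [hba, hxy, this]
      · simp [hba]
  | seq c₁ c₂ h₁ h₂ =>
    simp only [ok, Bool.and_eq_true] at hc
    simp only [time, Polynomial.eval_add]
    refine (h₁ hc.1 hd hv ha).seq ?_
    rintro s₁ ⟨hv₁, ha₁⟩
    have := h₂ hc.2 hd (s := s₁) (s₀ := c₁.run s₀)
      (fun i hi => by rw [hv₁ i (by omega), run_var, hv i hi]) ha₁
    rw [run_var] at this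
    refine this.mono le_rfl ?_
    rintro s₂ ⟨hv₂, ha₂⟩
    exact ⟨fun i hi => by rw [hv₂ i hi, hv₁ i hi], ha₂⟩
  | rep c h =>
    have hsn : s.var 0 = s₀.var 0 := hv 0 (by omega)
    have := halts_forLoop (x := d) (d := d + 1) (p := c.compile D (d + 2)) (s₀ := s)
        (B := c.time.eval (s₀.var 0))
        (Q := fun i s' => ∀ b < D, s'.arr b = (c.run^[i] s₀).arr b) (by omega) (by omega)
        (fun i s s' _ h2 h3 => by simpa only [h2] using h3) ?_ ha
    · simp only [time, Polynomial.eval_add, Polynomial.eval_mul, Polynomial.eval_X,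
        Polynomial.eval_ofNat]
      rw [hsn] at this
      refine this.mono le_rfl ?_
      rintro s' ⟨h1, h2⟩
      exact ⟨fun i hi => h2 i (by omega), h1⟩
    · intro i hi s' hs' hsd hf
      have := h hc (d := d + 2) (by omega) (s := s') (s₀ := c.run^[i] s₀) (fun z hz => by
        rw [hf z (by omega) (by omega), iterate_run_var, hv z hz]) hs'
      rw [iterate_run_var] at this
      refine this.mono le_rfl ?_
      rintro s'' ⟨h1, h2⟩
      refine ⟨?_, fun j hj => h1 j (by omega)⟩
      simpa only [Function.iterate_succ_apply'] using h2

end HCmd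

theorem monotone_polynomial_eval (p : Polynomial ℕ) : Monotone fun n => p.eval n := by
  intro a b hab
  simp only [Polynomial.eval_eq_sum_range]
  exact Finset.sum_le_sum fun i _ => Nat.mul_le_mul_left _ (Nat.pow_le_pow_left hab i)

/-- A command followed by an expression, whose value is put into variable `0`. -/
theorem exists_prog {D : ℕ} (hD : 6 ≤ D) (c : HCmd) (hc : c.ok D = true) (e : HExpr)
    (he : e.ok D = true) :
    ∃ (A : Prog) (T : Polynomial ℕ), ∀ s : Mem,
      Halts A s (T.eval (s.var 0)) fun s' =>
        s'.var 0 = e.eval (c.run s) ∧ ∀ a < D, s'.arr a = (c.run s).arr a := by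
  refine ⟨.seq (c.compile D D) (.seq (e.compile D) (.assign 0 (.var D))),
    c.time + (e.time + 2), fun s => ?_⟩
  simp only [Polynomial.eval_add, Polynomial.eval_ofNat]
  refine (c.halts_compile hD hc le_rfl (fun _ _ => rfl) (fun _ _ => rfl)).seq ?_
  rintro s₁ ⟨hv, ha⟩
  have hsp := e.spec (D := D) (by omega) he le_rfl s₁
  unfold HExpr.Spec at hsp
  rw [hv 0 (by omega)] at hsp
  refine hsp.seq ?_
  rintro s₂ ⟨hv₂, -, ha₂⟩
  refine Halts.assign (by simp [Expr.cost]) ⟨?_, fun a h => ?_⟩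
  · simp only [setVar_var, if_true, Expr.eval, hv₂]
    exact e.eval_congr (D := D) (by omega) he
      (fun i hi => by rw [hv i hi, HCmd.run_var]) ha
  · rw [setVar_arr, ha₂, ha a h]

end OutlierLine

end

noncomputable section
namespace OutlierLine

/-! ## Derived expressions -/

namespace HExpr

/-- Conjunction, where every number but `0` counts as true. -/
def and (e₁ e₂ : HExpr) : HExpr := cond e₁ e₂ (const 0)

/-- Disjunction. -/
def or (e₁ e₂ : HExpr) : HExpr := cond e₁ (const 1) e₂

/-- Negation. -/
def not (e : HExpr) : HExpr := cond e (const 0) (const 1)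

/-- Implication. -/
def imp (e₁ e₂ : HExpr) : HExpr := cond e₁ e₂ (const 1)

/-- There is `x < n` with `e`. -/
def ex (x : ℕ) (e : HExpr) : HExpr := sum x e

/-- All `x < n` satisfy `e`. -/
def all (x : ℕ) (e : HExpr) : HExpr := not (ex x (not e))

/-- The number of `x < n` with `e`. -/
def count (x : ℕ) (e : HExpr) : HExpr := sum x (cond e (const 1) (const 0))

/-- The product of `e₁` and `e₂`, if `e₁ ≤ n` and `x` does not occur. -/
def mulSmall (x : ℕ) (e₁ e₂ : HExpr) : HExpr := sum x (cond (lt (var x) e₁) e₂ (const 0))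

/-- The entry of array `a` in the row given by variable `x`, column `0`. -/
def col (a x : ℕ) : HExpr := arr a (var x) (const 0)

/-- The entry of array `a` with indices the variables `x` and `y`. -/
def entry (a x y : ℕ) : HExpr := arr a (var x) (var y)

variable {e e₁ e₂ e₃ : HExpr} {s : Mem}

@[simp] theorem eval_const (m : ℕ) : (const m).eval s = m := rfl
@[simp] theorem eval_var (i : ℕ) : (var i).eval s = s.var i := rfl
@[simp] theorem eval_arr (a : ℕ) : (arr a e₁ e₂).eval s = s.arr a (e₁.eval s) (e₂.eval s) := rfl
@[simp] theorem eval_add : (add e₁ e₂).eval s = e₁.eval s + e₂.eval s := rfl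
@[simp] theorem eval_sub : (sub e₁ e₂).eval s = e₁.eval s - e₂.eval s := rfl
@[simp] theorem eval_cond :
    (cond e₁ e₂ e₃).eval s = if e₁.eval s ≠ 0 then e₂.eval s else e₃.eval s := rfl
@[simp] theorem eval_col (a x : ℕ) : (col a x).eval s = s.arr a (s.var x) 0 := rfl
@[simp] theorem eval_entry (a x y : ℕ) : (entry a x y).eval s = s.arr a (s.var x) (s.var y) := rfl

@[simp] theorem lt_ne_zero : (lt e₁ e₂).eval s ≠ 0 ↔ e₁.eval s < e₂.eval s := by
  simp [eval]

@[simp] theorem eq_ne_zero : (eq e₁ e₂).eval s ≠ 0 ↔ e₁.eval s = e₂.eval s := by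
  simp [eval]

@[simp] theorem and_ne_zero : (and e₁ e₂).eval s ≠ 0 ↔ e₁.eval s ≠ 0 ∧ e₂.eval s ≠ 0 := by
  simp only [and, eval_cond, eval_const]
  split_ifs with h <;> simp [h]

@[simp] theorem or_ne_zero : (or e₁ e₂).eval s ≠ 0 ↔ e₁.eval s ≠ 0 ∨ e₂.eval s ≠ 0 := by
  simp only [or, eval_cond, eval_const]
  split_ifs with h <;> simp [h]

@[simp] theorem not_ne_zero : (not e).eval s ≠ 0 ↔ ¬ e.eval s ≠ 0 := by
  simp only [not, eval_cond, eval_const]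
  split_ifs with h <;> simp [h]

@[simp] theorem imp_ne_zero : (imp e₁ e₂).eval s ≠ 0 ↔ (e₁.eval s ≠ 0 → e₂.eval s ≠ 0) := by
  simp only [imp, eval_cond, eval_const]
  split_ifs with h <;> simp [h]

@[simp] theorem ex_ne_zero (x : ℕ) :
    (ex x e).eval s ≠ 0 ↔ ∃ i < s.var 0, e.eval (s.setVar x i) ≠ 0 := by
  simp [ex, eval]

@[simp] theorem all_ne_zero (x : ℕ) :
    (all x e).eval s ≠ 0 ↔ ∀ i < s.var 0, e.eval (s.setVar x i) ≠ 0 := by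
  rw [all, not_ne_zero, ex_ne_zero]
  simp only [not_ne_zero, not_exists, not_and, not_not]

theorem eval_count (x : ℕ) : (count x e).eval s =
    ((Finset.range (s.var 0)).filter fun i => e.eval (s.setVar x i) ≠ 0).card := by
  simp only [count, eval]
  rw [Finset.card_filter]

theorem eval_mulSmall {x a b : ℕ} (h₁ : ∀ i, e₁.eval (s.setVar x i) = a)
    (h₂ : ∀ i, e₂.eval (s.setVar x i) = b) (ha : a ≤ s.var 0) :
    (mulSmall x e₁ e₂).eval s = a * b := by
  rw [mulSmall, eval]
  have : ∀ i ∈ Finset.range (s.var 0),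
      (cond (lt (var x) e₁) e₂ (const 0)).eval (s.setVar x i) = if i < a then b else 0 := by
    intro i _
    simp only [eval_cond, lt_ne_zero, eval_var, h₁, h₂, eval_const, setVar_var, if_true]
  rw [Finset.sum_congr rfl this, ← Finset.sum_filter, Finset.sum_const, smul_eq_mul]
  congr 1
  rw [show (Finset.range (s.var 0)).filter (· < a) = Finset.range a by ext; simp; omega]
  simp

end HExpr

namespace HCmd

/-- The command may change array `a`. -/
def writes (a : ℕ) : HCmd → Bool
  | set b _ => a == b
  | seq c₁ c₂ => c₁.writes a || c₂.writes a
  | rep c => c.writes a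

theorem run_arr_of_writes_eq_false {a : ℕ} (c : HCmd) (h : c.writes a = false) (s : Mem) :
    (c.run s).arr a = s.arr a := by
  induction c generalizing s with
  | set b e =>
    funext i j
    have : a ≠ b := by simpa [writes] using h
    simp [run, this]
  | seq c₁ c₂ h₁ h₂ =>
    simp only [writes, Bool.or_eq_false_iff] at h
    rw [run, h₂ h.2, h₁ h.1]
  | rep c ih =>
    rw [run]
    generalize s.var 0 = m
    induction m with
    | zero => rfl
    | succ m ihm => rw [Function.iterate_succ_apply', ih h, ihm]

theorem run_seq (c₁ c₂ : HCmd) (s : Mem) : (seq c₁ c₂).run s = c₂.run (c₁.run s) := rfl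

theorem run_rep (c : HCmd) (s : Mem) : (rep c).run s = c.run^[s.var 0] s := rfl

theorem run_set_arr {a i j : ℕ} {e : HExpr} {s : Mem} (hi : i < s.var 0) (hj : j < s.var 0) :
    ((set a e).run s).arr a i j = e.eval ((s.setVar 4 i).setVar 5 j) := by
  simp [run, hi, hj]

theorem run_set_col {a i : ℕ} {e : HExpr} {s : Mem} (hi : i < s.var 0) :
    ((set a e).run s).arr a i 0 = e.eval ((s.setVar 4 i).setVar 5 0) :=
  run_set_arr hi (by omega)

end HCmd

open HExpr HCmd

/-! ## Distances -/

section Distances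

/-- After `r` rounds, array `5` says which pairs have distance at most `r`, and array `6` counts the
rounds before. -/
def distRound : HCmd :=
  .seq (.set 6 (.add (entry 6 4 5) (.not (entry 5 4 5))))
    (.set 5 (.or (entry 5 4 5) (.ex 6 (.and (entry 5 4 6) (entry 0 6 5)))))

/-- Compute the distances, with `n` instead of `∞`, in array `6`. -/
def distCmd : HCmd :=
  .seq (.set 5 (.eq (.var 4) (.var 5))) (.seq (.set 6 (.const 0)) (.rep distRound))

/-- Compute in array `7` which pairs have distance at most the rational number whose numerator and
denominator are variables `2` and `3`. -/
def nearCmd : HCmd :=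
  .set 7 (.and (.lt (entry 6 4 5) (.var 0))
    (.not (.lt (.var 2) (.mulSmall 6 (entry 6 4 5) (.var 3)))))

variable {n : ℕ} {G : SimpleGraph (Fin n)}

theorem edist_le_succ_iff {V : Type*} {G : SimpleGraph V} {u v : V} {r : ℕ} :
    G.edist u v ≤ (r + 1 : ℕ) ↔ G.edist u v ≤ r ∨ ∃ x, G.edist u x ≤ r ∧ G.Adj x v := by
  constructor
  · intro h
    by_cases hr : G.edist u v ≤ r
    · exact Or.inl hr
    right
    obtain ⟨p, hp⟩ := SimpleGraph.exists_walk_of_edist_ne_top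
      (ne_top_of_le_ne_top (ENat.natCast_ne_top _) h)
    rw [← hp] at h hr
    have hlen : p.length = r + 1 := by
      have h1 : p.length ≤ r + 1 := by exact_mod_cast h
      have h2 : ¬ p.length ≤ r := fun h => hr (by exact_mod_cast h)
      omega
    have hnil : ¬ p.Nil := fun h => by
      rw [← SimpleGraph.Walk.length_eq_zero_iff] at h
      omega
    refine ⟨p.penultimate, ?_, p.adj_penultimate hnil⟩
    refine (SimpleGraph.edist_le p.dropLast).trans ?_
    simp [hlen]
  · rintro (h | ⟨x, h, hx⟩)
    · exact h.trans (by exact_mod_cast Nat.le_succ r)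
    · calc G.edist u v ≤ G.edist u x + G.edist x v := SimpleGraph.edist_triangle
        _ ≤ r + 1 := add_le_add h (SimpleGraph.edist_eq_one_iff_adj.2 hx).le
        _ = (r + 1 : ℕ) := by push_cast; rfl

/-- The distance of two vertices, or `n` if there is no path. -/
def cutDist (G : SimpleGraph (Fin n)) (u v : Fin n) : ℕ :=
  if G.edist u v = ⊤ then n else (G.edist u v).toNat

theorem edist_lt_of_ne_top {u v : Fin n} (h : G.edist u v ≠ ⊤) : G.edist u v < n := by
  obtain ⟨p⟩ := SimpleGraph.edist_ne_top_iff_reachable.1 h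
  classical
  refine (SimpleGraph.edist_le (p.toPath : G.Walk u v)).trans_lt ?_
  have := p.toPath.2.length_lt
  rw [Fintype.card_fin] at this
  exact_mod_cast this

theorem cutDist_lt_iff {u v : Fin n} : cutDist G u v < n ↔ G.edist u v ≠ ⊤ := by
  unfold cutDist
  split_ifs with h
  · simp [h]
  · have := edist_lt_of_ne_top h
    lift G.edist u v to ℕ using h with m
    simp at this ⊢
    exact this

theorem cutDist_le (u v : Fin n) : cutDist G u v ≤ n := by
  by_cases h : G.edist u v = ⊤
  · simp [cutDist, h]
  · exact (cutDist_lt_iff.2 h).le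

theorem coe_cutDist {u v : Fin n} (h : G.edist u v ≠ ⊤) : (cutDist G u v : ℕ∞) = G.edist u v := by
  rw [cutDist, if_neg h, ENat.natCast_toNat h]

/-- Finite distances are below `n`, so `n` is a faithful stand-in for `∞` in comparisons. -/
theorem cutDist_le_iff {u v x y : Fin n} :
    cutDist G u v ≤ cutDist G x y ↔ G.edist u v ≤ G.edist x y := by
  by_cases h : G.edist u v = ⊤
  · by_cases h' : G.edist x y = ⊤
    · simp [cutDist, h, h']
    · have := cutDist_lt_iff.2 h'
      have e : cutDist G u v = n := by simp [cutDist, h]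
      simp only [e, h, top_le_iff, h', iff_false]
      omega
  · by_cases h' : G.edist x y = ⊤
    · have := cutDist_le (G := G) u v
      have e : cutDist G x y = n := by simp [cutDist, h']
      simp [e, h', this]
    · rw [← coe_cutDist h, ← coe_cutDist h']
      exact_mod_cast Iff.rfl

/-- The distance is the number of radii that fail to reach it, which is how the program measures it.
-/
theorem card_filter_edist (u v : Fin n) :
    ((Finset.range n).filter fun r : ℕ => ¬ G.edist u v ≤ r).card = cutDist G u v := by
  by_cases h : G.edist u v = ⊤
  · simp [h, cutDist]
  · have h1 := coe_cutDist h
    have h2 := cutDist_le (G := G) u v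
    rw [show (Finset.range n).filter (fun r : ℕ => ¬ G.edist u v ≤ r) =
      Finset.range (cutDist G u v) by
        ext r
        rw [← h1]
        simp only [Finset.mem_filter, Finset.mem_range, Nat.cast_le]
        omega]
    simp

/-- Array `a` of `s` is the adjacency matrix of `G`. -/
def IsAdjMatrix (G : SimpleGraph (Fin n)) (s : Mem) (a : ℕ) : Prop :=
  ∀ u v : Fin n, s.arr a u v ≠ 0 ↔ G.Adj u v

/-- Array `6` is updated before array `5`, so it counts with the old radius `r`. -/
theorem distRound_spec {s : Mem} (hn : s.var 0 = n) (hG : IsAdjMatrix G s 0) {r : ℕ}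
    (h5 : ∀ u v : Fin n, s.arr 5 u v ≠ 0 ↔ G.edist u v ≤ r)
    (h6 : ∀ u v : Fin n, s.arr 6 u v =
      ((Finset.range r).filter fun r : ℕ => ¬ G.edist u v ≤ r).card) :
    (∀ u v : Fin n, (distRound.run s).arr 5 u v ≠ 0 ↔ G.edist u v ≤ (r + 1 : ℕ)) ∧
    ∀ u v : Fin n, (distRound.run s).arr 6 u v =
      ((Finset.range (r + 1)).filter fun r : ℕ => ¬ G.edist u v ≤ r).card := by
  constructor
  · intro u v
    rw [distRound, run, run_set_arr (by simp [hn]) (by simp [hn])]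
    simp only [or_ne_zero, eval_entry, setVar_var, setVar_arr, ex_ne_zero, and_ne_zero, run_var, hn]
    simp only [run_arr_of_writes_eq_false _ (show writes 5 (set 6 _) = false from rfl),
      run_arr_of_writes_eq_false _ (show writes 0 (set 6 _) = false from rfl)]
    rw [edist_le_succ_iff]
    simp only [reduceIte, OfNat.zero_ne_ofNat, Nat.reduceEqDiff]
    refine or_congr (h5 u v) ?_
    constructor
    · rintro ⟨i, hi, h1, h2⟩
      exact ⟨⟨i, hi⟩, (h5 u ⟨i, hi⟩).1 h1, (hG ⟨i, hi⟩ v).1 h2⟩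
    · rintro ⟨x, h1, h2⟩
      exact ⟨x, x.2, (h5 u x).2 h1, (hG x v).2 h2⟩
  · intro u v
    rw [distRound, run, run_arr_of_writes_eq_false _ (by rfl),
      run_set_arr (by simp [hn]) (by simp [hn])]
    simp only [eval_add, eval_entry, setVar_var, setVar_arr, HExpr.not, eval_cond, eval_const]
    simp only [reduceIte, Nat.reduceEqDiff]
    rw [h6 u v, Finset.range_add_one, Finset.filter_insert]
    by_cases h : G.edist u v ≤ r
    · rw [if_pos ((h5 u v).2 h), if_neg (not_not.2 h), add_zero]
    · rw [if_neg (mt (h5 u v).1 h), if_pos h, Finset.card_insert_of_notMem (by simp)]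

theorem distCmd_spec {s : Mem} (hn : s.var 0 = n) (hG : IsAdjMatrix G s 0) (u v : Fin n) :
    (distCmd.run s).arr 6 u v = cutDist G u v := by
  rw [distCmd, run_seq, run_seq, run_rep]
  set s₁ := (set 6 (const 0)).run ((set 5 (.eq (.var 4) (.var 5))).run s)
  have hn₁ : s₁.var 0 = n := by simp [s₁, hn]
  have key : ∀ r, (∀ u v : Fin n, (distRound.run^[r] s₁).arr 5 u v ≠ 0 ↔ G.edist u v ≤ r) ∧
    ∀ u v : Fin n, (distRound.run^[r] s₁).arr 6 u v =
      ((Finset.range r).filter fun r : ℕ => ¬ G.edist u v ≤ r).card := by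
    intro r
    induction r with
    | zero =>
      constructor
      · intro u v
        simp only [Function.iterate_zero, id, s₁]
        rw [run_arr_of_writes_eq_false _ (by rfl), run_set_arr (by simp [hn]) (by simp [hn])]
        simp [Fin.ext_iff]
      · intro u v
        simp only [Function.iterate_zero, id, s₁]
        rw [run_set_arr (by simp [hn]) (by simp [hn])]
        simp
    | succ r ih =>
      rw [Function.iterate_succ_apply']
      refine distRound_spec (by rw [iterate_run_var, hn₁]) ?_ ih.1 ih.2
      intro u v
      have : (distRound.run^[r] s₁).arr 0 = s.arr 0 := by
        clear ih
        induction r with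
        | zero => simp [s₁, run_arr_of_writes_eq_false _ (show writes 0 (set 6 _) = false from rfl),
            run_arr_of_writes_eq_false _ (show writes 0 (set 5 _) = false from rfl)]
        | succ r ih => rw [Function.iterate_succ_apply', run_arr_of_writes_eq_false _ (by rfl), ih]
      rw [this]
      exact hG u v
  rw [hn₁, (key n).2, card_filter_edist]

/-- Clearing the denominator leaves a comparison of natural numbers; `toNat` loses nothing since `c`
is positive. -/
theorem gdist_le_ofReal_iff {c : ℚ} (hc : 1 ≤ c) (u v : Fin n) :
    gdist G u v ≤ ENNReal.ofReal (c : ℝ) ↔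
      cutDist G u v < n ∧ cutDist G u v * c.den ≤ c.num.toNat := by
  rw [cutDist_lt_iff]
  by_cases h : G.edist u v = ⊤
  · simp [gdist, h]
  · simp only [ne_eq, h, not_false_eq_true, true_and]
    rw [gdist, ← coe_cutDist h, ENat.toENNReal_coe, ← ENNReal.ofReal_natCast,
      ENNReal.ofReal_le_ofReal_iff (by exact_mod_cast (zero_le_one.trans hc))]
    have hnum : (c.num.toNat : ℤ) = c.num :=
      Int.toNat_of_nonneg (Rat.num_nonneg.2 (zero_le_one.trans hc))
    have h1 : ((cutDist G u v : ℕ) : ℝ) ≤ (c : ℝ) ↔ ((cutDist G u v : ℕ) : ℚ) ≤ c := by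
      exact_mod_cast Iff.rfl
    rw [h1]
    have hden : (0 : ℚ) < c.den := by exact_mod_cast c.den_pos
    conv_lhs => rw [← Rat.num_div_den c]
    rw [le_div_iff₀ hden, ← hnum]
    exact_mod_cast Iff.rfl

theorem nearCmd_spec {s : Mem} {c : ℚ} (hc : 1 ≤ c) (hn : s.var 0 = n)
    (h2 : s.var 2 = c.num.toNat) (h3 : s.var 3 = c.den)
    (h6 : ∀ u v : Fin n, s.arr 6 u v = cutDist G u v) (u v : Fin n) :
    (nearCmd.run s).arr 7 u v ≠ 0 ↔ gdist G u v ≤ ENNReal.ofReal (c : ℝ) := by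
  rw [nearCmd, run_set_arr (by simp [hn]) (by simp [hn]), gdist_le_ofReal_iff hc]
  simp only [and_ne_zero, lt_ne_zero, not_ne_zero, eval_entry, eval_var]
  rw [eval_mulSmall (a := cutDist G u v) (b := c.den) (by simp [h6]) (by simp [h3])
    (by simp [hn, cutDist_le])]
  simp [h6, hn, h2]

end Distances

end OutlierLine

end

noncomputable section
namespace OutlierLine

open HExpr HCmd

/-! ## The net, the partition and the minor -/

section Net

/-- One round of the greedy construction of a net. -/
def netRound : HCmd :=
  .set 1 (.all 6 (.not (.and (.lt (.var 6) (.var 4)) (.and (col 1 6) (entry 7 6 4)))))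

theorem netRound_spec {s : Mem} {v : ℕ} (hv : v < s.var 0) :
    (netRound.run s).arr 1 v 0 ≠ 0 ↔ ∀ u < v, ¬ (s.arr 1 u 0 ≠ 0 ∧ s.arr 7 u v ≠ 0) := by
  rw [netRound, run_set_col hv]
  simp only [all_ne_zero, not_ne_zero, and_ne_zero, lt_ne_zero, eval_var, eval_col, eval_entry,
    setVar_var, setVar_arr]
  simp only [reduceIte, Nat.reduceEqDiff, OfNat.zero_ne_ofNat]
  exact ⟨fun h u hu hc => h u (hu.trans hv) ⟨hu, hc⟩, fun h u _ hc => h u hc.1 hc.2⟩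

/-- Membership of `v` depends only on smaller vertices, so after `r` rounds the first `r` entries
are final, whatever the array held before. After `n` rounds it is a fixed point of the greedy rule.
-/
theorem rep_netRound_spec {s : Mem} {v : ℕ} (hv : v < s.var 0) :
    ((rep netRound).run s).arr 1 v 0 ≠ 0 ↔
      ∀ u < v, ¬ (((rep netRound).run s).arr 1 u 0 ≠ 0 ∧ s.arr 7 u v ≠ 0) := by
  rw [run_rep]
  have h7 : ∀ r, (netRound.run^[r] s).arr 7 = s.arr 7 := by
    intro r
    induction r with
    | zero => rfl
    | succ r ih => rw [Function.iterate_succ_apply', run_arr_of_writes_eq_false _ (by rfl), ih]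
  have step : ∀ r, ∀ v < s.var 0, (netRound.run^[r + 1] s).arr 1 v 0 ≠ 0 ↔
      ∀ u < v, ¬ ((netRound.run^[r] s).arr 1 u 0 ≠ 0 ∧ s.arr 7 u v ≠ 0) := by
    intro r v hv
    rw [Function.iterate_succ_apply', netRound_spec (by rwa [iterate_run_var]), h7]
  have stable : ∀ r, ∀ v < r, v < s.var 0 → ((netRound.run^[r + 1] s).arr 1 v 0 ≠ 0 ↔
      (netRound.run^[r] s).arr 1 v 0 ≠ 0) := by
    intro r
    induction r with
    | zero => intro v hv; omega
    | succ r ih =>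
      intro v hvr hv
      rw [step (r + 1) v hv, step r v hv]
      exact forall₂_congr fun u hu => not_congr (and_congr_left fun _ =>
        ih u (by omega) (by omega))
  rw [← stable (s.var 0) v hv hv, step _ v hv]

variable {n : ℕ} {G : SimpleGraph (Fin n)}

/-- The set of vertices with a nonzero entry in column `0` of array `a`. -/
def colSet (n : ℕ) (s : Mem) (a : ℕ) : Set (Fin n) := {v | s.arr a v 0 ≠ 0}

/-- A vertex left out is within `R` of an earlier net point, and a vertex taken is farther than `R`
from all earlier ones. -/
theorem isNet_of_greedy {R : ℝ} {N : Set (Fin n)}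
    (h : ∀ v, v ∈ N ↔ ∀ u < v, ¬ (u ∈ N ∧ gdist G u v ≤ ENNReal.ofReal R)) : IsNet G R N := by
  have far : ∀ p ∈ N, ∀ q ∈ N, p < q → ENNReal.ofReal R < gdist G p q := fun p hp q hq hpq =>
    not_le.1 fun hle => (h q).1 hq p hpq ⟨hp, hle⟩
  refine ⟨fun p hp q hq hne => ?_, fun v => ?_⟩
  · rcases lt_or_gt_of_ne hne with hlt | hlt
    · exact far p hp q hq hlt
    · rw [gdist_comm]
      exact far q hq p hp hlt
  · by_cases hv : v ∈ N
    · exact ⟨v, hv, by simp [gdist]⟩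
    · rw [h v] at hv
      push Not at hv
      obtain ⟨u, -, hu, hle⟩ := hv
      exact ⟨u, hu, hle⟩

end Net

/-! ### Voronoi clusters by first nearest net points, and the minor they induce. -/

section Partition

variable {n : ℕ} {G : SimpleGraph (Fin n)} {N : Set (Fin n)}

/-- `p` is the nearest point of `N` to `v`, and the first one among those. -/
def IsFirstNearest (G : SimpleGraph (Fin n)) (N : Set (Fin n)) (v p : Fin n) : Prop :=
  p ∈ N ∧ ∀ q ∈ N, G.edist v p < G.edist v q ∨ (G.edist v p = G.edist v q ∧ p ≤ q)

theorem IsFirstNearest.unique {v p q : Fin n} (hp : IsFirstNearest G N v p)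
    (hq : IsFirstNearest G N v q) : p = q := by
  rcases hp.2 q hq.1 with h | ⟨h, hpq⟩ <;> rcases hq.2 p hp.1 with h' | ⟨h', hqp⟩
  · exact absurd h h'.not_gt
  · exact absurd h h'.le.not_gt.elim
  · exact absurd h' h.le.not_gt.elim
  · exact le_antisymm hpq hqp

theorem exists_isFirstNearest (hN : N.Nonempty) (v : Fin n) : ∃ p, IsFirstNearest G N v p := by
  classical
  obtain ⟨p, hp, hmin⟩ := Finset.exists_min_image (Finset.univ.filter (· ∈ N))
    (fun p => toLex (G.edist v p, p)) (by obtain ⟨x, hx⟩ := hN; exact ⟨x, by simpa using hx⟩)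
  refine ⟨p, by simpa using hp, fun q hq => ?_⟩
  have := hmin q (by simpa using hq)
  rwa [Prod.Lex.toLex_le_toLex] at this

theorem isFirstNearest_self {p : Fin n} (hp : p ∈ N) : IsFirstNearest G N p p := by
  refine ⟨hp, fun q _ => ?_⟩
  by_cases h : p = q
  · subst h; exact Or.inr ⟨rfl, le_rfl⟩
  · left
    rw [SimpleGraph.edist_self]
    exact SimpleGraph.edist_pos_of_ne h

/-- A step towards `p` shortens the distance to `p` by one and to any other point by at most one, so
`p` stays first, ties included. Arbitrary tie-breaking could disconnect clusters. -/
theorem IsFirstNearest.of_adj {w x p : Fin n} {m : ℕ} (hw : IsFirstNearest G N w p)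
    (hwx : G.Adj w x) (hd : G.edist w p = (m + 1 : ℕ)) (hx : G.edist x p = m) :
    IsFirstNearest G N x p := by
  refine ⟨hw.1, fun q hq => ?_⟩
  have htri : G.edist w q ≤ 1 + G.edist x q := by
    rw [← SimpleGraph.edist_eq_one_iff_adj.2 hwx]
    exact SimpleGraph.edist_triangle
  by_cases htop : G.edist x q = ⊤
  · left; rw [hx, htop]; exact ENat.natCast_lt_top m
  obtain ⟨l, hl⟩ := ENat.ne_top_iff_exists.1 htop
  have htop' : G.edist w q ≠ ⊤ := by
    refine ne_top_of_le_ne_top ?_ htri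
    rw [← hl]
    exact_mod_cast ENat.natCast_ne_top (1 + l)
  obtain ⟨l', hl'⟩ := ENat.ne_top_iff_exists.1 htop'
  have := hw.2 q hq
  rw [hd, ← hl'] at this
  rw [hx, ← hl]
  rw [← hl, ← hl'] at htri
  have h1 : l' ≤ 1 + l := by exact_mod_cast htri
  have h2 : m + 1 < l' ∨ (m + 1 = l' ∧ p ≤ q) := by exact_mod_cast this
  have h3 : m < l ∨ (m = l ∧ p ≤ q) := by
    rcases h2 with h2 | ⟨h2, h4⟩
    · left; omega
    · rcases Nat.lt_or_ge m l with h | h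
      · exact Or.inl h
      · exact Or.inr ⟨by omega, h4⟩
  exact_mod_cast h3

theorem isVoronoiPartition_ker {R : ℝ} (hN : IsNet G R N) {lab : Fin n → Fin n}
    (hlab : ∀ v, IsFirstNearest G N v (lab v)) : IsVoronoiPartition G N (Setoid.ker lab) := by
  have hself : ∀ p ∈ N, lab p = p := fun p hp => (hlab p).unique (isFirstNearest_self hp)
  have hcl : ∀ {v w}, w ∈ cluster (Setoid.ker lab) v ↔ lab v = lab w := Iff.rfl
  refine ⟨fun v => ⟨lab v, ⟨(hlab v).1, (hself _ (hlab v).1).symm⟩, ?_⟩, fun v => ?_, fun v => ?_⟩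
  · rintro y ⟨hy, hyv⟩
    rw [hcl, hself y hy] at hyv
    exact hyv.symm
  · refine ⟨lab v, (hlab v).1, (hself _ (hlab v).1).symm, fun z hz => ?_⟩
    refine ENat.toENNReal_le.2 ?_
    rcases (hlab v).2 z hz with h | ⟨h, -⟩
    · exact h.le
    · exact h.le
  · have hp : lab v ∈ cluster (Setoid.ker lab) v := (hself _ (hlab v).1).symm
    -- Induction on the distance to the center: the next vertex of a shortest path has the same
    -- label by `IsFirstNearest.of_adj`.
    have key : ∀ m : ℕ, ∀ w (hw : w ∈ cluster (Setoid.ker lab) v), G.edist w (lab v) = m →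
        (G.induce (cluster (Setoid.ker lab) v)).Reachable ⟨lab v, hp⟩ ⟨w, hw⟩ := by
      intro m
      induction m with
      | zero =>
        intro w hw hd
        have hwv : w = lab v := SimpleGraph.edist_eq_zero_iff.1 (by exact_mod_cast hd)
        have : (⟨w, hw⟩ : cluster (Setoid.ker lab) v) = ⟨lab v, hp⟩ := Subtype.ext hwv
        rw [this]
      | succ m ih =>
        intro w hw hd
        obtain ⟨q, hq⟩ := SimpleGraph.exists_walk_of_edist_eq_coe hd
        cases q with
        | nil => simp at hq
        | @cons _ x _ hwx q =>
          rw [SimpleGraph.Walk.length_cons] at hq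
          have hle : G.edist x (lab v) ≤ m := by
            refine (SimpleGraph.edist_le q).trans ?_
            exact_mod_cast (by omega : q.length ≤ m)
          have hxd : G.edist x (lab v) = m := by
            refine le_antisymm hle ?_
            have htri : G.edist w (lab v) ≤ G.edist w x + G.edist x (lab v) :=
              SimpleGraph.edist_triangle
            rw [hd, SimpleGraph.edist_eq_one_iff_adj.2 hwx] at htri
            obtain ⟨l, hl⟩ := ENat.ne_top_iff_exists.1
              (ne_top_of_le_ne_top (ENat.natCast_ne_top m) hle)
            rw [← hl] at htri ⊢
            have : m + 1 ≤ 1 + l := by exact_mod_cast htri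
            exact_mod_cast (by omega : m ≤ l)
          have hw' := hlab w
          rw [← hcl.1 hw] at hw'
          have hx : x ∈ cluster (Setoid.ker lab) v :=
            (hw'.of_adj hwx hd hxd).unique (hlab x)
          refine (ih x hx hxd).trans (SimpleGraph.Adj.reachable ?_)
          exact hwx.symm
    have hall : ∀ w (hw : w ∈ cluster (Setoid.ker lab) v),
        (G.induce (cluster (Setoid.ker lab) v)).Reachable ⟨lab v, hp⟩ ⟨w, hw⟩ := by
      intro w hw
      have hfin : G.edist w (lab v) ≠ ⊤ := by
        obtain ⟨p, hpN, hpd⟩ := hN.2 w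
        have h1 : G.edist w p ≠ ⊤ := by
          rw [SimpleGraph.edist_comm, ← ENat.toENNReal_ne_top]
          exact ne_top_of_le_ne_top ENNReal.ofReal_ne_top hpd
        rw [hcl.1 hw]
        refine ne_top_of_le_ne_top h1 ?_
        rcases (hlab w).2 p hpN with h | ⟨h, -⟩
        · exact h.le
        · exact h.le
      obtain ⟨m, hm⟩ := ENat.ne_top_iff_exists.1 hfin
      exact key m w hw hm.symm
    rw [SimpleGraph.connected_iff_exists_forall_reachable]
    exact ⟨⟨lab v, hp⟩, fun w => hall w.1 w.2⟩

/-- Label every vertex by its first nearest net point. -/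
def labelCmd : HCmd :=
  .set 2 (.sum 6 (.cond (.and (col 1 6) (.all 7 (.imp (col 1 7)
    (.or (.lt (entry 6 4 6) (entry 6 4 7))
      (.and (.eq (entry 6 4 6) (entry 6 4 7)) (.not (.lt (.var 7) (.var 6))))))))
    (.var 6) (.const 0)))

/-- The first nearest point is unique, so the sum over all candidates has at most one nonzero term,
its index. -/
theorem labelCmd_spec {s : Mem} (hn : s.var 0 = n)
    (h6 : ∀ u v : Fin n, s.arr 6 u v = cutDist G u v) {v p : Fin n}
    (hp : IsFirstNearest G (colSet n s 1) v p) : (labelCmd.run s).arr 2 v 0 = p := by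
  rw [labelCmd, run_set_col (by simp [hn]), eval]
  have key : ∀ i ∈ Finset.range n,
      (HExpr.cond (.and (col 1 6) (.all 7 (.imp (col 1 7)
      (.or (.lt (entry 6 4 6) (entry 6 4 7))
      (.and (.eq (entry 6 4 6) (entry 6 4 7)) (.not (.lt (.var 7) (.var 6))))))))
      (.var 6) (.const 0)).eval (((s.setVar 4 v).setVar 5 0).setVar 6 i) =
      if i = p then (p : ℕ) else 0 := by
    intro i hi
    lift i to Fin n using Finset.mem_range.1 hi
    simp only [eval_cond, and_ne_zero, eval_col, all_ne_zero, imp_ne_zero, or_ne_zero, lt_ne_zero,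
      eq_ne_zero, not_ne_zero, eval_entry, eval_var, eval_const, setVar_var, setVar_arr]
    simp only [reduceIte, Nat.reduceEqDiff, OfNat.zero_ne_ofNat, hn]
    have : (s.arr 1 i 0 ≠ 0 ∧ ∀ q < n, s.arr 1 q 0 ≠ 0 → s.arr 6 v i < s.arr 6 v q ∨
        s.arr 6 v i = s.arr 6 v q ∧ ¬ q < i) ↔ (i : ℕ) = p := by
      have h : (s.arr 1 i 0 ≠ 0 ∧ ∀ q < n, s.arr 1 q 0 ≠ 0 → s.arr 6 v i < s.arr 6 v q ∨
          s.arr 6 v i = s.arr 6 v q ∧ ¬ q < i) ↔ IsFirstNearest G (colSet n s 1) v i := by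
        refine and_congr Iff.rfl ?_
        rw [Fin.forall_iff]
        refine forall₃_congr fun q hq _ => ?_
        have e1 := h6 v i
        have e2 := h6 v ⟨q, hq⟩
        simp only at e2
        rw [e1, e2]
        refine or_congr ?_ (and_congr ?_ ?_)
        · rw [← not_le, ← not_le, cutDist_le_iff]
        · rw [le_antisymm_iff, le_antisymm_iff, cutDist_le_iff, cutDist_le_iff]
        · rw [Fin.le_def, not_lt]
      rw [h]
      exact ⟨fun h => by rw [h.unique hp], fun h => by rwa [Fin.ext h]⟩
    simp only [this]
    split_ifs with h
    · exact h
    · rfl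
  rw [setVar_var, setVar_var, if_neg (by decide), if_neg (by decide), hn,
    Finset.sum_congr rfl key]
  simp

/-- The adjacency matrix of the minor. -/
def minorCmd : HCmd :=
  .set 3 (.and (.not (.eq (.var 4) (.var 5))) (.ex 6 (.ex 7 (.and (.eq (col 2 6) (.var 4))
    (.and (.eq (col 2 7) (.var 5)) (entry 0 6 7))))))

/-- The minor induced by the labels, as a graph on the natural numbers. -/
def labelMinor (G : SimpleGraph (Fin n)) (lab : Fin n → Fin n) : SimpleGraph ℕ where
  Adj u v := u ≠ v ∧ ∃ x y, (lab x : ℕ) = u ∧ (lab y : ℕ) = v ∧ G.Adj x y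
  symm := ⟨fun _ _ ⟨h, x, y, hx, hy, hxy⟩ => ⟨h.symm, y, x, hy, hx, hxy.symm⟩⟩
  loopless := ⟨fun _ h => h.1 rfl⟩

theorem minorCmd_spec {s : Mem} (hn : s.var 0 = n) (hG : IsAdjMatrix G s 0)
    {lab : Fin n → Fin n} (h2 : ∀ v : Fin n, s.arr 2 v 0 = lab v) {u v : ℕ} (hu : u < n)
    (hv : v < n) : (minorCmd.run s).arr 3 u v ≠ 0 ↔ (labelMinor G lab).Adj u v := by
  rw [minorCmd, run_set_arr (by rwa [hn]) (by rwa [hn])]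
  simp only [and_ne_zero, not_ne_zero, eq_ne_zero, ex_ne_zero, eval_var, eval_col, eval_entry,
    setVar_var, setVar_arr]
  simp only [reduceIte, Nat.reduceEqDiff, OfNat.zero_ne_ofNat, hn]
  refine and_congr Iff.rfl ?_
  constructor
  · rintro ⟨x, hx, y, hy, h1, h3, h4⟩
    refine ⟨⟨x, hx⟩, ⟨y, hy⟩, ?_, ?_, (hG ⟨x, hx⟩ ⟨y, hy⟩).1 h4⟩
    · rw [← h2]; exact h1
    · rw [← h2]; exact h3
  · rintro ⟨x, y, h1, h3, h4⟩
    exact ⟨x, x.2, y, y.2, by rw [h2, h1], by rw [h2, h3], (hG x y).2 h4⟩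

theorem inducedMinor_adj_iff_labelMinor {lab : Fin n → Fin n} (hself : ∀ p ∈ N, lab p = p)
    (u v : N) : (inducedMinor G N (Setoid.ker lab)).Adj u v ↔
      (labelMinor G lab).Adj (u : Fin n) (v : Fin n) := by
  have hcl : ∀ {v w}, w ∈ cluster (Setoid.ker lab) v ↔ lab v = lab w := Iff.rfl
  unfold inducedMinor labelMinor
  simp only [hcl, hself u u.2, hself v v.2]
  refine and_congr (by simp [Fin.ext_iff, Subtype.ext_iff]) ?_
  constructor
  · rintro ⟨x, hx, y, hy, hxy⟩
    exact ⟨x, y, by rw [← hx], by rw [← hy], hxy⟩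
  · rintro ⟨x, y, hx, hy, hxy⟩
    exact ⟨x, (Fin.ext hx).symm, y, (Fin.ext hy).symm, hxy⟩

end Partition

end OutlierLine

end

noncomputable section
namespace OutlierLine

open HExpr HCmd

/-! ## The feedback vertex set -/

section FeedbackVertexSet

variable {n : ℕ} {H : SimpleGraph ℕ} {s : Mem}

/-- The numbers below `n` with a nonzero entry in column `0` of array `a`. -/
def colFin (s : Mem) (a : ℕ) : Finset ℕ := (Finset.range (s.var 0)).filter fun v => s.arr a v 0 ≠ 0

/-- The numbers below `n` with a nonzero entry in row `i` of array `a`. -/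
def rowFin (s : Mem) (a i : ℕ) : Finset ℕ :=
  (Finset.range (s.var 0)).filter fun v => s.arr a i v ≠ 0

theorem mem_colFin {a v : ℕ} : v ∈ colFin s a ↔ v < s.var 0 ∧ s.arr a v 0 ≠ 0 := by
  simp [colFin]

theorem mem_rowFin {a i v : ℕ} : v ∈ rowFin s a i ↔ v < s.var 0 ∧ s.arr a i v ≠ 0 := by
  simp [rowFin]

theorem card_colFin_le (s : Mem) (a : ℕ) : (colFin s a).card ≤ s.var 0 :=
  (Finset.card_filter_le _ _).trans (by simp)

theorem card_rowFin_le (s : Mem) (a i : ℕ) : (rowFin s a i).card ≤ s.var 0 :=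
  (Finset.card_filter_le _ _).trans (by simp)

theorem run_set_arr_ne {a b : ℕ} (h : b ≠ a) (e : HExpr) (s : Mem) :
    ((set a e).run s).arr b = s.arr b := by
  funext i j
  simp [run, h]

/-- Array `3` is the adjacency matrix of `H` on the numbers below `n`. -/
def HasMinor (H : SimpleGraph ℕ) (s : Mem) : Prop :=
  ∀ u < s.var 0, ∀ v < s.var 0, s.arr 3 u v ≠ 0 ↔ H.Adj u v

theorem HasMinor.of_eq {s s' : Mem} (h : HasMinor H s) (hv : s'.var 0 = s.var 0)
    (ha : s'.arr 3 = s.arr 3) : HasMinor H s' := by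
  unfold HasMinor
  rw [hv, ha]
  exact h

/-- The degree of the vertex in variable `4` into the set in array `a`. -/
def degExpr (a : ℕ) : HExpr := count 6 (.and (col a 6) (entry 3 4 6))

theorem degExpr_spec (hM : HasMinor H s) (a : ℕ) {i : ℕ} (hi : i < s.var 0) (m : ℕ) :
    (degExpr a).eval ((s.setVar 4 i).setVar 5 m) = degIn H (colFin s a) i := by
  classical
  rw [degExpr, eval_count]
  unfold degIn
  congr 1
  ext v
  simp only [Finset.mem_filter, mem_colFin, Finset.mem_range, and_ne_zero, eval_col, eval_entry,
    setVar_var, setVar_arr]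
  simp only [reduceIte, Nat.reduceEqDiff, OfNat.zero_ne_ofNat]
  rw [and_assoc]
  exact and_congr_right fun hv => and_congr_right fun _ => hM i hi v hv

/-- Remove the vertices of degree at most one from the set in array `a`. -/
def pruneRound (a : ℕ) : HCmd := .set a (.and (col a 4) (.lt (.const 1) (degExpr a)))

theorem colFin_pruneRound (hM : HasMinor H s) (a : ℕ) :
    colFin ((pruneRound a).run s) a = pruneStep H (colFin s a) := by
  ext v
  rw [mem_colFin, pruneStep, Finset.mem_filter, mem_colFin, run_var, and_assoc]
  refine and_congr_right fun hv => ?_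
  rw [pruneRound, run_set_col hv, and_ne_zero, lt_ne_zero, degExpr_spec hM a hv]
  simp [Nat.succ_le_iff]

theorem arr_iterate_of_writes {a : ℕ} {c : HCmd} (h : c.writes a = false) (m : ℕ) (s : Mem) :
    (c.run^[m] s).arr a = s.arr a := by
  induction m with
  | zero => rfl
  | succ m ih => rw [Function.iterate_succ_apply', run_arr_of_writes_eq_false _ h, ih]

theorem colFin_rep_pruneRound (hM : HasMinor H s) {a : ℕ} (ha : a ≠ 3) :
    colFin ((rep (pruneRound a)).run s) a = prune H (s.var 0) (colFin s a) := by
  rw [run_rep]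
  have hw : (pruneRound a).writes 3 = false := by simpa [pruneRound, writes] using ha.symm
  generalize s.var 0 = m
  induction m with
  | zero => rfl
  | succ m ih =>
    rw [Function.iterate_succ_apply', colFin_pruneRound, ih, prune_succ]
    exact hM.of_eq (by rw [iterate_run_var]) (arr_iterate_of_writes hw m s)

/-- The weight of the vertex in variable `x` times the degree minus one of the vertex in
variable `y`. -/
def weightExpr (x y : ℕ) : HExpr := mulSmall 7 (.sub (col 13 y) (.const 1)) (col 9 x)

theorem weightExpr_spec {s : Mem} {x y : ℕ} (hx : x ≠ 7) (hy : y ≠ 7)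
    (hd : s.arr 13 (s.var y) 0 ≤ s.var 0) :
    (weightExpr x y).eval s = s.arr 9 (s.var x) 0 * (s.arr 13 (s.var y) 0 - 1) := by
  rw [weightExpr, eval_mulSmall (a := s.arr 13 (s.var y) 0 - 1) (b := s.arr 9 (s.var x) 0)
    (by simp [hy]) (by simp [hx]) (by omega), mul_comm]

/-- The selection of a vertex that minimizes weight over degree minus one, in array `15`. -/
def pickCmd : HCmd :=
  .seq (.set 13 (degExpr 8))
    (.seq (.set 14 (.and (col 8 4) (.all 6 (.imp (col 8 6)
      (.not (.lt (weightExpr 6 4) (weightExpr 4 6)))))))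
      (.set 15 (.and (col 14 4) (.all 6 (.not (.and (.lt (.var 6) (.var 4)) (col 14 6)))))))

theorem pickCmd_deg (hM : HasMinor H s) {i : ℕ} (hi : i < s.var 0) :
    (pickCmd.run s).arr 13 i 0 = degIn H (colFin s 8) i := by
  rw [pickCmd, run_seq, run_seq, run_set_arr_ne (by decide), run_set_arr_ne (by decide),
    run_set_col hi, degExpr_spec hM 8 hi]

theorem degIn_le_card {V : Type*} (H : SimpleGraph V) (U : Finset V) (v : V) :
    degIn H U v ≤ U.card := by
  classical
  exact Finset.card_filter_le _ _

/-- The minimum of `w / d`, cross-multiplied so that the program can compare natural numbers. -/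
theorem exists_min_ratio {U : Finset ℕ} (hU : U.Nonempty) (w d : ℕ → ℕ)
    (hd : ∀ u ∈ U, 0 < d u) : ∃ v ∈ U, ∀ u ∈ U, w v * d u ≤ w u * d v := by
  obtain ⟨v, hv, hmin⟩ := Finset.exists_min_image U (fun v => (w v : ℚ) / d v) hU
  refine ⟨v, hv, fun u hu => ?_⟩
  have h1 : (0 : ℚ) < d v := by exact_mod_cast hd v hv
  have h2 : (0 : ℚ) < d u := by exact_mod_cast hd u hu
  have := hmin u hu
  rw [div_le_div_iff₀ h1 h2] at this
  exact_mod_cast this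

/-- Array `14` marks all minimizers of the ratio, and array `15` keeps only the first, so that
exactly one vertex is removed. -/
theorem pickCmd_spec (hM : HasMinor H s) (hdeg : ∀ v ∈ colFin s 8, 2 ≤ degIn H (colFin s 8) v)
    (hne : (colFin s 8).Nonempty) :
    ∃ v ∈ colFin s 8, colFin (pickCmd.run s) 15 = {v} ∧
      ∀ u ∈ colFin s 8, s.arr 9 v 0 * (degIn H (colFin s 8) u - 1) ≤
        s.arr 9 u 0 * (degIn H (colFin s 8) v - 1) := by
  classical
  set U := colFin s 8 with hU
  set s₁ := (set 13 (degExpr 8)).run s with hs₁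
  have h13 : ∀ i < s.var 0, s₁.arr 13 i 0 = degIn H U i := fun i hi => by
    rw [hs₁, run_set_col hi, degExpr_spec hM 8 hi]
  have h13' : ∀ i < s.var 0, s₁.arr 13 i 0 ≤ s.var 0 := fun i hi => by
    rw [h13 i hi]
    exact (degIn_le_card _ _ _).trans (card_colFin_le _ _)
  have h8 : s₁.arr 8 = s.arr 8 := run_set_arr_ne (by decide) _ _
  have h9 : s₁.arr 9 = s.arr 9 := run_set_arr_ne (by decide) _ _
  have hv₁ : s₁.var 0 = s.var 0 := by rw [hs₁, run_var]
  let M : ℕ → Prop := fun i => i ∈ U ∧ ∀ u ∈ U,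
    s.arr 9 i 0 * (degIn H U u - 1) ≤ s.arr 9 u 0 * (degIn H U i - 1)
  set s₂ := (set 14 (.and (col 8 4) (.all 6 (.imp (col 8 6)
      (.not (.lt (weightExpr 6 4) (weightExpr 4 6))))))).run s₁ with hs₂
  have hv₂ : s₂.var 0 = s.var 0 := by rw [hs₂, run_var, hv₁]
  have h14 : ∀ i < s.var 0, (s₂.arr 14 i 0 ≠ 0 ↔ M i) := by
    intro i hi
    rw [hs₂, run_set_col (by rwa [hv₁])]
    simp only [and_ne_zero, all_ne_zero, imp_ne_zero, not_ne_zero, lt_ne_zero, eval_col,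
      setVar_var, setVar_arr]
    simp only [reduceIte, Nat.reduceEqDiff, OfNat.zero_ne_ofNat, hv₁, h8]
    simp only [M, hU, mem_colFin, and_imp, hi, true_and]
    refine and_congr_right fun _ => forall₃_congr fun u hu _ => ?_
    rw [weightExpr_spec (by decide) (by decide) (by simpa [hv₁] using h13' i hi),
      weightExpr_spec (by decide) (by decide) (by simpa [hv₁] using h13' u hu)]
    simp [h9, h13 i hi, h13 u hu, hU]
  have hexM : ∃ i, M i := by
    obtain ⟨v, hv, h⟩ := exists_min_ratio hne (fun v => s.arr 9 v 0) (fun v => degIn H U v - 1)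
      (fun u hu => by have := hdeg u hu; omega)
    exact ⟨v, hv, h⟩
  refine ⟨Nat.find hexM, (Nat.find_spec hexM).1, ?_, (Nat.find_spec hexM).2⟩
  have hlt : ∀ i, M i → i < s.var 0 := fun i hi => (mem_colFin.1 hi.1).1
  ext i
  rw [mem_colFin, run_var, Finset.mem_singleton]
  have h15 : i < s.var 0 → ((pickCmd.run s).arr 15 i 0 ≠ 0 ↔ M i ∧ ∀ u < i, ¬ M u) := by
    intro hi
    rw [pickCmd, run_seq, run_seq, ← hs₁, ← hs₂, run_set_col (by rwa [hv₂])]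
    simp only [and_ne_zero, all_ne_zero, not_ne_zero, lt_ne_zero, eval_col, eval_var,
      setVar_var, setVar_arr]
    simp only [reduceIte, Nat.reduceEqDiff, OfNat.zero_ne_ofNat, hv₂]
    refine and_congr (h14 i hi) ?_
    constructor
    · intro h u hu hMu
      exact h u (hu.trans hi) ⟨hu, (h14 u (hu.trans hi)).2 hMu⟩
    · rintro h u hu ⟨hui, hu'⟩
      exact h u hui ((h14 u hu).1 hu')
  constructor
  · rintro ⟨hi, h⟩
    obtain ⟨h1, h2⟩ := (h15 hi).1 h
    exact ((Nat.find_eq_iff hexM).2 ⟨h1, h2⟩).symm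
  · rintro rfl
    have hi := hlt _ (Nat.find_spec hexM)
    exact ⟨hi, (h15 hi).2 ⟨Nat.find_spec hexM, fun u hu => Nat.find_min hexM hu⟩⟩

/-- Record the pruned set and the picked vertex in the row of the clock, update the weights, and
remove the picked vertex. -/
def updateCmd : HCmd :=
  .seq (.set 11 (.cond (.eq (.var 4) (entry 10 4 5)) (col 8 5) (entry 11 4 5)))
    (.seq (.set 12 (.cond (.eq (.var 4) (entry 10 4 5)) (col 15 5) (entry 12 4 5)))
      (.seq (.set 9 (.sum 6 (.cond (col 15 6) (.sub (weightExpr 4 6) (weightExpr 6 4))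
        (.const 0))))
        (.seq (.set 8 (.and (col 8 4) (.not (col 15 4))))
          (.set 10 (.add (entry 10 4 5) (.const 1))))))

/-- All relevant entries of array `10` are `t`. -/
def ClockAt (s : Mem) (t : ℕ) : Prop := ∀ i < s.var 0, ∀ j < s.var 0, s.arr 10 i j = t

/-- Commands change arrays only, so the round counter is an array with constant entries, which every
entry of another array can read. -/
theorem updateCmd_clock {t : ℕ} (ht : ClockAt s t) : ClockAt (updateCmd.run s) (t + 1) := by
  intro i hi j hj
  rw [run_var] at hi hj
  simp only [updateCmd, run_seq]
  rw [run_set_arr (by simpa using hi) (by simpa using hj)]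
  simp [run_set_arr_ne, ht i hi j hj]

theorem updateCmd_alive : colFin (updateCmd.run s) 8 = colFin s 8 \ colFin s 15 := by
  ext v
  simp only [Finset.mem_sdiff, mem_colFin, run_var, not_and]
  by_cases hv : v < s.var 0
  · simp only [hv, true_and, true_imp_iff]
    simp only [updateCmd, run_seq]
    rw [run_set_arr_ne (by decide), run_set_col (by simpa using hv)]
    simp only [and_ne_zero, not_ne_zero, eval_col, setVar_var, setVar_arr]
    simp [run_set_arr_ne]
  · simp [hv]

theorem updateCmd_history {t : ℕ} (ht : ClockAt s t) {i : ℕ} (hi : i < s.var 0) :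
    rowFin (updateCmd.run s) 11 i = (if i = t then colFin s 8 else rowFin s 11 i) ∧
    rowFin (updateCmd.run s) 12 i = if i = t then colFin s 15 else rowFin s 12 i := by
  constructor
  all_goals
    ext v
    rw [mem_rowFin, run_var]
    by_cases hv : v < s.var 0
    · simp only [updateCmd, run_seq]
      simp only [run_set_arr_ne, ne_eq, Nat.reduceEqDiff, not_false_eq_true]
      rw [run_set_arr (by simpa using hi) (by simpa using hv)]
      simp only [eval_cond, eq_ne_zero, eval_entry, eval_col, eval_var, setVar_var, setVar_arr]
      simp only [reduceIte, Nat.reduceEqDiff, run_set_arr_ne, ne_eq, not_false_eq_true,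
        ht i hi v hv]
      split_ifs
      · simp [mem_colFin]
      · simp [mem_rowFin]
    · split_ifs
      · simp [mem_colFin, hv]
      · simp [mem_rowFin, hv]

/-- The sum over the singleton in array `15` serves to read off the picked vertex. The subtraction
is truncated, which is harmless only where `v` has minimum ratio. -/
theorem updateCmd_weight (hd : ∀ i < s.var 0, s.arr 13 i 0 ≤ s.var 0) {v : ℕ}
    (hv : colFin s 15 = {v}) {i : ℕ} (hi : i < s.var 0) :
    (updateCmd.run s).arr 9 i 0 =
      s.arr 9 i 0 * (s.arr 13 v 0 - 1) - s.arr 9 v 0 * (s.arr 13 i 0 - 1) := by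
  simp only [updateCmd, run_seq]
  simp only [run_set_arr_ne, ne_eq, Nat.reduceEqDiff, not_false_eq_true]
  rw [run_set_col (by simpa using hi), eval]
  have hv' : ∀ u < s.var 0, (s.arr 15 u 0 ≠ 0 ↔ u = v) := fun u hu => by
    rw [← Finset.mem_singleton, ← hv, mem_colFin]
    simp [hu]
  rw [Finset.sum_congr rfl (g := fun u => if u = v then
    s.arr 9 i 0 * (s.arr 13 v 0 - 1) - s.arr 9 v 0 * (s.arr 13 i 0 - 1) else 0)]
  · have hvn : v < s.var 0 := by
      have : v ∈ colFin s 15 := by simp [hv]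
      exact (mem_colFin.1 this).1
    simp [hvn]
  · intro u hu
    have hu : u < s.var 0 := by simpa using hu
    simp only [eval_cond, eval_col, setVar_var, setVar_arr, eval_sub, eval_const]
    simp only [reduceIte, run_set_arr_ne, ne_eq, Nat.reduceEqDiff, not_false_eq_true]
    by_cases huv : u = v
    · rw [if_pos ((hv' u hu).2 huv), if_pos huv,
        weightExpr_spec (by decide) (by decide) (by simpa [run_set_arr_ne] using hd u hu),
        weightExpr_spec (by decide) (by decide) (by simpa [run_set_arr_ne] using hd i hi)]
      simp [run_set_arr_ne, huv]
    · rw [if_neg (fun h => huv ((hv' u hu).1 h)), if_neg huv]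

/-- One forward round of the local ratio algorithm. -/
def lrRound : HCmd := .seq (.rep (pruneRound 8)) (.seq pickCmd updateCmd)

/-- The last clause says that earlier rows of the history are kept; the backward phase relies on
them. -/
theorem lrRound_spec (hM : HasMinor H s) {t : ℕ} (ht : ClockAt s t) :
    ∃ U P : Finset ℕ, U = prune H (s.var 0) (colFin s 8) ∧
      (U.Nonempty → ∃ v ∈ U, P = {v} ∧
        (∀ u ∈ U, s.arr 9 v 0 * (degIn H U u - 1) ≤ s.arr 9 u 0 * (degIn H U v - 1)) ∧
        ∀ u ∈ U, (lrRound.run s).arr 9 u 0 =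
          s.arr 9 u 0 * (degIn H U v - 1) - s.arr 9 v 0 * (degIn H U u - 1)) ∧
      colFin (lrRound.run s) 8 = U \ P ∧ ClockAt (lrRound.run s) (t + 1) ∧
      ∀ i < s.var 0, rowFin (lrRound.run s) 11 i = (if i = t then U else rowFin s 11 i) ∧
        rowFin (lrRound.run s) 12 i = if i = t then P else rowFin s 12 i := by
  set s₁ := (rep (pruneRound 8)).run s with hs₁
  have hv₁ : s₁.var 0 = s.var 0 := by rw [hs₁, run_var]
  have f₁ : ∀ a, a ≠ 8 → s₁.arr a = s.arr a := fun a ha =>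
    run_arr_of_writes_eq_false _ (by simpa [writes, pruneRound] using ha) s
  have hM₁ : HasMinor H s₁ := hM.of_eq hv₁ (f₁ 3 (by decide))
  have hU : colFin s₁ 8 = prune H (s.var 0) (colFin s 8) :=
    colFin_rep_pruneRound hM (by decide)
  set s₂ := pickCmd.run s₁ with hs₂
  have hv₂ : s₂.var 0 = s.var 0 := by rw [hs₂, run_var, hv₁]
  have f₂ : ∀ a, a ≠ 13 → a ≠ 14 → a ≠ 15 → s₂.arr a = s₁.arr a := fun a h h' h'' =>
    run_arr_of_writes_eq_false _ (by simp [writes, pickCmd, h, h', h'']) s₁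
  have h8 : colFin s₂ 8 = colFin s₁ 8 := by
    simp only [colFin, hv₂, hv₁, f₂ 8 (by decide) (by decide) (by decide)]
  have h13 : ∀ i < s.var 0, s₂.arr 13 i 0 = degIn H (colFin s₁ 8) i := fun i hi =>
    pickCmd_deg hM₁ (by rwa [hv₁])
  have ht₂ : ClockAt s₂ t := by
    intro i hi j hj
    rw [hv₂] at hi hj
    rw [f₂ 10 (by decide) (by decide) (by decide), f₁ 10 (by decide)]
    exact ht i hi j hj
  have hrun : lrRound.run s = updateCmd.run s₂ := rfl
  have h9 : s₂.arr 9 = s.arr 9 := by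
    rw [f₂ 9 (by decide) (by decide) (by decide), f₁ 9 (by decide)]
  refine ⟨colFin s₁ 8, colFin s₂ 15, hU, fun hne => ?_, ?_, ?_, fun i hi => ?_⟩
  · have hdeg : ∀ v ∈ colFin s₁ 8, 2 ≤ degIn H (colFin s₁ 8) v := by
      rw [hU]
      exact two_le_degIn_prune (card_colFin_le _ _)
    obtain ⟨v, hv, hP, hmin⟩ := pickCmd_spec hM₁ hdeg hne
    refine ⟨v, hv, hP, ?_, fun u hu => ?_⟩
    · simpa only [f₁ 9 (by decide)] using hmin
    · have hun : u < s.var 0 := hv₁ ▸ (mem_colFin.1 hu).1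
      have hvn : v < s.var 0 := hv₁ ▸ (mem_colFin.1 hv).1
      rw [hrun, updateCmd_weight (fun i hi => ?_) hP (by rwa [hv₂]), h9, h13 u hun, h13 v hvn]
      rw [hv₂] at hi ⊢
      rw [h13 i hi, ← hv₁]
      exact (degIn_le_card _ _ _).trans (card_colFin_le _ _)
  · rw [hrun, updateCmd_alive, h8]
  · exact updateCmd_clock ht₂
  · rw [hrun]
    have := updateCmd_history ht₂ (i := i) (by rwa [hv₂])
    rw [this.1, this.2, h8]
    simp only [rowFin, hv₂, f₂ 11 (by decide) (by decide) (by decide),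
      f₂ 12 (by decide) (by decide) (by decide), f₁ 11 (by decide), f₁ 12 (by decide)]
    exact ⟨trivial, trivial⟩

/-- One backward round: put the vertex picked in the round of the clock into the solution in array
`4`, if what is left of the pruned set of that round contains a cycle. -/
def backRound : HCmd :=
  .seq (.set 10 (.sub (entry 10 4 5) (.const 1)))
    (.seq (.set 16 (.and (.arr 11 (col 10 4) (.var 4)) (.not (col 4 4))))
      (.seq (.rep (pruneRound 16))
        (.set 4 (.or (col 4 4) (.and (.ex 6 (col 16 6)) (.arr 12 (col 10 4) (.var 4)))))))

-- The clock is decremented first, so the round reads row `t`, not `t + 1`. Pruning array `16`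
-- decides whether the remaining graph has a cycle.
open Classical in
theorem backRound_spec (hM : HasMinor H s) {t : ℕ} (ht : ClockAt s (t + 1)) :
    ClockAt (backRound.run s) t ∧ colFin (backRound.run s) 4 =
      if ThickFree H (rowFin s 11 t \ colFin s 4) then colFin s 4
      else colFin s 4 ∪ rowFin s 12 t := by
  set s₁ := (set 10 (.sub (entry 10 4 5) (.const 1))).run s with hs₁
  have hv₁ : s₁.var 0 = s.var 0 := by rw [hs₁, run_var]
  have f₁ : ∀ a, a ≠ 10 → s₁.arr a = s.arr a := fun a ha => run_set_arr_ne ha _ _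
  have h10 : ∀ i < s.var 0, ∀ j < s.var 0, s₁.arr 10 i j = t := by
    intro i hi j hj
    rw [hs₁, run_set_arr hi hj]
    simp [ht i hi j hj]
  set s₂ := (set 16 (.and (.arr 11 (col 10 4) (.var 4)) (.not (col 4 4)))).run s₁ with hs₂
  have hv₂ : s₂.var 0 = s.var 0 := by rw [hs₂, run_var, hv₁]
  have f₂ : ∀ a, a ≠ 16 → s₂.arr a = s₁.arr a := fun a ha => run_set_arr_ne ha _ _
  have h16 : colFin s₂ 16 = rowFin s 11 t \ colFin s 4 := by
    ext v
    rw [mem_colFin, Finset.mem_sdiff, mem_rowFin, mem_colFin, hv₂]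
    by_cases hv : v < s.var 0
    · rw [hs₂, run_set_col (by rwa [hv₁])]
      simp only [and_ne_zero, not_ne_zero, eval_arr, eval_col, eval_var, setVar_var, setVar_arr]
      simp only [reduceIte, Nat.reduceEqDiff, f₁ 11 (by decide), f₁ 4 (by decide),
        h10 v hv 0 (by omega), hv, true_and]
    · simp [hv]
  set s₃ := (rep (pruneRound 16)).run s₂ with hs₃
  have hv₃ : s₃.var 0 = s.var 0 := by rw [hs₃, run_var, hv₂]
  have f₃ : ∀ a, a ≠ 16 → s₃.arr a = s₂.arr a := fun a ha =>
    run_arr_of_writes_eq_false _ (by simpa [writes, pruneRound] using ha) s₂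
  have hM₂ : HasMinor H s₂ := hM.of_eq hv₂ (by rw [f₂ 3 (by decide), f₁ 3 (by decide)])
  have hcore : colFin s₃ 16 = prune H (s.var 0) (rowFin s 11 t \ colFin s 4) := by
    rw [hs₃, colFin_rep_pruneRound hM₂ (by decide), h16, hv₂]
  have hrun : backRound.run s = (set 4 (.or (col 4 4) (.and (.ex 6 (col 16 6))
    (.arr 12 (col 10 4) (.var 4))))).run s₃ := rfl
  have h10' : s₃.arr 10 = s₁.arr 10 := by rw [f₃ 10 (by decide), f₂ 10 (by decide)]
  refine ⟨fun i hi j hj => ?_, ?_⟩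
  · rw [run_var] at hi hj
    rw [hrun, run_set_arr_ne (by decide), h10', h10 i hi j hj]
  · have hcard : (rowFin s 11 t \ colFin s 4).card ≤ s.var 0 :=
      (Finset.card_le_card Finset.sdiff_subset).trans (card_rowFin_le _ _ _)
    rw [thickFree_iff_prune_eq_empty hcard, ← hcore]
    have hex : (∃ u < s.var 0, s₃.arr 16 u 0 ≠ 0) ↔ colFin s₃ 16 ≠ ∅ := by
      rw [← Finset.nonempty_iff_ne_empty]
      simp only [Finset.Nonempty, mem_colFin, hv₃]
    ext v
    rw [mem_colFin, run_var]
    by_cases hv : v < s.var 0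
    · rw [hrun, run_set_col (by rwa [hv₃])]
      simp only [or_ne_zero, and_ne_zero, ex_ne_zero, eval_arr, eval_col, eval_var, setVar_var,
        setVar_arr]
      simp only [reduceIte, Nat.reduceEqDiff, OfNat.zero_ne_ofNat, h10', h10 v hv 0 (by omega),
        hv₃, hv, true_and, hex, f₃ 4 (by decide), f₂ 4 (by decide), f₁ 4 (by decide),
        f₃ 12 (by decide), f₂ 12 (by decide), f₁ 12 (by decide)]
      by_cases hc : colFin s₃ 16 = ∅
      · simp [hc, mem_colFin, hv]
      · simp [hc, mem_colFin, mem_rowFin, hv]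
    · split_ifs <;> simp [mem_colFin, mem_rowFin, hv]

/-- Initialize the sets, the weights and the clock. -/
def lrInit : HCmd :=
  .seq (.set 8 (col 1 4)) (.seq (.set 9 (.const 1)) (.set 10 (.const 0)))

/-- The local ratio algorithm for the minor in array `3` on the vertices in array `1`. -/
def lrCmd : HCmd :=
  .seq lrInit (.seq (.rep lrRound) (.seq (.set 4 (.const 0)) (.rep backRound)))

theorem exists_localRatioRun (hM : HasMinor H s) :
    ∃ (A U P X : ℕ → Finset ℕ) (w : ℕ → ℕ → ℕ), LocalRatioRun H (s.var 0) A U P X w ∧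
      A 0 = colFin s 1 ∧ X 0 = colFin (lrCmd.run s) 4 := by
  set n := s.var 0 with hn
  set s₀ := lrInit.run s with hs₀
  have hv₀ : s₀.var 0 = n := by rw [hs₀, run_var]
  let S : ℕ → Mem := fun r => lrRound.run^[r] s₀
  have hS : ∀ r, S (r + 1) = lrRound.run (S r) := fun r => Function.iterate_succ_apply' _ _ _
  have hSv : ∀ r, (S r).var 0 = n := fun r => by simp only [S, iterate_run_var, hv₀]
  have hSM : ∀ r, HasMinor H (S r) := fun r => hM.of_eq (hSv r) (by
    rw [arr_iterate_of_writes (by rfl), hs₀, run_arr_of_writes_eq_false _ (by rfl)])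
  have hSt : ∀ r, ClockAt (S r) r := by
    intro r
    induction r with
    | zero =>
      intro i hi j hj
      rw [hSv] at hi hj
      change (lrInit.run s).arr 10 i j = 0
      rw [lrInit, run_seq, run_seq, run_set_arr (by simpa using hi) (by simpa using hj)]
      rfl
    | succ r ih =>
      rw [hS]
      obtain ⟨_, _, _, _, _, h, _⟩ := lrRound_spec (hSM r) ih
      exact h
  choose U P hU hP hA hrest using fun r => lrRound_spec (hSM r) (hSt r)
  -- Row `r` is written in round `r` and never again.
  have hrow : ∀ m ≤ n, ∀ r < m, rowFin (S m) 11 r = U r ∧ rowFin (S m) 12 r = P r := by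
    intro m
    induction m with
    | zero => intro _ r hr; omega
    | succ m ih =>
      intro hm r hr
      have h := (hrest m).2 r (by rw [hSv]; omega)
      rw [hS, h.1, h.2]
      by_cases hrm : r = m
      · subst hrm; simp
      · rw [if_neg hrm, if_neg hrm]
        exact ih (by omega) r (by omega)
  set s₁ := (set 4 (const 0)).run (S n) with hs₁
  have hv₁ : s₁.var 0 = n := by rw [hs₁, run_var, hSv]
  have f₁ : ∀ a, a ≠ 4 → s₁.arr a = (S n).arr a := fun a ha => run_set_arr_ne ha _ _
  let B : ℕ → Mem := fun r => backRound.run^[r] s₁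
  have hB : ∀ r, B (r + 1) = backRound.run (B r) := fun r => Function.iterate_succ_apply' _ _ _
  have hBv : ∀ r, (B r).var 0 = n := fun r => by simp only [B, iterate_run_var, hv₁]
  have hBM : ∀ r, HasMinor H (B r) := fun r => (hSM n).of_eq ((hBv r).trans (hSv n).symm) (by
    rw [arr_iterate_of_writes (by rfl), f₁ 3 (by decide)])
  have hBt : ∀ r ≤ n, ClockAt (B r) (n - r) := by
    intro r
    induction r with
    | zero =>
      intro _ i hi j hj
      rw [hBv] at hi hj
      change s₁.arr 10 i j = n
      rw [f₁ 10 (by decide)]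
      exact hSt n i (by rwa [hSv]) j (by rwa [hSv])
    | succ r ih =>
      intro hr
      rw [hB]
      refine (backRound_spec (hBM r) (t := n - (r + 1)) ?_).1
      rw [show n - (r + 1) + 1 = n - r by omega]
      exact ih (by omega)
  have hBrow : ∀ m, ∀ r < n, rowFin (B m) 11 r = U r ∧ rowFin (B m) 12 r = P r := by
    intro m r hr
    have h := hrow n le_rfl r hr
    rw [← h.1, ← h.2]
    simp only [rowFin, hBv, hSv, B, arr_iterate_of_writes (show writes 11 backRound = false from rfl),
      arr_iterate_of_writes (show writes 12 backRound = false from rfl), f₁ 11 (by decide),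
      f₁ 12 (by decide)]
    exact ⟨trivial, trivial⟩
  have hX : ∀ r < n, ClockAt (B (n - (r + 1))) (r + 1) := fun r hr => by
    have := hBt (n - (r + 1)) (by omega)
    rwa [show n - (n - (r + 1)) = r + 1 by omega] at this
  have hXs : ∀ r < n, B (n - r) = backRound.run (B (n - (r + 1))) := fun r hr => by
    rw [← hB, show n - (r + 1) + 1 = n - r by omega]
  have h0 : colFin (S 0) 8 = colFin s 1 := by
    ext v
    rw [mem_colFin, mem_colFin, hSv]
    refine and_congr_right fun hv => ?_
    change (lrInit.run s).arr 8 v 0 ≠ 0 ↔ _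
    rw [lrInit, run_seq, run_seq, run_set_arr_ne (by decide), run_set_arr_ne (by decide),
      run_set_col hv]
    simp
  -- The solution after going back to round `r` is found after `n - r` backward rounds.
  refine ⟨fun r => colFin (S r) 8, U, P, fun r => colFin (B (n - r)) 4,
    fun r v => (S r).arr 9 v 0, ⟨?_, ?_, ?_, ?_, ?_, ?_, ?_, ?_⟩, h0, ?_⟩
  · exact (card_colFin_le _ _).trans (hSv 0).le
  · intro v hv
    have hv : v < n := hSv 0 ▸ (mem_colFin.1 hv).1
    change (lrInit.run s).arr 9 v 0 = 1
    rw [lrInit, run_seq, run_seq, run_set_arr_ne (by decide), run_set_col (by simpa using hv)]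
    rfl
  · intro r _
    rw [hU r, hSv]
  · intro r _ hne
    simpa only [hS] using hP r hne
  · intro r _
    simp only [hS]
    exact hA r
  · have : colFin (B 0) 4 = ∅ := by
      ext v
      simp only [mem_colFin, hBv, Finset.notMem_empty, iff_false, not_and, not_not]
      intro hv
      change ((set 4 (const 0)).run (S n)).arr 4 v 0 = 0
      rw [run_set_col (by rwa [hSv])]
      rfl
    simpa using this
  · intro r hr hfree
    rw [hXs r hr, (backRound_spec (hBM _) (hX r hr)).2, (hBrow _ r hr).1, if_pos hfree]
  · intro r hr hfree
    rw [hXs r hr, (backRound_spec (hBM _) (hX r hr)).2, (hBrow _ r hr).1, (hBrow _ r hr).2,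
      if_neg hfree]
  · simp only [Nat.sub_zero]
    congr 1
    rw [lrCmd, run_seq, run_seq, run_seq, run_rep, run_rep, ← hs₀, hv₀]
    change B n = backRound.run^[((set 4 (const 0)).run (S n)).var 0] s₁
    rw [run_var, hSv]

end FeedbackVertexSet

end OutlierLine

end

noncomputable section
namespace OutlierLine

open HExpr HCmd

/-! ## The whole algorithm -/

section Algorithm

variable {n : ℕ} {G : SimpleGraph (Fin n)}

/-- The algorithm, up to the final test. -/
def embeddingCmd : HCmd :=
  .seq distCmd (.seq nearCmd (.seq (.rep netRound) (.seq labelCmd (.seq minorCmd lrCmd))))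

/-- The final test: the feedback vertex set has at most `2 k` elements. -/
def flagExpr : HExpr := .not (.lt (.add (.var 1) (.var 1)) (.count 6 (col 4 6)))

theorem flagExpr_eval (s : Mem) :
    flagExpr.eval s = if (colFin s 4).card ≤ 2 * s.var 1 then 1 else 0 := by
  rw [flagExpr, HExpr.not, eval_cond]
  simp only [lt_ne_zero, eval_add, eval_var, eval_count, eval_const]
  have : ((Finset.range (s.var 0)).filter fun i => (col 4 6).eval (s.setVar 6 i) ≠ 0) =
      colFin s 4 := by
    simp [colFin]
  rw [this]
  split_ifs <;> omega

theorem embeddingCmd_spec {s : Mem} {c : ℚ} (hc : 1 ≤ c) (hn : s.var 0 = n)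
    (h2 : s.var 2 = c.num.toNat) (h3 : s.var 3 = c.den) (hG : IsAdjMatrix G s 0) :
    IsNet G (c : ℝ) (colSet n (embeddingCmd.run s) 1) ∧ ∃ lab : Fin n → Fin n,
      (∀ v, IsFirstNearest G (colSet n (embeddingCmd.run s) 1) v (lab v)) ∧
      (∀ v : Fin n, (embeddingCmd.run s).arr 2 v 0 = lab v) ∧
      (∀ u v : Fin n, (embeddingCmd.run s).arr 3 u v ≠ 0 ↔ (labelMinor G lab).Adj u v) ∧
      ∃ (A U P X : ℕ → Finset ℕ) (w : ℕ → ℕ → ℕ), LocalRatioRun (labelMinor G lab) n A U P X w ∧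
        A 0 = colFin (embeddingCmd.run s) 1 ∧ X 0 = colFin (embeddingCmd.run s) 4 := by
  set s₁ := distCmd.run s with hs₁
  set s₂ := nearCmd.run s₁ with hs₂
  set s₃ := (rep netRound).run s₂ with hs₃
  set s₄ := labelCmd.run s₃ with hs₄
  set s₅ := minorCmd.run s₄ with hs₅
  have hv₁ : s₁.var = s.var := run_var _ _
  have hv₂ : s₂.var = s.var := (run_var _ _).trans hv₁
  have hv₃ : s₃.var = s.var := (run_var _ _).trans hv₂
  have hv₄ : s₄.var = s.var := (run_var _ _).trans hv₃
  have hv₅ : s₅.var = s.var := (run_var _ _).trans hv₄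
  have hrun : embeddingCmd.run s = lrCmd.run s₅ := rfl
  have h1F : (embeddingCmd.run s).arr 1 = s₃.arr 1 := by
    rw [hrun, run_arr_of_writes_eq_false _ (by rfl), hs₅, run_arr_of_writes_eq_false _ (by rfl),
      hs₄, run_arr_of_writes_eq_false _ (by rfl)]
  have h2F : (embeddingCmd.run s).arr 2 = s₄.arr 2 := by
    rw [hrun, run_arr_of_writes_eq_false _ (by rfl), hs₅, run_arr_of_writes_eq_false _ (by rfl)]
  have h3F : (embeddingCmd.run s).arr 3 = s₅.arr 3 := by
    rw [hrun, run_arr_of_writes_eq_false _ (by rfl)]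
  have h6 : ∀ u v : Fin n, s₁.arr 6 u v = cutDist G u v := distCmd_spec hn hG
  have h7 : ∀ u v : Fin n, s₂.arr 7 u v ≠ 0 ↔ gdist G u v ≤ ENNReal.ofReal (c : ℝ) :=
    nearCmd_spec hc (by rw [hv₁, hn]) (by rw [hv₁, h2]) (by rw [hv₁, h3]) h6
  have h6' : ∀ u v : Fin n, s₃.arr 6 u v = cutDist G u v := by
    rw [hs₃, run_arr_of_writes_eq_false _ (by rfl), hs₂, run_arr_of_writes_eq_false _ (by rfl)]
    exact h6
  have hcol : colSet n (embeddingCmd.run s) 1 = colSet n s₃ 1 := by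
    simp only [colSet, h1F]
  have hG' : IsAdjMatrix G s₄ 0 := by
    unfold IsAdjMatrix
    rw [hs₄, run_arr_of_writes_eq_false _ (by rfl), hs₃, run_arr_of_writes_eq_false _ (by rfl),
      hs₂, run_arr_of_writes_eq_false _ (by rfl), hs₁, run_arr_of_writes_eq_false _ (by rfl)]
    exact hG
  have hnet : IsNet G (c : ℝ) (colSet n s₃ 1) := by
    refine isNet_of_greedy fun v => ?_
    have := rep_netRound_spec (s := s₂) (v := v) (by rw [hv₂, hn]; exact v.2)
    refine this.trans ⟨fun h u hu hc => ?_, fun h u hu hc => ?_⟩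
    · exact h u hu ⟨hc.1, (h7 u v).2 hc.2⟩
    · exact h ⟨u, hu.trans v.2⟩ hu ⟨hc.1, (h7 ⟨u, hu.trans v.2⟩ v).1 hc.2⟩
  have hexists : ∀ v, ∃ p, IsFirstNearest G (colSet n s₃ 1) v p := fun v => by
    obtain ⟨p, hp, -⟩ := hnet.2 v
    exact exists_isFirstNearest ⟨p, hp⟩ v
  choose lab hlab using hexists
  have hl : ∀ v : Fin n, s₄.arr 2 v 0 = lab v := fun v =>
    labelCmd_spec (by rw [hv₃, hn]) h6' (hlab v)
  have hm : ∀ u < n, ∀ v < n, s₅.arr 3 u v ≠ 0 ↔ (labelMinor G lab).Adj u v :=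
    fun u hu v hv => minorCmd_spec (by rw [hv₄, hn]) hG' hl hu hv
  rw [hcol, h2F, h3F]
  refine ⟨hnet, lab, hlab, hl, fun u v => hm u u.2 v v.2, ?_⟩
  have hn₅ : s₅.var 0 = n := by rw [hv₅, hn]
  obtain ⟨A, U, P, X, w, hR, hA, hX⟩ := exists_localRatioRun (s := s₅) (H := labelMinor G lab)
    (by intro u hu v hv; rw [hn₅] at hu hv; exact hm u hu v hv)
  rw [hn₅] at hR
  refine ⟨A, U, P, X, w, hR, ?_, hX⟩
  rw [hA]
  simp only [colFin, run_var, hv₅, h1F]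
  rw [hs₅, run_arr_of_writes_eq_false _ (by rfl), hs₄, run_arr_of_writes_eq_false _ (by rfl)]

/-- The points of a set of vertices as natural numbers. -/
def netVal (N : Set (Fin n)) : N ↪ ℕ :=
  (Function.Embedding.subtype _).trans Fin.valEmbedding

open Classical in
theorem map_netVal_filter {N : Set (Fin n)} {s : Mem} (hn : s.var 0 = n) {a : ℕ}
    (h : ∀ v ∈ colFin s a, ∃ p : N, netVal N p = v) :
    (Finset.univ.filter fun p : N => s.arr a (p : Fin n) 0 ≠ 0).map (netVal N) = colFin s a := by
  ext v
  simp only [Finset.mem_map, Finset.mem_filter, Finset.mem_univ, true_and]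
  constructor
  · rintro ⟨p, hp, rfl⟩
    exact mem_colFin.2 ⟨by rw [hn]; exact p.1.2, hp⟩
  · intro hv
    obtain ⟨p, rfl⟩ := h v hv
    exact ⟨p, (mem_colFin.1 hv).2, rfl⟩

theorem degIn_induce_univ {V : Type*} [Fintype V] [DecidableEq V] (H : SimpleGraph V)
    (F : Finset V) (h : ∀ U : Finset {p | p ∉ F}, ∀ v, degIn (H.induce {p | p ∉ F}) U v ≤ 2) :
    ∀ v ∈ Finset.univ \ F, degIn H (Finset.univ \ F) v ≤ 2 := by
  classical
  intro v hv
  have hv' : v ∉ F := (Finset.mem_sdiff.1 hv).2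
  have hmap : (Finset.univ : Finset {p | p ∉ F}).map (Function.Embedding.subtype _) =
      Finset.univ \ F := by
    ext z; simp
  rw [← hmap]
  have := degIn_map (H.induce {p | p ∉ F}) H (Function.Embedding.subtype _) Finset.univ
    (fun _ _ _ _ => Iff.rfl) (Finset.mem_univ ⟨v, hv'⟩)
  exact this.le.trans (h _ _)

theorem algorithm_correct {k : ℕ} {c : ℚ} (hc : 1 ≤ c) {s s' : Mem} (hn : s.var 0 = n)
    (hk : s.var 1 = k) (h2 : s.var 2 = c.num.toNat) (h3 : s.var 3 = c.den)
    (hG : IsAdjMatrix G s 0) (hflag : s'.var 0 = flagExpr.eval (embeddingCmd.run s))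
    (harr : ∀ a < 20, s'.arr a = (embeddingCmd.run s).arr a) :
    (AnswersNo s' ∧ ¬ AdmitsEmbedding G k (c : ℝ) ∧ ¬ MetricAdmitsEmbedding G k (c : ℝ)) ∨
      ∃ o : Output n, Outputs s' o ∧ IsRPartition G (c : ℝ) o.net o.partition ∧
        o.minor = inducedMinor G o.net o.partition ∧ IsFeedbackVertexSet o.minor o.fvs ∧
        o.fvs.card ≤ 2 * k := by
  classical
  obtain ⟨hnet, lab, hlab, hl, hm, A, U, P, X, w, hR, hA, hX⟩ :=
    embeddingCmd_spec hc hn h2 h3 hG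
  set sF := embeddingCmd.run s with hsF
  have hnF : sF.var 0 = n := by rw [hsF, run_var, hn]
  set N := colSet n sF 1 with hN
  have hself : ∀ p ∈ N, lab p = p := fun p hp => (hlab p).unique (isFirstNearest_self hp)
  have hpart : IsRPartition G (c : ℝ) N (Setoid.ker lab) :=
    ⟨hnet, isVoronoiPartition_ker hnet hlab⟩
  have hadj : ∀ u v : N, (inducedMinor G N (Setoid.ker lab)).Adj u v ↔
      (labelMinor G lab).Adj (netVal N u) (netVal N v) := inducedMinor_adj_iff_labelMinor hself
  have hex : ∀ v ∈ colFin sF 1, ∃ p : N, netVal N p = v := fun v hv => by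
    obtain ⟨hv1, hv2⟩ := mem_colFin.1 hv
    rw [hnF] at hv1
    exact ⟨⟨⟨v, hv1⟩, hv2⟩, rfl⟩
  have hXA : colFin sF 4 ⊆ colFin sF 1 := by
    rw [← hX, ← hA]
    exact hR.subset
  set Y : Finset N := Finset.univ.filter fun p : N => sF.arr 4 (p : Fin n) 0 ≠ 0 with hY
  have hYmap : Y.map (netVal N) = colFin sF 4 :=
    map_netVal_filter hnF fun v hv => hex v (hXA hv)
  have hAmap : (Finset.univ : Finset N).map (netVal N) = colFin sF 1 := by
    rw [← map_netVal_filter hnF hex]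
    congr 1
    ext p
    have hp : sF.arr 1 (p : Fin n) 0 ≠ 0 := p.2
    simp [hp]
  have hsdiff : ∀ F : Finset N, A 0 \ F.map (netVal N) = (Finset.univ \ F).map (netVal N) :=
    fun F => by rw [hA, ← hAmap, Finset.map_sdiff]
  have hthick : ∀ W : Finset N, ThickFree (labelMinor G lab) (W.map (netVal N)) ↔
      ThickFree (inducedMinor G N (Setoid.ker lab)) W :=
    fun W => thickFree_map_iff _ _ _ _ fun u _ v _ => hadj u v
  by_cases hcard : (colFin sF 4).card ≤ 2 * k
  · right
    refine ⟨⟨N, Setoid.ker lab, inducedMinor G N (Setoid.ker lab), Y⟩, ⟨?_, ?_, ?_, ?_, ?_⟩,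
      hpart, rfl, ?_, ?_⟩
    · rw [hflag, flagExpr_eval, hsF, run_var, hk, ← hsF, if_pos hcard]
    · intro v
      rw [harr 1 (by omega)]
      rfl
    · intro u v
      rw [harr 2 (by omega), hl, hl]
      exact Fin.ext_iff.symm
    · intro u v
      rw [harr 3 (by omega), hm]
      exact (hadj u v).symm
    · intro v
      rw [harr 4 (by omega)]
      simp [hY]
    · refine isAcyclic_induce_of_thickFree fun W hW => ?_
      rw [← hthick]
      have hfree := hR.thickFree
      rw [hX, ← hYmap, hsdiff] at hfree
      exact hfree.mono (Finset.map_subset_map.2 fun v hv => by simpa using hW v hv)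
    · rw [← hYmap, Finset.card_map] at hcard
      exact hcard
  · left
    have hno : ¬ (AdmitsEmbedding G k (c : ℝ) ∨ MetricAdmitsEmbedding G k (c : ℝ)) := by
      intro h
      -- An embedding would give a set `F` of size at most `k` that leaves a linear forest, and then
      -- the computed set has at most `2k` points.
      obtain ⟨F, hF, hFk, hF2⟩ := minor_of_embeddable le_rfl h hpart
      refine hcard ?_
      have hle := hR.card_le_two_mul (F := F.map (netVal N)) ?_ ?_
      · rw [Finset.card_map, hX] at hle
        omega
      · rw [hsdiff, hthick]
        exact thickFree_of_isAcyclic hF fun v hv => (Finset.mem_sdiff.1 hv).2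
      · rw [hsdiff]
        intro u hu
        obtain ⟨v, hv, rfl⟩ := Finset.mem_map.1 hu
        rw [degIn_map (inducedMinor G N (Setoid.ker lab)) _ (netVal N) _
          (fun u _ v _ => hadj u v) hv]
        exact degIn_induce_univ _ F hF2 v hv
    exact ⟨by rw [AnswersNo, hflag, flagExpr_eval, hsF, run_var, hk, ← hsF, if_neg hcard],
      fun h => hno (Or.inl h), fun h => hno (Or.inr h)⟩

end Algorithm

end OutlierLine

end

theorem mainTheorem4 :
    -- the polynomial-time algorithm
    (∃ (A : OutlierLine.Prog) (T : Polynomial ℕ),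
      ∀ (n : ℕ) (G : SimpleGraph (Fin n)) (k : ℕ) (c : ℚ), 1 ≤ c →
        ∃ (t : ℕ) (s : OutlierLine.Mem),
          OutlierLine.Exec A (OutlierLine.inputMem G k c) t s ∧
          t ≤ T.eval (OutlierLine.inputSize n k c) ∧
          ((OutlierLine.AnswersNo s ∧
              ¬ OutlierLine.AdmitsEmbedding G k (c : ℝ) ∧
              ¬ OutlierLine.MetricAdmitsEmbedding G k (c : ℝ)) ∨
            (∃ o : OutlierLine.Output n, OutlierLine.Outputs s o ∧
              OutlierLine.IsRPartition G (c : ℝ) o.net o.partition ∧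
              o.minor = OutlierLine.inducedMinor G o.net o.partition ∧
              OutlierLine.IsFeedbackVertexSet o.minor o.fvs ∧
              o.fvs.card ≤ 2 * k))) ∧
    -- the existence of small feedback vertex sets in the minors of an embeddable graph
    (∀ (V : Type*) (G : SimpleGraph V) (k : ℕ) (c R : ℝ), 1 ≤ c → c ≤ R →
      (OutlierLine.AdmitsEmbedding G k c ∨ OutlierLine.MetricAdmitsEmbedding G k c) →
      ∀ (N : Set V) (P : Setoid V), OutlierLine.IsRPartition G R N P →
        ∃ X : Finset N,
          OutlierLine.IsFeedbackVertexSet (OutlierLine.inducedMinor G N P) X ∧ X.card ≤ k) := by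
  refine ⟨?_, fun V G k c R _ hcR h N P hP => ?_⟩
  -- All arrays and variables of the algorithm are below `20`, so everything from there on is free
  -- as scratch space.
  · obtain ⟨A, T, hA⟩ := OutlierLine.exists_prog (D := 20) (by omega) OutlierLine.embeddingCmd
      (by decide) OutlierLine.flagExpr (by decide)
    refine ⟨A, T, fun n G k c hc => ?_⟩
    obtain ⟨t, s, hex, ht, hflag, harr⟩ := hA (OutlierLine.inputMem G k c)
    refine ⟨t, s, hex, ht.trans (OutlierLine.monotone_polynomial_eval T ?_), ?_⟩
    -- The time bound is a polynomial in `n`, and the adjacency matrix alone has `n * n` bits.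
    · change n ≤ OutlierLine.inputSize n k c
      unfold OutlierLine.inputSize
      have := Nat.le_mul_self n
      omega
    · refine OutlierLine.algorithm_correct hc rfl rfl rfl rfl (fun u v => ?_) hflag harr
      simp [OutlierLine.inputMem]
  · obtain ⟨X, hX, hXk, -⟩ := OutlierLine.minor_of_embeddable hcR h hP
    exact ⟨X, hX, hXk⟩
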